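/- **Setting.** Fix $d\ge 1$ and put $\gamma=2/(3+d)$. For $L\in\mathbb R$ let $\mathcal L(L)$ be the set of probability densities $p$ on $\mathbb R^d$ with $|p(x)-p(y)|\le L\|x-y\|_2$ for all $x,y$. Write $P(A)=\int_A p$, $\|p-q\|_1=\int|p-q|$. Data are Poissonized: the sample size is $\mathrm{Poisson}(n)$ and, given it, the observations are i.i.d. with density $p$; $\mathbb P_p$ is the resulting probability. For a density $p_0$ let $$T_\sigma(p_0)=\inf\Big\{\Big(\int_B p_0^\gamma\Big)^{1/\gamma}: B \text{ Borel},\ P_0(B)\ge 1-\sigma\Big\}\in[0,\infty],$$ and let $w_n^a(p_0,L)$ be the solution $w>0$ of $$w=\Big(\frac{L^{d/2}\log(n)\,T_{cw}(p_0)}{n}\Big)^{2/(4+d)}.$$ **Binning test** with parameters $(L,\varepsilon,\alpha)$, $0<\varepsilon\le 2$. Put $\theta_1=\frac1{2L}$ and $\theta_2=\frac{\varepsilon}{8L\mu}$, where $\mu$ is the smallest positive number with $\varepsilon=\int\min\{4p_0,\ \varepsilon p_0^\gamma/\mu\}$. Put $a=b=\varepsilon/1024$, $\kappa=\varepsilon/512$.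 Let $S_a$ be the smallest cube centred at the mean of $p_0$ (at the origin if there is no mean) with $P_0(S_a)\ge 1-a$. All cubes are half-open. 1. *Partition.* Starting from $S_a$, treat each cube $Q$ with centroid $x_Q$ as follows: remove it if $\sup_Q p_0\le b/\mathrm{vol}(S_a)$; otherwise keep it if $\mathrm{diam}(Q)\le\min\{\theta_1p_0(x_Q),\theta_2p_0(x_Q)^\gamma\}$; otherwise replace it by its $2^d$ halves. Repeat until nothing changes, and order the kept cubes so that $P_0(A_1)\ge\dots\ge P_0(A_{\tilde N})$. 2. *Pruning.* Let $N$ be the least integer with $\mathcal Q:=\sum_{i>N}P_0(A_i)\le \kappa$. Retain $A_1,\dots,A_N$. If $\mathcal Q<\kappa/5$, also shrink the sides of $A_N$ by the factor $1-\min\{\kappa/(5P_0(A_N)),1/5\}$, keeping its lower corner. Let $A_\infty$ be the complement of the union of the resulting cubes. 3. *Multinomial test.* Sort the bins $A_1,\dots,A_N,A_\infty$ so that their null probabilities satisfy $q_1\ge q_2\ge\cdots$, let $X_j$ be the bin counts and put $\sigma=\varepsilon/64$. The tail is $\mathcal T=\{i:\sum_{j\ge i}q_j\le\sigma\}$ and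 the bulk is $\mathcal B=\{i>1: i\notin \mathcal T\}$. Reject iff $$\sum_{j\in\mathcal T}(X_j-nq_j)>\sqrt{\frac{n\sum_{j\in\mathcal T}q_j}{\alpha/2}}\quad\text{or}\quad \sum_{j\in\mathcal B}\frac{(X_j-nq_j)^2-X_j}{q_j^{2/3}}>\sqrt{\frac{\sum_{j\in\mathcal B}2n^2q_j^{2/3}}{\alpha/2}} .$$ **Adaptive Lipschitz test** (constants $c,A,C$; null $p_0\in\mathcal L(L_0)$; $\alpha,\zeta>0$). Let $K=\lceil\log_2(An^{2/d})+1\rceil$. For each $L$ in the grid $\{L_0,2L_0,\dots,2^{K-1}L_0\}$ run the binning test with parameters $L$, $\varepsilon=\min\{2,\tfrac C2\max\{\tfrac1\alpha,\tfrac1\zeta\}\,w_n^a(p_0,L)\}$ and level $\alpha/K$. Reject iff at least one of them rejects. **Theorem.** For every $d\ge1$ the following holds for all sufficiently small $c>0$, all sufficiently large $A\ge 1$ (depending on $d,c$) and all sufficiently large $C>0$ (depending on $d,c,A$). For all $\alpha,\zeta>0$, all integers $n\ge2$, all $L_0$ and all $p_0\in\mathcal L(L_0)$: the equation for $w_n^a(p_0,L)$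 has exactly one positive solution for every $L\ge L_0$, the adaptive Lipschitz test $\phi$ is Borel measurable, and * (Type I) $\mathbb P_{p_0}(\phi=1)\le\alpha$; * (Type II) $\mathbb P_p(\phi=0)\le\zeta$ for every $L\ge L_0$ and every $p\in\mathcal L(L)$ with $\|p-p_0\|_1\ge C\max\{1/\alpha,1/\zeta\}\,w_n^a(p_0,L)$. -/

import Mathlib

open MeasureTheory ProbabilityTheory
open scoped ENNReal NNReal

noncomputable section

namespace LipTest

/-! ### Lipschitz densities and the Poissonized sampling model -/

/-- `ℝ^d` with the Euclidean norm. -/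
abbrev Pt (d : ℕ) : Type := EuclideanSpace ℝ (Fin d)

/-- The class `𝓛(L)` of `L`-Lipschitz probability densities on `ℝ^d`. (A Bochner integral equal to
`1` includes integrability.) -/
structure IsLipDensity {d : ℕ} (L : ℝ) (p : Pt d → ℝ) : Prop where
  nonneg : ∀ x, 0 ≤ p x
  integral_eq_one : ∫ x, p x = 1
  lipschitz : ∀ x y, |p x - p y| ≤ L * ‖x - y‖

/-- The distribution with Lebesgue density `p`. -/
def law {d : ℕ} (p : Pt d → ℝ) : Measure (Pt d) :=
  volume.withDensity fun x => ENNReal.ofReal (p x)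

/-- `P(A)` as a real number. -/
def mass {d : ℕ} (p : Pt d → ℝ) (A : Set (Pt d)) : ℝ := (law p).real A

/-- `‖P - P₀‖₁`. -/
def l1Dist {d : ℕ} (p p₀ : Pt d → ℝ) : ℝ := ∫ x, |p x - p₀ x|

/-- A test for samples of arbitrary size, given by its rejection regions: `R m` is the set of
samples of size `m` on which the null hypothesis is rejected. -/
abbrev Test (d : ℕ) : Type := ∀ m : ℕ, Set (Fin m → Pt d)

/-- Probability that the sample lies in `R` when the sample size is `Poisson(n)` and, given the
sample size, the observations are independent with density `p`. -/
def poissonProb {d : ℕ} (n : ℕ) (p : Pt d → ℝ) (R : Test d) : ℝ≥0∞ :=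
  ∑' m : ℕ, poissonMeasure (n : ℝ≥0) {m} * Measure.pi (fun _ : Fin m => law p) (R m)

/-- Probability of rejection. -/
def rejectProb {d : ℕ} (n : ℕ) (p : Pt d → ℝ) (R : Test d) : ℝ≥0∞ := poissonProb n p R

/-- Probability of acceptance. -/
def acceptProb {d : ℕ} (n : ℕ) (p : Pt d → ℝ) (R : Test d) : ℝ≥0∞ :=
  poissonProb n p fun m => (R m)ᶜ

/-! ### The truncated `T`-functional and the adaptive critical radius -/

/-- The exponent `γ = 2 / (3 + d)`. -/
def gam (d : ℕ) : ℝ := 2 / (3 + d)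

/-- The truncated `T`-functional
`T_σ(p₀) = inf { (∫_B p₀^γ)^(1/γ) : B Borel, P₀(B) ≥ 1 - σ }`, with values in `[0, ∞]`. -/
def truncT {d : ℕ} (p₀ : Pt d → ℝ) (σ : ℝ) : ℝ≥0∞ :=
  ⨅ B ∈ {B : Set (Pt d) | MeasurableSet B ∧ ENNReal.ofReal (1 - σ) ≤ law p₀ B},
    (∫⁻ x in B, ENNReal.ofReal (p₀ x ^ gam d)) ^ (1 / gam d)

/-- `w > 0` solves the adaptive critical equation
`w = (L^(d/2) log(n) T_{c w}(p₀) / n)^(2/(4+d))`. -/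
def SolvesAdaptiveEq {d : ℕ} (c : ℝ) (n : ℕ) (p₀ : Pt d → ℝ) (L w : ℝ) : Prop :=
  0 < w ∧ ENNReal.ofReal w =
    (ENNReal.ofReal (L ^ ((d : ℝ) / 2) * Real.log n / n) * truncT p₀ (c * w)) ^
      ((2 : ℝ) / (4 + d))

/-- The adaptive critical radius `wᵃ_n(p₀, L)`: the solution of the adaptive critical equation. -/
def adaptiveRadius {d : ℕ} (c : ℝ) (n : ℕ) (p₀ : Pt d → ℝ) (L : ℝ) : ℝ :=
  sInf {w | SolvesAdaptiveEq c n p₀ L w}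

/-! ### Cubes and the recursive partition -/

/-- A half-open axis-parallel cube, given by its lower corner and its side length. -/
structure Cube (d : ℕ) where
  corner : Fin d → ℝ
  side : ℝ

namespace Cube

variable {d : ℕ}

/-- The set of points of the cube. -/
def toSet (Q : Cube d) : Set (Pt d) := {x | ∀ i, Q.corner i ≤ x i ∧ x i < Q.corner i + Q.side}

/-- The centroid. -/
def center (Q : Cube d) : Pt d := WithLp.toLp 2 fun i => Q.corner i + Q.side / 2

/-- The Euclidean diameter of the cube. -/
def diam (Q : Cube d) : ℝ := Real.sqrt d * Q.side

/-- The volume. -/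
def vol (Q : Cube d) : ℝ := Q.side ^ d

/-- The `2^d` cubes obtained by halving each side; `s` says on which axes the upper half is
taken. -/
def child (Q : Cube d) (s : Fin d → Bool) : Cube d where
  corner i := Q.corner i + if s i then Q.side / 2 else 0
  side := Q.side / 2

/-- Shrink the sides by the factor `t`, keeping the lower corner. -/
def shrink (Q : Cube d) (t : ℝ) : Cube d where
  corner := Q.corner
  side := t * Q.side

end Cube

/-- The cube with centre `x` and half side length `r`. -/
def cubeAt {d : ℕ} (x : Pt d) (r : ℝ) : Cube d where
  corner i := x i - r
  side := 2 * r

/-- The mean of `p₀`; the Bochner integral makes it the origin if `p₀` has no mean. -/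
def mean {d : ℕ} (p₀ : Pt d → ℝ) : Pt d := ∫ x, p₀ x • x

/-- `S_a`: the smallest cube centred at the mean of `p₀` with `P₀(S_a) ≥ 1 - a`. -/
def effSupport {d : ℕ} (p₀ : Pt d → ℝ) (a : ℝ) : Cube d :=
  cubeAt (mean p₀) (sInf {r : ℝ | 0 < r ∧ 1 - a ≤ mass p₀ (cubeAt (mean p₀) r).toSet})

/-- First stopping rule: the density is at most `t` on the cube, which is then removed. -/
def Removed {d : ℕ} (p₀ : Pt d → ℝ) (t : ℝ) (Q : Cube d) : Prop := ∀ x ∈ Q.toSet, p₀ x ≤ t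

/-- Second stopping rule: the cube is small enough, and is then left as it is. -/
def SmallEnough {d : ℕ} (p₀ : Pt d → ℝ) (θ₁ θ₂ : ℝ) (Q : Cube d) : Prop :=
  Q.diam ≤ min (θ₁ * p₀ Q.center) (θ₂ * p₀ Q.center ^ gam d)

/-- The cubes that the recursive partitioning started at `S₀` ever visits: a visited cube to which
neither stopping rule applies is replaced by its `2^d` halves. -/
inductive Visited {d : ℕ} (p₀ : Pt d → ℝ) (t θ₁ θ₂ : ℝ) (S₀ : Cube d) : Cube d → Prop
  | root : Visited p₀ t θ₁ θ₂ S₀ S₀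
  | split (Q : Cube d) (s : Fin d → Bool) (h : Visited p₀ t θ₁ θ₂ S₀ Q)
      (h₁ : ¬ Removed p₀ t Q) (h₂ : ¬ SmallEnough p₀ θ₁ θ₂ Q) :
      Visited p₀ t θ₁ θ₂ S₀ (Q.child s)

/-- The cubes in the output of the adaptive partition algorithm (the remaining cell `A_∞` is the
complement of their union). -/
def partitionCubes {d : ℕ} (p₀ : Pt d → ℝ) (θ₁ θ₂ a b : ℝ) : Set (Cube d) :=
  {Q | Visited p₀ (b / (effSupport p₀ a).vol) θ₁ θ₂ (effSupport p₀ a) Q ∧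
    ¬ Removed p₀ (b / (effSupport p₀ a).vol) Q ∧ SmallEnough p₀ θ₁ θ₂ Q}

/-- Sort a list of sets, carried by objects of type `β`, by decreasing `P₀`-mass. -/
def sortByMass {d : ℕ} {β : Type} (p₀ : Pt d → ℝ) (f : β → Set (Pt d)) (l : List β) : List β :=
  l.mergeSort fun A B => decide (mass p₀ (f B) ≤ mass p₀ (f A))

open Classical in
/-- The cubes of the adaptive partition, listed by decreasing probability content. -/
def partitionList {d : ℕ} (p₀ : Pt d → ℝ) (θ₁ θ₂ a b : ℝ) : List (Cube d) :=
  if h : (partitionCubes p₀ θ₁ θ₂ a b).Finite then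
    sortByMass p₀ Cube.toSet h.toFinset.toList
  else []

/-- Total `P₀`-mass of the cubes of the list from position `j` (counted from `0`) on. -/
def tailMass {d : ℕ} (p₀ : Pt d → ℝ) (l : List (Cube d)) (j : ℕ) : ℝ :=
  ((l.drop j).map fun Q => mass p₀ Q.toSet).sum

/-- The number of cubes retained by the pruning: the least `N` such that the cubes after the
first `N` have total mass at most `c`. -/
def pruneCount {d : ℕ} (p₀ : Pt d → ℝ) (c : ℝ) (l : List (Cube d)) : ℕ :=
  sInf {j | tailMass p₀ l j ≤ c}

open Classical in
/-- The pruning algorithm with pruning level `c`, applied to a list sorted by decreasing mass. The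
first `N` cubes are retained. If the mass of the others is less than `c / 5`, then the last retained
cube `A_N` is moreover shrunk by the factor `1 - min(c / (5 P₀(A_N)), 1/5)`. -/
def prune {d : ℕ} (p₀ : Pt d → ℝ) (c : ℝ) (l : List (Cube d)) : List (Cube d) :=
  let kept := l.take (pruneCount p₀ c l)
  if c / 5 ≤ tailMass p₀ l (pruneCount p₀ c l) then kept
  else kept.dropLast ++ (kept.getLast?.map fun Q =>
    Q.shrink (1 - min (c / (5 * mass p₀ Q.toSet)) (1 / 5))).toList

/-- `μ(x)`: the smallest positive `m` with `ε = ∫ min(p₀(y) / x, ε p₀(y)^γ / m) dy`. -/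
def muFun {d : ℕ} (p₀ : Pt d → ℝ) (ε x : ℝ) : ℝ :=
  sInf {m : ℝ | 0 < m ∧ ε = ∫ y, min (p₀ y / x) (ε * p₀ y ^ gam d / m)}

/-- The cubes `A₁, …, A_N` of the pruned partition for Lipschitz constant `L` and separation `ε`:
`θ₁ = 1/(2L)`, `θ₂ = ε/(8 L μ(1/4))`, `a = b = ε/1024`, `c = ε/512`. -/
def prunedCubes {d : ℕ} (p₀ : Pt d → ℝ) (L ε : ℝ) : List (Cube d) :=
  prune p₀ (ε / 512)
    (partitionList p₀ (1 / (2 * L)) (ε / (8 * L * muFun p₀ ε (1 / 4))) (ε / 1024) (ε / 1024))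

/-- All bins `A₁, …, A_N, A_∞`, listed by decreasing `P₀`-mass; `A_∞` is the complement of the
union of the cubes. -/
def bins {d : ℕ} (p₀ : Pt d → ℝ) (L ε : ℝ) : List (Set (Pt d)) :=
  sortByMass p₀ id
    ((prunedCubes p₀ L ε).map Cube.toSet ++ [(⋃ Q ∈ prunedCubes p₀ L ε, Q.toSet)ᶜ])

/-! ### The composite `2/3`-rd + tail test for multinomials -/

section Multinomial

variable {k : ℕ}

open Classical in
/-- The `σ`-tail of a multinomial `q` with `q 0 ≥ q 1 ≥ …`. -/
def multTail (q : Fin k → ℝ) (σ : ℝ) : Finset (Fin k) :=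
  Finset.univ.filter fun i => ∑ j ∈ Finset.Ici i, q j ≤ σ

open Classical in
/-- The `σ`-bulk: neither the first (most likely) category nor in the `σ`-tail. -/
def multBulk (q : Fin k → ℝ) (σ : ℝ) : Finset (Fin k) :=
  Finset.univ.filter fun i => 0 < (i : ℕ) ∧ i ∉ multTail q σ

/-- The tail test rejects for the counts `X`. -/
def TailRejects (n : ℕ) (q : Fin k → ℝ) (σ α : ℝ) (X : Fin k → ℕ) : Prop :=
  Real.sqrt (n * (∑ j ∈ multTail q σ, q j) / α) < ∑ j ∈ multTail q σ, ((X j : ℝ) - n * q j)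

/-- The `2/3`-test rejects for the counts `X`. -/
def TwoThirdsRejects (n : ℕ) (q : Fin k → ℝ) (σ α : ℝ) (X : Fin k → ℕ) : Prop :=
  Real.sqrt ((∑ j ∈ multBulk q σ, 2 * (n : ℝ) ^ 2 * q j ^ ((2 : ℝ) / 3)) / α) <
    ∑ j ∈ multBulk q σ, (((X j : ℝ) - n * q j) ^ 2 - X j) / q j ^ ((2 : ℝ) / 3)

/-- The composite test `φ_V(σ, α)` rejects: one of the two tests rejects at level `α / 2`. -/
def CompositeRejects (n : ℕ) (q : Fin k → ℝ) (σ α : ℝ) (X : Fin k → ℕ) : Prop :=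
  TailRejects n q σ (α / 2) X ∨ TwoThirdsRejects n q σ (α / 2) X

end Multinomial

/-! ### The binning test and the adaptive Lipschitz test -/

open Classical in
/-- Number of sample points in `A`. -/
def count {d m : ℕ} (z : Fin m → Pt d) (A : Set (Pt d)) : ℕ :=
  (Finset.univ.filter fun i => z i ∈ A).card

/-- The binning test for Lipschitz constant `L`, separation `ε` and level `α`: the composite test
applied to the bin counts. The binning keeps a multinomial separation of `ε / 8`, and the composite
test has truncation parameter one eighth of that separation, i.e. `σ = (ε / 8) / 8`. -/
def binningTest {d : ℕ} (n : ℕ) (p₀ : Pt d → ℝ) (L ε α : ℝ) : Test d := fun _ =>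
  {z | CompositeRejects n (fun i => mass p₀ ((bins p₀ L ε).get i)) (ε / 8 / 8) α
    fun i => count z ((bins p₀ L ε).get i)}

/-- Number of points of the dyadic grid `{L₀, 2 L₀, …, 2^⌈log₂(A n^(2/d))⌉ L₀}` of Lipschitz
constants. -/
def gridSize (d : ℕ) (A : ℝ) (n : ℕ) : ℕ :=
  ⌈Real.logb 2 (A * (n : ℝ) ^ ((2 : ℝ) / d)) + 1⌉₊

/-- The separation `C max(1/α, 1/ζ) wᵃ_n(p₀, L)`. -/
def separation {d : ℕ} (c C α ζ : ℝ) (n : ℕ) (p₀ : Pt d → ℝ) (L : ℝ) : ℝ :=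
  C * max (1 / α) (1 / ζ) * adaptiveRadius c n p₀ L

/-- The separation for which the binning test at Lipschitz constant `L` is tuned. Half of the
constant `C` is used since consecutive grid points differ by the factor `2`, and the separation is
capped at `2`, the largest possible value of `‖p - p₀‖₁`. -/
def tunedSeparation {d : ℕ} (c C α ζ : ℝ) (n : ℕ) (p₀ : Pt d → ℝ) (L : ℝ) : ℝ :=
  min 2 (separation c (C / 2) α ζ n p₀ L)

/-- The adaptive Lipschitz test: it rejects when for some `L` in the grid the binning test, run at
the Bonferroni corrected level `α / gridSize`, rejects. -/
def adaptiveTest {d : ℕ} (c A C α ζ : ℝ) (n : ℕ) (L₀ : ℝ) (p₀ : Pt d → ℝ) : Test d := fun m =>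
  ⋃ j ∈ Finset.range (gridSize d A n),
    binningTest n p₀ (2 ^ j * L₀) (tunedSeparation c C α ζ n p₀ (2 ^ j * L₀))
      (α / gridSize d A n) m

end LipTest

end

/-!
Why the adaptive Lipschitz test has the stated error probabilities.

*Poissonization.* With a `Poisson(n)` sample size, the counts in the bins of a measurable partition
are independent Poisson variables with means `n P(A_j)` (`countLaw_eq_pi`). Both laws satisfy the
recursion `(x_j + 1) π(x + e_j) = n P(A_j) π(x)` and agree at `0`, and this determines them. So the
composite test is analysed with Chebyshev's inequality for sums of independent terms. Under the null
the two statistics have mean `0` and their variances are at most the squared thresholds times the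
level (`composite_typeI`). Under an alternative whose bin probabilities differ from the null ones by
`ε / 2` in `ℓ₁`, either the tail or the bulk carries a fixed part of the difference (`tail_or_bulk`),
and the corresponding test detects it once `n ε` and `n ε ^ 2 / s ^ 3` are large compared with the
reciprocal error levels, where `s ^ 2` bounds the sum of `q_j ^ (2 / 3)` over the bulk
(`composite_typeII`).

*Binning.* The recursive partition stops after finitely many steps, since `p₀` is Lipschitz and the
cubes on which it is below a fixed level are removed (`goodPartition`). A kept cube has diameter
comparable with `min (θ₁ ρ) (θ₂ ρ ^ γ)`, where `ρ` is the value of `p₀` at its centre, and `p₀` is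
comparable with `ρ` on it (`keptCube_diam`). The upper bound on the diameter, with the choice of `μ`
in `θ₂`, makes the loss of `ℓ₁` separation inside the cubes at most a third of `ε`, and the residual
bin has mass at most `ε / 15`; so half of the separation survives the binning
(`GoodBins.half_le_sum`). The lower bound on the diameter bounds `P₀(Q) ^ (2 / 3)` by a multiple of
`∫_Q p₀ ^ γ`. Summing over the bulk and comparing with a nearly optimal set in the definition of the
truncated functional gives `s ^ 3 ≲ (L / ε) ^ (d / 2) T_{ε / 512}(p₀) + ε`
(`GoodBins.sum_bulk_le`, `GoodBins.exists_sum_bulk_le`).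

*Radius.* `T_σ(p₀)` is finite, continuous and antitone in `σ > 0`, vanishes for `σ ≥ 1`, and is at
least a constant times `L ^ (-d / 2)` for `σ ≤ 1 / 2` (`lowerConst_le`). Hence the critical equation
has exactly one positive solution (`existsUnique_solvesAdaptiveEq`), the radius is at least of order
`log n / n` as long as it is small, and doubling the Lipschitz constant at most doubles it
(`adaptiveRadius_le_two_mul`).

*Adaptation.* The size of the grid is of order `log n`, which the factor `log n` in the critical
equation absorbs in the Bonferroni correction; the type I error follows by the union bound. An
alternative with constant `L` in the range of the grid is treated at a grid point `L'` with
`L ≤ L' ≤ 2 L`, where the tuned separation is at most the separation at `L`; the equation for the radius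
at `L'` turns the two conditions of `composite_typeII` into lower bounds on `C`. Beyond the grid the
radius is at least `1 / (2 c)`, so the required separation exceeds `2` and there is no alternative
(`one_div_le_adaptiveRadius`).
-/

noncomputable section

namespace LipTest

/-! ### Moments of the Poisson distribution -/

lemma hasSum_poisson_descFactorial (r : ℝ≥0) (k : ℕ) :
    HasSum (fun m : ℕ => Real.exp (-r) * r ^ m / m.factorial * (m.descFactorial k : ℝ))
      ((r : ℝ) ^ k) := by
  rw [← hasSum_nat_add_iff' k]
  have h0 : ∑ i ∈ Finset.range k,
      Real.exp (-r) * (r : ℝ) ^ i / i.factorial * (i.descFactorial k : ℝ) = 0 := by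
    refine Finset.sum_eq_zero fun i hi => ?_
    rw [Nat.descFactorial_eq_zero_iff_lt.2 (Finset.mem_range.1 hi)]
    simp
  rw [h0, sub_zero]
  have h := (hasSum_one_poissonMeasure r).mul_left ((r : ℝ) ^ k)
  rw [mul_one] at h
  refine (congrArg (HasSum · _) (funext fun m => ?_)).mp h
  have h1 : (m.factorial : ℝ) * ((m + k).descFactorial k : ℝ) = ((m + k).factorial : ℝ) := by
    have := Nat.factorial_mul_descFactorial (Nat.le_add_left k m)
    rw [Nat.add_sub_cancel] at this
    exact_mod_cast this
  have h2 : (m.factorial : ℝ) ≠ 0 := by positivity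
  have h3 : ((m + k).factorial : ℝ) ≠ 0 := by positivity
  rw [← h1] at h3 ⊢
  have h4 : ((m + k).descFactorial k : ℝ) ≠ 0 := right_ne_zero_of_mul h3
  field_simp
  ring

lemma integrable_descFactorial (r : ℝ≥0) (k : ℕ) :
    Integrable (fun m : ℕ => (m.descFactorial k : ℝ)) (poissonMeasure r) := by
  rw [integrable_poissonMeasure_iff]
  simpa using (hasSum_poisson_descFactorial r k).summable

lemma integral_descFactorial (r : ℝ≥0) (k : ℕ) :
    ∫ m : ℕ, (m.descFactorial k : ℝ) ∂poissonMeasure r = (r : ℝ) ^ k := by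
  rw [integral_poissonMeasure]
  exact (hasSum_poisson_descFactorial r k).tsum_eq

lemma cast_eq_descFactorial_one (m : ℕ) : (m : ℝ) = (m.descFactorial 1 : ℝ) := by simp

lemma sq_eq_descFactorial (m : ℕ) :
    (m : ℝ) ^ 2 = (m.descFactorial 2 : ℝ) + (m.descFactorial 1 : ℝ) := by
  rcases m with _ | m
  · simp
  · simp [Nat.descFactorial_succ]; ring

/-- The recentred square `(X - c)² - X` of a Poisson variable, in terms of factorial moments. -/
lemma recentred_eq_descFactorial (c : ℝ) (m : ℕ) :
    ((m : ℝ) - c) ^ 2 - m =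
      (m.descFactorial 2 : ℝ) - 2 * c * (m.descFactorial 1 : ℝ) + c ^ 2 := by
  have h := sq_eq_descFactorial m
  have h1 := cast_eq_descFactorial_one m
  linear_combination h + (-2 * c - 1) * h1

lemma recentred_sq_eq_descFactorial (c : ℝ) (m : ℕ) :
    (((m : ℝ) - c) ^ 2 - m) ^ 2 =
      (m.descFactorial 4 : ℝ) + (4 - 4 * c) * (m.descFactorial 3 : ℝ)
        + (2 + 6 * c ^ 2 - 8 * c) * (m.descFactorial 2 : ℝ)
        + (4 * c ^ 2 - 4 * c ^ 3) * (m.descFactorial 1 : ℝ) + c ^ 4 := by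
  rcases m with _ | _ | _ | m
  · simp; ring
  · simp [Nat.descFactorial_succ]; ring
  · simp [Nat.descFactorial_succ]; ring
  · simp [Nat.descFactorial_succ]; ring

lemma integral_poisson_id (r : ℝ≥0) : ∫ m : ℕ, (m : ℝ) ∂poissonMeasure r = r := by
  simpa using integral_descFactorial r 1

lemma memLp_poisson_of_sq {r : ℝ≥0} {f : ℕ → ℝ}
    (h : Integrable (fun m => f m ^ 2) (poissonMeasure r)) : MemLp f 2 (poissonMeasure r) :=
  (memLp_two_iff_integrable_sq (Measurable.of_discrete.aestronglyMeasurable)).2 h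

lemma memLp_poisson_id (r : ℝ≥0) : MemLp (fun m : ℕ => (m : ℝ)) 2 (poissonMeasure r) := by
  refine memLp_poisson_of_sq ?_
  simp_rw [sq_eq_descFactorial]
  exact (integrable_descFactorial r 2).add (integrable_descFactorial r 1)

lemma variance_poisson_id (r : ℝ≥0) : Var[fun m : ℕ => (m : ℝ); poissonMeasure r] = r := by
  rw [variance_eq_sub (memLp_poisson_id r)]
  have : ∫ m : ℕ, (m : ℝ) ^ 2 ∂poissonMeasure r = (r : ℝ) ^ 2 + r := by
    simp_rw [sq_eq_descFactorial]
    rw [integral_add (integrable_descFactorial r 2) (integrable_descFactorial r 1),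
      integral_descFactorial, integral_descFactorial, pow_one]
  simp only [Pi.pow_apply, this, integral_poisson_id]
  ring

lemma integral_recentred (r : ℝ≥0) (c : ℝ) :
    ∫ m : ℕ, (((m : ℝ) - c) ^ 2 - m) ∂poissonMeasure r = (r - c) ^ 2 := by
  simp_rw [recentred_eq_descFactorial]
  have h2 := integrable_descFactorial r 2
  have h1 := (integrable_descFactorial r 1).const_mul (2 * c)
  rw [integral_add (f := fun m : ℕ => (m.descFactorial 2 : ℝ) - 2 * c * (m.descFactorial 1 : ℝ))
    (h2.sub h1) (integrable_const _), integral_sub h2 h1, integral_const_mul,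
    integral_descFactorial, integral_descFactorial]
  simp
  ring

lemma memLp_recentred (r : ℝ≥0) (c : ℝ) :
    MemLp (fun m : ℕ => ((m : ℝ) - c) ^ 2 - m) 2 (poissonMeasure r) := by
  refine memLp_poisson_of_sq ?_
  simp_rw [recentred_sq_eq_descFactorial]
  exact ((((integrable_descFactorial r 4).add ((integrable_descFactorial r 3).const_mul _)).add
    ((integrable_descFactorial r 2).const_mul _)).add
    ((integrable_descFactorial r 1).const_mul _)).add (integrable_const _)

lemma variance_recentred (r : ℝ≥0) (c : ℝ) :
    Var[fun m : ℕ => ((m : ℝ) - c) ^ 2 - m; poissonMeasure r] =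
      2 * (r : ℝ) ^ 2 + 4 * r * (r - c) ^ 2 := by
  rw [variance_eq_sub (memLp_recentred r c)]
  have : ∫ m : ℕ, (((m : ℝ) - c) ^ 2 - m) ^ 2 ∂poissonMeasure r =
      (r : ℝ) ^ 4 + (4 - 4 * c) * (r : ℝ) ^ 3 + (2 + 6 * c ^ 2 - 8 * c) * (r : ℝ) ^ 2
        + (4 * c ^ 2 - 4 * c ^ 3) * r + c ^ 4 := by
    simp_rw [recentred_sq_eq_descFactorial]
    have h4 := integrable_descFactorial r 4
    have h3 := (integrable_descFactorial r 3).const_mul (4 - 4 * c)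
    have h2 := (integrable_descFactorial r 2).const_mul (2 + 6 * c ^ 2 - 8 * c)
    have h1 := (integrable_descFactorial r 1).const_mul (4 * c ^ 2 - 4 * c ^ 3)
    have h43 := h4.add h3
    have h432 := h43.add h2
    have h4321 := h432.add h1
    simp only [Pi.add_def] at h43 h432 h4321
    rw [integral_add h4321 (integrable_const _), integral_add h432 h1, integral_add h43 h2,
      integral_add h4 h3]
    simp only [integral_const_mul, integral_descFactorial]
    simp
  simp only [Pi.pow_apply, this, integral_recentred]
  ring

/-! ### Poissonized bin counts are independent Poisson variables -/

section CountLaw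

variable {d k : ℕ}

lemma measurable_count {m : ℕ} {A : Set (Pt d)} (hA : MeasurableSet A) :
    Measurable fun z : Fin m → Pt d => count z A := by
  classical
  have : (fun z : Fin m → Pt d => count z A) = fun z => ∑ i, A.indicator (fun _ => 1) (z i) := by
    funext z
    rw [count, Finset.card_filter]
    simp only [Set.indicator_apply]
  rw [this]
  exact Finset.measurable_sum _ fun i _ =>
    (measurable_const.indicator hA).comp (measurable_pi_apply i)

lemma measurable_counts {m : ℕ} {A : Fin k → Set (Pt d)} (hA : ∀ j, MeasurableSet (A j)) :
    Measurable fun (z : Fin m → Pt d) j => count z (A j) :=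
  measurable_pi_lambda _ fun j => measurable_count (hA j)

open Classical in
lemma count_insertNth {m : ℕ} (i : Fin (m + 1)) (y : Pt d) (z : Fin m → Pt d) (A : Set (Pt d)) :
    count (i.insertNth (α := fun _ => Pt d) y z) A = (if y ∈ A then 1 else 0) + count z A := by
  simp only [count, Finset.card_filter]
  rw [Fin.sum_univ_succAbove _ i]
  simp

/-- Splitting off one observation: removing a point of the bin `A j` from a sample of size `m + 1`
with bin counts `x + e_j` leaves a sample of size `m` with bin counts `x`. -/
lemma count_recursion {ν : Measure (Pt d)} [IsProbabilityMeasure ν] {A : Fin k → Set (Pt d)}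
    (hA : ∀ j, MeasurableSet (A j)) (hdisj : Pairwise fun i j => Disjoint (A i) (A j))
    (x : Fin k → ℕ) (j : Fin k) (m : ℕ) :
    ((x j + 1 : ℕ) : ℝ≥0∞) * Measure.pi (fun _ : Fin (m + 1) => ν)
        {z | (fun l => count z (A l)) = x + Pi.single j 1} =
      (m + 1 : ℕ) * (ν (A j) * Measure.pi (fun _ : Fin m => ν)
        {z | (fun l => count z (A l)) = x}) := by
  classical
  set E := {z : Fin (m + 1) → Pt d | (fun l => count z (A l)) = x + Pi.single j 1} with hE
  have hEm : MeasurableSet E := measurable_counts hA (measurableSet_singleton _)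
  -- the point `i` lies in the bin `j`
  let F : Fin (m + 1) → Set (Fin (m + 1) → Pt d) := fun i => {z | z i ∈ A j}
  have hFm : ∀ i, MeasurableSet (F i) := fun i => measurable_pi_apply i (hA j)
  have h1 : ((x j + 1 : ℕ) : ℝ≥0∞) * Measure.pi (fun _ : Fin (m + 1) => ν) E =
      ∑ i, Measure.pi (fun _ : Fin (m + 1) => ν) (E ∩ F i) := by
    have : ∀ i, Measure.pi (fun _ : Fin (m + 1) => ν) (E ∩ F i) =
        ∫⁻ z in E, (F i).indicator 1 z ∂Measure.pi (fun _ : Fin (m + 1) => ν) := by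
      intro i
      rw [lintegral_indicator_one (hFm i), Measure.restrict_apply (hFm i), Set.inter_comm]
    simp_rw [this]
    rw [← lintegral_finsetSum' _ fun i _ => (measurable_one.indicator (hFm i)).aemeasurable,
      ← setLIntegral_const]
    refine setLIntegral_congr_fun hEm fun z hz => ?_
    have hz' : count z (A j) = x j + 1 := by
      have := congrFun hz j
      simpa using this
    rw [← hz']
    rw [count, Finset.card_filter]
    simp only [F, Set.indicator_apply, Set.mem_ofPred_eq, Pi.one_apply]
    push_cast
    rfl
  have h2 : ∀ i, Measure.pi (fun _ : Fin (m + 1) => ν) (E ∩ F i) =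
      ν (A j) * Measure.pi (fun _ : Fin m => ν) {z | (fun l => count z (A l)) = x} := by
    intro i
    have hmp := (measurePreserving_piFinSuccAbove (fun _ : Fin (m + 1) => ν) i).symm
    rw [← hmp.measure_preimage (hEm.inter (hFm i)).nullMeasurableSet, ← Measure.prod_prod]
    congr 1
    ext ⟨y, z⟩
    have hins : (MeasurableEquiv.piFinSuccAbove (fun _ : Fin (m + 1) => Pt d) i).symm (y, z) =
        i.insertNth (α := fun _ => Pt d) y z := rfl
    simp only [Set.mem_preimage, hins, Set.mem_inter_iff, hE, Set.mem_ofPred_eq, F,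
      Fin.insertNth_apply_same, Set.mem_prod, count_insertNth]
    constructor
    · rintro ⟨h, hy⟩
      refine ⟨hy, funext fun l => ?_⟩
      have hl := congrFun h l
      by_cases hlj : l = j
      · subst hlj
        simp only [hy, if_true, Pi.add_apply, Pi.single_eq_same] at hl
        omega
      · have : y ∉ A l := fun hyl => (Set.disjoint_left.1 (hdisj hlj) hyl) hy
        simpa [this, hlj] using hl
    · rintro ⟨hy, h⟩
      refine ⟨funext fun l => ?_, hy⟩
      have hl := congrFun h l
      by_cases hlj : l = j
      · subst hlj
        simp only [hy, if_true, Pi.add_apply, Pi.single_eq_same]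
        omega
      · have : y ∉ A l := fun hyl => (Set.disjoint_left.1 (hdisj hlj) hyl) hy
        simpa [this, hlj] using hl
  rw [h1]
  simp [h2]

lemma succ_mul_poissonMeasure (r : ℝ≥0) (m : ℕ) :
    ((m + 1 : ℕ) : ℝ≥0∞) * poissonMeasure r {m + 1} = r * poissonMeasure r {m} := by
  rw [poissonMeasure_singleton, poissonMeasure_singleton, ← ENNReal.ofReal_natCast,
    ← ENNReal.ofReal_coe_nnreal (p := r), ← ENNReal.ofReal_mul (by positivity),
    ← ENNReal.ofReal_mul (by positivity), Nat.factorial_succ]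
  congr 1
  push_cast
  field_simp
  ring

/-- The law of the bin counts of a sample of Poisson size. -/
def countLaw (n : ℕ) (ν : Measure (Pt d)) (A : Fin k → Set (Pt d)) : Measure (Fin k → ℕ) :=
  Measure.sum fun m : ℕ => poissonMeasure (n : ℝ≥0) {m} •
    (Measure.pi fun _ : Fin m => ν).map fun z l => count z (A l)

lemma countLaw_apply (n : ℕ) (ν : Measure (Pt d)) {A : Fin k → Set (Pt d)}
    (hA : ∀ j, MeasurableSet (A j)) (S : Set (Fin k → ℕ)) :
    countLaw n ν A S = ∑' m : ℕ, poissonMeasure (n : ℝ≥0) {m} *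
      Measure.pi (fun _ : Fin m => ν) {z | (fun l => count z (A l)) ∈ S} := by
  have hS : MeasurableSet S := MeasurableSet.of_discrete
  rw [countLaw, Measure.sum_apply _ hS]
  refine tsum_congr fun m => ?_
  rw [Measure.smul_apply, Measure.map_apply (measurable_counts hA) hS, smul_eq_mul]
  rfl

/-- The recursion of the Poisson weights, for the joint law of the bin counts: on the left the point
to be removed is one of the `x j + 1` points of `A j`. -/
lemma countLaw_recursion (n : ℕ) {ν : Measure (Pt d)} [IsProbabilityMeasure ν]
    {A : Fin k → Set (Pt d)} (hA : ∀ j, MeasurableSet (A j))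
    (hdisj : Pairwise fun i j => Disjoint (A i) (A j)) (x : Fin k → ℕ) (j : Fin k) :
    ((x j + 1 : ℕ) : ℝ≥0∞) * countLaw n ν A {x + Pi.single j 1} =
      n * ν (A j) * countLaw n ν A {x} := by
  rw [countLaw_apply n ν hA, countLaw_apply n ν hA, tsum_eq_zero_add' ENNReal.summable,
    ← ENNReal.tsum_mul_left, mul_add, ← ENNReal.tsum_mul_left]
  have h0 : {z : Fin 0 → Pt d | (fun l => count z (A l)) ∈
      ({x + Pi.single j 1} : Set (Fin k → ℕ))} = ∅ := by
    ext z
    simp only [Set.mem_singleton_iff, Set.mem_ofPred_eq, Set.mem_empty_iff_false, iff_false]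
    intro h
    have := congrFun h j
    simp [count] at this
  rw [h0]
  simp only [measure_empty, mul_zero, zero_add]
  refine tsum_congr fun m => ?_
  have h1 := count_recursion (ν := ν) hA hdisj x j m
  have h2 := succ_mul_poissonMeasure (n : ℝ≥0) m
  simp only [Set.mem_singleton_iff]
  rw [mul_left_comm, h1, mul_left_comm, ← mul_assoc, ← mul_assoc, h2]
  simp only [ENNReal.coe_natCast]
  ring

/-- Poissonization: the counts in the bins of a measurable partition are independent Poisson
variables. -/
theorem countLaw_eq_pi (n : ℕ) {ν : Measure (Pt d)} [IsProbabilityMeasure ν]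
    {A : Fin k → Set (Pt d)} (hA : ∀ j, MeasurableSet (A j))
    (hdisj : Pairwise fun i j => Disjoint (A i) (A j)) (hcov : ⋃ j, A j = Set.univ) :
    countLaw n ν A = Measure.pi fun j => poissonMeasure (n * (ν (A j)).toNNReal) := by
  refine Measure.ext_of_singleton fun x => ?_
  have hpi : ∀ x : Fin k → ℕ, (Measure.pi fun j => poissonMeasure (n * (ν (A j)).toNNReal)) {x} =
      ∏ j, poissonMeasure (n * (ν (A j)).toNNReal) {x j} := fun x => by
    rw [← Set.univ_pi_singleton, Measure.pi_pi]
  have hsum : ∑ j, ν (A j) = 1 := by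
    rw [← measure_univ (μ := ν), ← hcov, measure_iUnion hdisj hA, tsum_fintype]
  -- both sides satisfy the same recursion in each coordinate and agree at `x = 0`
  generalize hs : ∑ j, x j = s
  induction s generalizing x with
  | zero =>
    have hx : x = 0 := by
      funext j
      have := (Finset.sum_eq_zero_iff.1 hs) j (Finset.mem_univ _)
      simpa using this
    subst hx
    rw [hpi, countLaw_apply n ν hA, tsum_eq_single (0 : ℕ) ?_]
    · have : {z : Fin 0 → Pt d | (fun l => count z (A l)) ∈ ({0} : Set (Fin k → ℕ))} =
          Set.univ := by
        ext z
        simp only [Set.mem_singleton_iff, Set.mem_ofPred_eq, Set.mem_univ, iff_true]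
        funext l
        simp [count]
      rw [this, measure_univ, mul_one]
      simp only [poissonMeasure_singleton, Pi.zero_apply, pow_zero, Nat.factorial_zero,
        Nat.cast_one, mul_one, div_one]
      rw [← ENNReal.ofReal_prod_of_nonneg fun _ _ => (Real.exp_pos _).le, ← Real.exp_sum]
      congr 2
      have hsum' : ∑ j, (ν (A j)).toNNReal = 1 := by
        rw [← ENNReal.toNNReal_sum fun j _ => measure_ne_top _ _, hsum, ENNReal.toNNReal_one]
      rw [Finset.sum_neg_distrib]
      congr 1
      rw [← NNReal.coe_sum, ← Finset.mul_sum, hsum', mul_one]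
    · intro m hm
      have : {z : Fin m → Pt d | (fun l => count z (A l)) ∈ ({0} : Set (Fin k → ℕ))} = ∅ := by
        ext z
        simp only [Set.mem_singleton_iff, Set.mem_ofPred_eq, Set.mem_empty_iff_false, iff_false]
        intro h
        have hz : z ⟨0, Nat.pos_of_ne_zero hm⟩ ∈ ⋃ j, A j := hcov ▸ Set.mem_univ _
        obtain ⟨j, hj⟩ := Set.mem_iUnion.1 hz
        have := congrFun h j
        classical
        simp only [count, Pi.zero_apply, Finset.card_eq_zero] at this
        exact (Finset.eq_empty_iff_forall_notMem.1 this _) (Finset.mem_filter.2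
          ⟨Finset.mem_univ _, hj⟩)
      rw [this, measure_empty, mul_zero]
  | succ s ih =>
    obtain ⟨j, hj⟩ : ∃ j, x j ≠ 0 := by
      by_contra! h
      simp [h] at hs
    obtain ⟨y, rfl⟩ : ∃ y : Fin k → ℕ, x = y + Pi.single j 1 := by
      refine ⟨x - Pi.single j 1, funext fun l => ?_⟩
      by_cases hlj : l = j
      · subst hlj; simp; omega
      · simp [hlj]
    have hy : ∑ l, y l = s := by
      simp only [Pi.add_apply, Finset.sum_add_distrib, Finset.sum_pi_single', Finset.mem_univ,
        if_true] at hs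
      have h1 : ∑ l, (Pi.single j 1 : Fin k → ℕ) l = 1 := by
        simp [Pi.single_apply]
      omega
    have h1 := countLaw_recursion n (ν := ν) hA hdisj y j
    rw [ih y hy, hpi] at h1
    have h2 := succ_mul_poissonMeasure (n * (ν (A j)).toNNReal) (y j)
    have h3 : ((y j + 1 : ℕ) : ℝ≥0∞) *
        ∏ l, poissonMeasure (n * (ν (A l)).toNNReal) {(y + Pi.single j 1 : Fin k → ℕ) l} =
        n * ν (A j) * ∏ l, poissonMeasure (n * (ν (A l)).toNNReal) {y l} := by
      rw [← Finset.mul_prod_erase _ _ (Finset.mem_univ j),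
        ← Finset.mul_prod_erase Finset.univ (fun l => poissonMeasure _ {y l}) (Finset.mem_univ j)]
      rw [← mul_assoc, ← mul_assoc]
      congr 1
      · simp only [Pi.add_apply, Pi.single_eq_same]
        rw [h2]
        simp [ENNReal.coe_toNNReal]
      · refine Finset.prod_congr rfl fun l hl => ?_
        have hlj := Finset.ne_of_mem_erase hl
        simp [hlj]
    rw [hpi]
    rw [← h3] at h1
    exact (ENNReal.mul_right_inj (by simp) (ENNReal.natCast_ne_top _)).1 h1

lemma poissonProb_eq_pi (n : ℕ) {p : Pt d → ℝ} [IsProbabilityMeasure (law p)]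
    {A : Fin k → Set (Pt d)} (hA : ∀ j, MeasurableSet (A j))
    (hdisj : Pairwise fun i j => Disjoint (A i) (A j)) (hcov : ⋃ j, A j = Set.univ)
    (S : Set (Fin k → ℕ)) :
    poissonProb n p (fun _ => {z | (fun l => count z (A l)) ∈ S}) =
      (Measure.pi fun j => poissonMeasure (n * (law p (A j)).toNNReal)) S := by
  rw [← countLaw_eq_pi n hA hdisj hcov, countLaw_apply n _ hA]
  rfl

end CountLaw

/-! ### Chebyshev bounds for sums of functions of independent Poisson variables -/

section Chebyshev

variable {k : ℕ} {r : Fin k → ℝ≥0} {f : Fin k → ℕ → ℝ}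

lemma memLp_sum_pi (hf : ∀ i, MemLp (f i) 2 (poissonMeasure (r i))) (s : Finset (Fin k)) :
    MemLp (fun x : Fin k → ℕ => ∑ i ∈ s, f i (x i)) 2
      (Measure.pi fun j => poissonMeasure (r j)) :=
  memLp_finsetSum s fun i _ => (hf i).comp_measurePreserving
    (measurePreserving_eval (fun j => poissonMeasure (r j)) i)

lemma integral_sum_pi (hf : ∀ i, MemLp (f i) 2 (poissonMeasure (r i))) (s : Finset (Fin k)) :
    ∫ x : Fin k → ℕ, ∑ i ∈ s, f i (x i) ∂(Measure.pi fun j => poissonMeasure (r j)) =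
      ∑ i ∈ s, ∫ m, f i m ∂poissonMeasure (r i) := by
  have hint : ∀ i, Integrable (fun x : Fin k → ℕ => f i (x i))
      (Measure.pi fun j => poissonMeasure (r j)) := fun i =>
    ((hf i).comp_measurePreserving
      (measurePreserving_eval (fun j => poissonMeasure (r j)) i)).integrable one_le_two
  rw [integral_finsetSum s fun i _ => hint i]
  refine Finset.sum_congr rfl fun i _ => ?_
  have h := (measurePreserving_eval (fun j => poissonMeasure (r j)) i).map_eq
  rw [← h, integral_map (measurable_pi_apply i).aemeasurable
    Measurable.of_discrete.aestronglyMeasurable]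

lemma variance_sum_finset_pi (hf : ∀ i, MemLp (f i) 2 (poissonMeasure (r i)))
    (s : Finset (Fin k)) :
    Var[fun x : Fin k → ℕ => ∑ i ∈ s, f i (x i); Measure.pi fun j => poissonMeasure (r j)] =
      ∑ i ∈ s, Var[f i; poissonMeasure (r i)] := by
  classical
  have h := variance_sum_pi (X := fun i => if i ∈ s then f i else 0)
    (μ := fun j => poissonMeasure (r j)) fun i => by
      by_cases hi : i ∈ s
      · simpa [hi] using hf i
      · simp [hi]
  have h1 : (∑ i, fun ω : Fin k → ℕ => (if i ∈ s then f i else 0) (ω i)) =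
      fun x : Fin k → ℕ => ∑ i ∈ s, f i (x i) := by
    funext x
    simp only [Finset.sum_apply]
    rw [← Finset.sum_filter_add_sum_filter_not Finset.univ (· ∈ s)]
    rw [Finset.sum_eq_zero (s := Finset.univ.filter fun i => ¬ i ∈ s), add_zero]
    · simp only [Finset.filter_mem_eq_inter, Finset.univ_inter]
      exact Finset.sum_congr rfl fun i hi => by simp [hi]
    · intro i hi
      simp [(Finset.mem_filter.1 hi).2]
  rw [h1] at h
  rw [h, ← Finset.sum_filter_add_sum_filter_not Finset.univ (· ∈ s)]
  rw [Finset.sum_eq_zero (s := Finset.univ.filter fun i => ¬ i ∈ s), add_zero]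
  · simp only [Finset.filter_mem_eq_inter, Finset.univ_inter]
    exact Finset.sum_congr rfl fun i hi => by simp [hi]
  · intro i hi
    simp [(Finset.mem_filter.1 hi).2]

end Chebyshev

/-- A centred variable exceeds `√(Var / β)` with probability at most `β`. The case of zero variance
uses that the inequality defining the event is strict. -/
lemma measure_sqrt_lt_le {Ω : Type*} {mΩ : MeasurableSpace Ω} {μ : Measure Ω}
    [IsProbabilityMeasure μ] {Z : Ω → ℝ} (hZ : MemLp Z 2 μ) (h0 : ∫ ω, Z ω ∂μ = 0) {v β : ℝ}
    (hv : Var[Z; μ] = v) (hβ : 0 < β) :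
    μ {ω | Real.sqrt (v / β) < Z ω} ≤ ENNReal.ofReal β := by
  have hv0 : 0 ≤ v := hv ▸ variance_nonneg _ _
  rcases hv0.eq_or_lt with rfl | hv0
  · have h1 : evariance Z μ = 0 := by
      rw [← hZ.ofReal_variance_eq, hv, ENNReal.ofReal_zero]
    have h2 := (evariance_eq_zero_iff hZ.1.aemeasurable).1 h1
    have : μ {ω | Real.sqrt (0 / β) < Z ω} = 0 := by
      rw [measure_eq_zero_iff_ae_notMem]
      filter_upwards [h2] with ω hω
      simp [hω, h0]
    rw [this]
    exact zero_le
  · have hc : 0 < Real.sqrt (v / β) := Real.sqrt_pos.2 (by positivity)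
    have h := meas_ge_le_variance_div_sq hZ hc
    rw [hv, Real.sq_sqrt (by positivity), h0] at h
    have e : v / (v / β) = β := by field_simp
    rw [e] at h
    refine le_trans (measure_mono fun ω hω => ?_) h
    have hω' : Real.sqrt (v / β) < Z ω := hω
    simpa using hω'.le.trans (le_abs_self _)

/-- A variable whose mean dominates both twice the threshold `t` and its standard deviation is
unlikely to stay below `t`. -/
lemma measure_le_threshold_le {Ω : Type*} {mΩ : MeasurableSpace Ω} {μ : Measure Ω}
    [IsProbabilityMeasure μ] {Z : Ω → ℝ} (hZ : MemLp Z 2 μ) {e t ζ : ℝ} (he : ∫ ω, Z ω ∂μ = e)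
    (he0 : 0 < e) (ht : t ≤ e / 2) (hv : 4 * Var[Z; μ] ≤ ζ * e ^ 2) :
    μ {ω | Z ω ≤ t} ≤ ENNReal.ofReal ζ := by
  have h := meas_ge_le_variance_div_sq hZ (half_pos he0)
  refine le_trans (measure_mono fun ω hω => ?_) (h.trans (ENNReal.ofReal_le_ofReal ?_))
  · have hω' : Z ω ≤ t := hω
    rw [Set.mem_ofPred_eq, he, abs_sub_comm]
    exact le_trans (by linarith) (le_abs_self _)
  · rw [div_le_iff₀ (by positivity)]
    linarith

/-! ### The composite test for multinomials -/

section Composite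

variable {k : ℕ} {q p : Fin k → ℝ} {σ : ℝ} {n : ℕ}

lemma mem_multTail {i : Fin k} : i ∈ multTail q σ ↔ ∑ j ∈ Finset.Ici i, q j ≤ σ := by
  simp [multTail]

lemma mem_multBulk {i : Fin k} :
    i ∈ multBulk q σ ↔ 0 < (i : ℕ) ∧ σ < ∑ j ∈ Finset.Ici i, q j := by
  simp [multBulk, mem_multTail]

lemma sum_multTail_le (hq : ∀ i, 0 ≤ q i) (hσ : 0 ≤ σ) : ∑ j ∈ multTail q σ, q j ≤ σ := by
  rcases (multTail q σ).eq_empty_or_nonempty with h | h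
  · simpa [h] using hσ
  · have hm := mem_multTail.1 ((multTail q σ).min'_mem h)
    refine le_trans (Finset.sum_le_sum_of_subset_of_nonneg ?_ fun j _ _ => hq j) hm
    exact fun j hj => Finset.mem_Ici.2 (Finset.min'_le _ j hj)

lemma multBulk_pos (hq : ∀ i, 0 ≤ q i) (ha : Antitone q) (hσ : 0 ≤ σ) {i : Fin k}
    (hi : i ∈ multBulk q σ) : 0 < q i := by
  have h := (mem_multBulk.1 hi).2
  by_contra h0
  have hi0 : q i = 0 := le_antisymm (not_lt.1 h0) (hq i)
  have : ∑ j ∈ Finset.Ici i, q j = 0 := Finset.sum_eq_zero fun j hj =>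
    le_antisymm ((ha (Finset.mem_Ici.1 hj)).trans hi0.le) (hq j)
  linarith

/-- The law of the bin counts when the bins have probabilities `p`. -/
def poissonPi (n : ℕ) (p : Fin k → ℝ) : Measure (Fin k → ℕ) :=
  Measure.pi fun j => poissonMeasure (n * (p j).toNNReal)

instance : IsProbabilityMeasure (poissonPi n p) := by
  unfold poissonPi; infer_instance

lemma coe_rate (hp : ∀ i, 0 ≤ p i) (i : Fin k) :
    ((n * (p i).toNNReal : ℝ≥0) : ℝ) = n * p i := by
  simp [Real.coe_toNNReal _ (hp i)]

/-- The linear statistic of the tail test. -/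
def tailStat (n : ℕ) (q : Fin k → ℝ) (s : Finset (Fin k)) (x : Fin k → ℕ) : ℝ :=
  ∑ i ∈ s, ((x i : ℝ) - n * q i)

/-- The quadratic statistic of the `2/3`-test. -/
def quadStat (n : ℕ) (q : Fin k → ℝ) (s : Finset (Fin k)) (x : Fin k → ℕ) : ℝ :=
  ∑ i ∈ s, (((x i : ℝ) - n * q i) ^ 2 - x i) / q i ^ ((2 : ℝ) / 3)

lemma memLp_tailTerm (i : Fin k) (r : ℝ≥0) :
    MemLp (fun m : ℕ => (m : ℝ) - n * q i) 2 (poissonMeasure r) :=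
  (memLp_poisson_id r).sub (memLp_const _)

lemma memLp_quadTerm (i : Fin k) (r : ℝ≥0) :
    MemLp (fun m : ℕ => (((m : ℝ) - n * q i) ^ 2 - m) / q i ^ ((2 : ℝ) / 3)) 2
      (poissonMeasure r) := by
  simp_rw [div_eq_mul_inv]
  exact (memLp_recentred r _).mul_const _

lemma memLp_tailStat (s : Finset (Fin k)) : MemLp (tailStat n q s) 2 (poissonPi n p) :=
  memLp_sum_pi (f := fun i (m : ℕ) => (m : ℝ) - n * q i) (fun i => memLp_tailTerm i _) s

lemma memLp_quadStat (s : Finset (Fin k)) : MemLp (quadStat n q s) 2 (poissonPi n p) :=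
  memLp_sum_pi (f := fun i (m : ℕ) => (((m : ℝ) - n * q i) ^ 2 - m) / q i ^ ((2 : ℝ) / 3))
    (fun i => memLp_quadTerm i _) s

lemma integral_tailStat (hp : ∀ i, 0 ≤ p i) (s : Finset (Fin k)) :
    ∫ x, tailStat n q s x ∂poissonPi n p = n * (∑ i ∈ s, p i - ∑ i ∈ s, q i) := by
  have h := integral_sum_pi (f := fun i (m : ℕ) => (m : ℝ) - n * q i)
    (r := fun j => n * (p j).toNNReal) (fun i => memLp_tailTerm i _) s
  unfold tailStat poissonPi
  rw [h, mul_sub, Finset.mul_sum, Finset.mul_sum, ← Finset.sum_sub_distrib]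
  refine Finset.sum_congr rfl fun i _ => ?_
  rw [integral_sub ((memLp_poisson_id _).integrable one_le_two) (integrable_const _),
    integral_poisson_id, coe_rate hp]
  simp

lemma variance_tailStat (hp : ∀ i, 0 ≤ p i) (s : Finset (Fin k)) :
    Var[tailStat n q s; poissonPi n p] = n * ∑ i ∈ s, p i := by
  have h := variance_sum_finset_pi (f := fun i (m : ℕ) => (m : ℝ) - n * q i)
    (r := fun j => n * (p j).toNNReal) (fun i => memLp_tailTerm i _) s
  unfold tailStat poissonPi
  rw [h, Finset.mul_sum]
  refine Finset.sum_congr rfl fun i _ => ?_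
  rw [variance_sub_const Measurable.of_discrete.aestronglyMeasurable, variance_poisson_id,
    coe_rate hp]

lemma integral_quadStat (hp : ∀ i, 0 ≤ p i) (s : Finset (Fin k)) :
    ∫ x, quadStat n q s x ∂poissonPi n p =
      n ^ 2 * ∑ i ∈ s, (p i - q i) ^ 2 / q i ^ ((2 : ℝ) / 3) := by
  have h := integral_sum_pi
    (f := fun i (m : ℕ) => (((m : ℝ) - n * q i) ^ 2 - m) / q i ^ ((2 : ℝ) / 3))
    (r := fun j => n * (p j).toNNReal) (fun i => memLp_quadTerm i _) s
  unfold quadStat poissonPi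
  rw [h, Finset.mul_sum]
  refine Finset.sum_congr rfl fun i _ => ?_
  rw [integral_div, integral_recentred, coe_rate hp]
  ring

lemma variance_quadStat (hp : ∀ i, 0 ≤ p i) (s : Finset (Fin k)) :
    Var[quadStat n q s; poissonPi n p] =
      ∑ i ∈ s, (2 * n ^ 2 * p i ^ 2 + 4 * n ^ 3 * p i * (p i - q i) ^ 2) /
        (q i ^ ((2 : ℝ) / 3)) ^ 2 := by
  have h := variance_sum_finset_pi
    (f := fun i (m : ℕ) => (((m : ℝ) - n * q i) ^ 2 - m) / q i ^ ((2 : ℝ) / 3))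
    (r := fun j => n * (p j).toNNReal) (fun i => memLp_quadTerm i _) s
  unfold quadStat poissonPi
  rw [h]
  refine Finset.sum_congr rfl fun i _ => ?_
  simp_rw [div_eq_mul_inv]
  rw [variance_mul_const, variance_recentred, coe_rate hp]
  rw [inv_pow]
  ring

/-- Under the null, each of the two tests rejects with probability at most `α / 2`: its threshold is
the square root of the variance of its statistic divided by `α / 2`. -/
theorem composite_typeI (hq : ∀ i, 0 ≤ q i) (ha : Antitone q) (hσ : 0 ≤ σ) {α : ℝ} (hα : 0 < α) :
    poissonPi n q {x | CompositeRejects n q σ α x} ≤ ENNReal.ofReal α := by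
  have h1 : poissonPi n q {x | TailRejects n q σ (α / 2) x} ≤ ENNReal.ofReal (α / 2) :=
    measure_sqrt_lt_le (memLp_tailStat (multTail q σ))
      (by rw [integral_tailStat hq, sub_self, mul_zero]) (variance_tailStat hq _) (by positivity)
  have h2 : poissonPi n q {x | TwoThirdsRejects n q σ (α / 2) x} ≤ ENNReal.ofReal (α / 2) := by
    refine measure_sqrt_lt_le (memLp_quadStat (multBulk q σ)) ?_ ?_ (by positivity)
    · rw [integral_quadStat hq]
      simp
    · rw [variance_quadStat hq]
      refine Finset.sum_congr rfl fun i hi => ?_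
      have hqi := multBulk_pos hq ha hσ hi
      have h4 : q i ^ ((2 : ℝ) / 3) * (q i ^ ((2 : ℝ) / 3)) ^ 2 = q i ^ 2 := by
        rw [← pow_succ', ← Real.rpow_natCast, ← Real.rpow_mul hqi.le, ← Real.rpow_natCast]
        norm_num
      have h5 : 0 < q i ^ ((2 : ℝ) / 3) := Real.rpow_pos_of_pos hqi _
      rw [sub_self, div_eq_iff (by positivity)]
      linear_combination (-2 * (n : ℝ) ^ 2) * h4
  calc poissonPi n q {x | CompositeRejects n q σ α x}
      ≤ poissonPi n q {x | TailRejects n q σ (α / 2) x} +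
        poissonPi n q {x | TwoThirdsRejects n q σ (α / 2) x} := measure_union_le _ _
    _ ≤ ENNReal.ofReal (α / 2) + ENNReal.ofReal (α / 2) := add_le_add h1 h2
    _ = ENNReal.ofReal α := by
      rw [← ENNReal.ofReal_add (by positivity) (by positivity), add_halves]

lemma multBulk_anti {τ : ℝ} (h : τ ≤ σ) : multBulk q σ ⊆ multBulk q τ := fun i hi => by
  rw [mem_multBulk] at hi ⊢
  exact ⟨hi.1, h.trans_lt hi.2⟩

/-- A bulk category cannot be too small compared with the `2/3`-norm of the larger bulk obtained
by halving the truncation level: at least half of the mass it dominates lies in that bulk. -/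
lemma half_lt_mul_of_mem_multBulk (hq : ∀ i, 0 ≤ q i) (ha : Antitone q) (hσ : 0 ≤ σ) {i : Fin k}
    (hi : i ∈ multBulk q σ) :
    σ / 2 < q i ^ ((1 : ℝ) / 3) * ∑ j ∈ multBulk q (σ / 2), q j ^ ((2 : ℝ) / 3) := by
  classical
  obtain ⟨hi0, hi1⟩ := mem_multBulk.1 hi
  have hT := sum_multTail_le hq (half_pos_le hσ)
  have hsub : Finset.Ici i ⊆ multTail q (σ / 2) ∪ (Finset.Ici i ∩ multBulk q (σ / 2)) := by
    intro j hj
    by_cases hjT : j ∈ multTail q (σ / 2)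
    · exact Finset.mem_union_left _ hjT
    · refine Finset.mem_union_right _ (Finset.mem_inter.2 ⟨hj, ?_⟩)
      rw [mem_multTail, not_le] at hjT
      exact mem_multBulk.2 ⟨lt_of_lt_of_le hi0 (Fin.le_def.1 (Finset.mem_Ici.1 hj)), hjT⟩
  have h1 : ∑ j ∈ Finset.Ici i, q j ≤ ∑ j ∈ multTail q (σ / 2), q j +
      ∑ j ∈ Finset.Ici i ∩ multBulk q (σ / 2), q j :=
    (Finset.sum_le_sum_of_subset_of_nonneg hsub fun j _ _ => hq j).trans
      (Finset.sum_union_inter (f := q) ▸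
        le_add_of_nonneg_right (Finset.sum_nonneg fun j _ => hq j))
  have h2 : ∑ j ∈ Finset.Ici i ∩ multBulk q (σ / 2), q j ≤
      q i ^ ((1 : ℝ) / 3) * ∑ j ∈ multBulk q (σ / 2), q j ^ ((2 : ℝ) / 3) := by
    rw [Finset.mul_sum]
    refine le_trans (Finset.sum_le_sum (g := fun j => q i ^ ((1 : ℝ) / 3) * q j ^ ((2 : ℝ) / 3))
      fun j hj => ?_) (Finset.sum_le_sum_of_subset_of_nonneg Finset.inter_subset_right
        fun j _ _ => mul_nonneg (Real.rpow_nonneg (hq i) _) (Real.rpow_nonneg (hq j) _))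
    have hji : q j ≤ q i := ha (Finset.mem_Ici.1 (Finset.mem_inter.1 hj).1)
    calc q j = q j ^ ((1 : ℝ) / 3) * q j ^ ((2 : ℝ) / 3) := by
          rw [← Real.rpow_add' (hq j) (by norm_num)]; norm_num
      _ ≤ q i ^ ((1 : ℝ) / 3) * q j ^ ((2 : ℝ) / 3) := by
          have := hq j
          gcongr
  linarith
where
  half_pos_le {σ : ℝ} (hσ : 0 ≤ σ) : 0 ≤ σ / 2 := by linarith

/-- The variance of the quadratic statistic under an alternative. Here `s² = ∑ q^(2/3)` and
`y² = ∑ (p - q)² / q^(2/3)`, and `R` bounds `q^(-1/3)` on the bulk. -/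
lemma variance_quadStat_le (hp : ∀ i, 0 ≤ p i) {B : Finset (Fin k)}
    (hB : ∀ i ∈ B, 0 < q i) {s y R : ℝ} (hs0 : 0 ≤ s) (hy0 : 0 ≤ y)
    (hs : ∑ i ∈ B, q i ^ ((2 : ℝ) / 3) ≤ s ^ 2)
    (hy : ∑ i ∈ B, (p i - q i) ^ 2 / q i ^ ((2 : ℝ) / 3) = y ^ 2)
    (hR : ∀ i ∈ B, 1 ≤ R * q i ^ ((1 : ℝ) / 3)) :
    Var[quadStat n q B; poissonPi n p] ≤
      4 * n ^ 2 * s ^ 2 + 4 * n ^ 2 * R ^ 2 * y ^ 2 + 4 * n ^ 3 * s * y ^ 2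
        + 4 * n ^ 3 * R * y ^ 3 := by
  rw [variance_quadStat hp]
  have hn : (0 : ℝ) ≤ n := n.cast_nonneg
  have hkey : ∀ i ∈ B, (2 * (n : ℝ) ^ 2 * p i ^ 2 + 4 * n ^ 3 * p i * (p i - q i) ^ 2) /
        (q i ^ ((2 : ℝ) / 3)) ^ 2 ≤
      4 * n ^ 2 * q i ^ ((2 : ℝ) / 3) +
        (4 * n ^ 2 * R ^ 2 + 4 * n ^ 3 * s + 4 * n ^ 3 * R * y) *
          ((p i - q i) ^ 2 / q i ^ ((2 : ℝ) / 3)) := by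
    intro i hi
    set u := q i ^ ((1 : ℝ) / 3) with hu
    have hu0 : 0 < u := Real.rpow_pos_of_pos (hB i hi) _
    have hu2 : q i ^ ((2 : ℝ) / 3) = u ^ 2 := by
      rw [hu, ← Real.rpow_natCast, ← Real.rpow_mul (hB i hi).le]; norm_num
    have hu3 : q i = u ^ 3 := by
      rw [hu, ← Real.rpow_natCast, ← Real.rpow_mul (hB i hi).le]; norm_num
    set D := p i - q i with hD
    have hpi : p i = u ^ 3 + D := by rw [← hu3]; ring
    have hus : u ≤ s := by
      have : u ^ 2 ≤ s ^ 2 := by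
        rw [← hu2]
        exact (Finset.single_le_sum (f := fun i => q i ^ ((2 : ℝ) / 3))
          (fun j hj => Real.rpow_nonneg (hB j hj).le _) hi).trans hs
      exact (sq_le_sq₀ hu0.le hs0).1 this
    have hDy : |D| / u ≤ y := by
      have : (|D| / u) ^ 2 ≤ y ^ 2 := by
        rw [← hy, div_pow, sq_abs, ← hu2]
        exact Finset.single_le_sum (f := fun i => (p i - q i) ^ 2 / q i ^ ((2 : ℝ) / 3))
          (fun j hj => div_nonneg (sq_nonneg _) (Real.rpow_nonneg (hB j hj).le _)) hi
      exact (sq_le_sq₀ (by positivity) hy0).1 this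
    have hDy' : |D| ≤ y * u := (div_le_iff₀ hu0).1 hDy
    have hRu : 1 ≤ R * u := hR i hi
    rw [hu2]
    have hw : 0 ≤ D ^ 2 / u ^ 2 := by positivity
    have e1 : 2 * p i ^ 2 / (u ^ 2) ^ 2 ≤ 4 * u ^ 2 + 4 * R ^ 2 * (D ^ 2 / u ^ 2) := by
      have a1 : 2 * p i ^ 2 ≤ 4 * u ^ 6 + 4 * D ^ 2 := by
        rw [hpi]; nlinarith [sq_nonneg (u ^ 3 - D)]
      have a2 : 1 ≤ (R * u) ^ 2 := one_le_pow₀ hRu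
      calc 2 * p i ^ 2 / (u ^ 2) ^ 2 ≤ (4 * u ^ 6 + 4 * D ^ 2) / (u ^ 2) ^ 2 := by gcongr
        _ = 4 * u ^ 2 + 4 * (D ^ 2 / u ^ 4) * 1 := by field_simp
        _ ≤ 4 * u ^ 2 + 4 * (D ^ 2 / u ^ 4) * (R * u) ^ 2 := by gcongr
        _ = 4 * u ^ 2 + 4 * R ^ 2 * (D ^ 2 / u ^ 2) := by field_simp
    have e2 : p i * D ^ 2 / (u ^ 2) ^ 2 ≤ (s + R * y) * (D ^ 2 / u ^ 2) := by
      have a1 : p i ≤ u ^ 2 * (s + R * y) := by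
        have b1 : u ^ 3 ≤ u ^ 2 * s := by
          rw [pow_succ]; gcongr
        have b2 : D ≤ u ^ 2 * (R * y) :=
          calc D ≤ y * u := (le_abs_self _).trans hDy'
            _ ≤ y * u * (R * u) := le_mul_of_one_le_right (by positivity) hRu
            _ = _ := by ring
        rw [hpi]; linarith
      calc p i * D ^ 2 / (u ^ 2) ^ 2 ≤ (u ^ 2 * (s + R * y)) * D ^ 2 / (u ^ 2) ^ 2 := by gcongr
        _ = _ := by field_simp
    calc _ = (n : ℝ) ^ 2 * (2 * p i ^ 2 / (u ^ 2) ^ 2) +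
          4 * n ^ 3 * (p i * D ^ 2 / (u ^ 2) ^ 2) := by ring
      _ ≤ (n : ℝ) ^ 2 * (4 * u ^ 2 + 4 * R ^ 2 * (D ^ 2 / u ^ 2)) +
          4 * n ^ 3 * ((s + R * y) * (D ^ 2 / u ^ 2)) := by gcongr
      _ = _ := by ring
  refine (Finset.sum_le_sum hkey).trans ?_
  rw [Finset.sum_add_distrib, ← Finset.mul_sum, ← Finset.mul_sum, hy]
  calc _ ≤ 4 * (n : ℝ) ^ 2 * s ^ 2 +
        (4 * n ^ 2 * R ^ 2 + 4 * n ^ 3 * s + 4 * n ^ 3 * R * y) * y ^ 2 := by gcongr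
    _ = _ := by ring

/-- If the two distributions differ by `ε / 2` in `ℓ¹`, then the difference is seen either in the
total mass of the tail or in the bulk. -/
lemma tail_or_bulk (hq : ∀ i, 0 ≤ q i) (hp : ∀ i, 0 ≤ p i) (hq1 : ∑ i, q i = 1)
    (hp1 : ∑ i, p i = 1) {ε : ℝ} (hε : 0 < ε) (hsep : ε / 2 ≤ ∑ i, |p i - q i|) :
    ε / 8 ≤ ∑ i ∈ multTail q (ε / 64), p i - ∑ i ∈ multTail q (ε / 64), q i ∨
      ε / 16 ≤ ∑ i ∈ multBulk q (ε / 64), |p i - q i| := by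
  classical
  by_contra! h
  obtain ⟨h1, h2⟩ := h
  set T := multTail q (ε / 64)
  set B := multBulk q (ε / 64)
  have hT := sum_multTail_le (σ := ε / 64) hq (by positivity)
  have hk : 0 < k := by
    rcases Nat.eq_zero_or_pos k with rfl | hk
    · simp at hq1
    · exact hk
  let z : Fin k := ⟨0, hk⟩
  have e0 : |p z - q z| ≤ ∑ i ∈ Finset.univ.erase z, |p i - q i| := by
    have : p z - q z = - ∑ i ∈ Finset.univ.erase z, (p i - q i) := by
      have e := Finset.add_sum_erase Finset.univ (fun i => p i - q i) (Finset.mem_univ z)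
      rw [Finset.sum_sub_distrib (s := Finset.univ), hp1, hq1] at e
      linarith
    rw [this, abs_neg]
    exact Finset.abs_sum_le_sum_abs _ _
  have e1 : ∑ i, |p i - q i| ≤ 2 * ∑ i ∈ Finset.univ.erase z, |p i - q i| := by
    rw [← Finset.add_sum_erase Finset.univ _ (Finset.mem_univ z)]
    linarith
  have e2 : ∑ i ∈ Finset.univ.erase z, |p i - q i| ≤
      ∑ i ∈ T, |p i - q i| + ∑ i ∈ B, |p i - q i| := by
    rw [← Finset.sum_union_inter]
    refine le_trans (Finset.sum_le_sum_of_subset_of_nonneg (t := T ∪ B) (fun i hi => ?_)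
      fun i _ _ => abs_nonneg _) (le_add_of_nonneg_right (Finset.sum_nonneg fun i _ => abs_nonneg _))
    by_cases hiT : i ∈ T
    · exact Finset.mem_union_left _ hiT
    · refine Finset.mem_union_right _ ?_
      rw [mem_multTail, not_le] at hiT
      refine mem_multBulk.2 ⟨Nat.pos_of_ne_zero fun h => ?_, hiT⟩
      exact Finset.ne_of_mem_erase hi (Fin.ext h)
  have e3 : ∑ i ∈ T, |p i - q i| ≤ ∑ i ∈ T, p i + ∑ i ∈ T, q i := by
    rw [← Finset.sum_add_distrib]
    refine Finset.sum_le_sum fun i _ => ?_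
    have := hp i
    have := hq i
    exact abs_le.2 ⟨by linarith, by linarith⟩
  linarith

lemma le_mul_of_mul_le {a b M z : ℝ} (ha : 0 ≤ a) (hz : 0 ≤ z) (h : a * M ≤ b)
    (hM : 1 ≤ M * z) : a ≤ b * z :=
  calc a ≤ a * (M * z) := le_mul_of_one_le_right ha hM
    _ = a * M * z := by ring
    _ ≤ b * z := by gcongr

lemma four_mul_variance_bound_le {m s R y ζ : ℝ} (hm : 0 ≤ m) (hs : 0 ≤ s) (hR : 0 ≤ R)
    (hy : 0 ≤ y) (m1 : 512 * s ≤ m * y ^ 2 * ζ) (m2 : 64 * R ≤ m * y * ζ)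
    (m3 : 512 * s ≤ m * y ^ 2) (m4 : 64 * R ≤ m * y) :
    4 * (4 * m ^ 2 * s ^ 2 + 4 * m ^ 2 * R ^ 2 * y ^ 2 + 4 * m ^ 3 * s * y ^ 2
      + 4 * m ^ 3 * R * y ^ 3) ≤ ζ * (m ^ 2 * y ^ 2) ^ 2 := by
  have t1 : 64 * s ^ 2 ≤ m ^ 2 * y ^ 4 * ζ := by
    have := mul_le_mul m3 m1 (by positivity) (by positivity)
    have h : 0 ≤ s ^ 2 := by positivity
    linarith
  have t2 : 64 * R ^ 2 ≤ m ^ 2 * y ^ 2 * ζ := by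
    have := mul_le_mul m4 m2 (by positivity) (by positivity)
    have h : 0 ≤ R ^ 2 := by positivity
    linarith
  have t3 : 64 * s ≤ m * y ^ 2 * ζ := by linarith
  have a1 := mul_le_mul_of_nonneg_left t1 (sq_nonneg m)
  have a2 := mul_le_mul_of_nonneg_left t2 (a := m ^ 2 * y ^ 2) (by positivity)
  have a3 := mul_le_mul_of_nonneg_left t3 (a := m ^ 3 * y ^ 2) (by positivity)
  have a4 := mul_le_mul_of_nonneg_left m2 (a := m ^ 3 * y ^ 3) (by positivity)
  linarith

/-- Power of the composite test: the tail test detects a difference in the mass of the tail, and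
the `2/3`-test detects a difference in the bulk. -/
theorem composite_typeII (hq : ∀ i, 0 ≤ q i) (ha : Antitone q) (hp : ∀ i, 0 ≤ p i)
    (hq1 : ∑ i, q i = 1) (hp1 : ∑ i, p i = 1) {ε : ℝ} (hε : 0 < ε)
    (hsep : ε / 2 ≤ ∑ i, |p i - q i|) {α ζ M : ℝ} (hα : 0 < α) (hζ : 0 < ζ) (hM : 1 ≤ M)
    (hMα : 1 ≤ M * α) (hMζ : 1 ≤ M * ζ) (h1 : 64 * M ≤ n * ε) {s : ℝ} (hs0 : 0 ≤ s)
    (hs : ∑ i ∈ multBulk q (ε / 64 / 2), q i ^ ((2 : ℝ) / 3) ≤ s ^ 2)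
    (h2 : 2 ^ 17 * M * s ^ 3 ≤ n * ε ^ 2) :
    poissonPi n p {x | ¬ CompositeRejects n q (ε / 64) α x} ≤ ENNReal.ofReal ζ := by
  wlog hζ1 : ζ ≤ 1 generalizing ζ
  · refine prob_le_one.trans ?_
    rw [← ENNReal.ofReal_one]
    exact ENNReal.ofReal_le_ofReal (not_le.1 hζ1).le
  have hn : (0 : ℝ) ≤ n := n.cast_nonneg
  rcases tail_or_bulk hq hp hq1 hp1 hε hsep with hT | hB
  · set T := multTail q (ε / 64) with hTdef
    refine (measure_mono (t := {x | tailStat n q T x ≤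
      Real.sqrt (n * (∑ j ∈ T, q j) / (α / 2))}) fun x hx => ?_).trans
      (measure_le_threshold_le (memLp_tailStat T) (integral_tailStat hp T) ?_ ?_ ?_)
    · have hx' : ¬ CompositeRejects n q (ε / 64) α x := hx
      exact not_lt.1 fun h => hx' (Or.inl h)
    all_goals
      set D := ∑ i ∈ T, p i - ∑ i ∈ T, q i with hD
      have hqT : ∑ i ∈ T, q i ≤ ε / 64 := sum_multTail_le hq (by positivity)
      have hqT0 : 0 ≤ ∑ i ∈ T, q i := Finset.sum_nonneg fun i _ => hq i
      have hnD : 8 * M ≤ n * D := by nlinarith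
    · linarith
    · rw [Real.sqrt_le_left (by linarith), div_le_iff₀ (by positivity)]
      have e1 : 8 ≤ n * D * α := by nlinarith
      have e2 : (n : ℝ) * ∑ i ∈ T, q i ≤ n * D := by gcongr; linarith
      nlinarith
    · rw [variance_tailStat hp]
      have e1 : 8 ≤ n * D * ζ := by nlinarith
      have e2 : (n : ℝ) * ∑ i ∈ T, p i ≤ 2 * (n * D) := by
        have : ∑ i ∈ T, p i ≤ 2 * D := by linarith
        calc (n : ℝ) * ∑ i ∈ T, p i ≤ n * (2 * D) := by gcongr
          _ = _ := by ring
      nlinarith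
  · set B := multBulk q (ε / 64) with hBdef
    have hqB : ∀ i ∈ B, 0 < q i := fun i hi => multBulk_pos hq ha (by positivity) hi
    have hsB : ∑ i ∈ B, q i ^ ((2 : ℝ) / 3) ≤ s ^ 2 :=
      (Finset.sum_le_sum_of_subset_of_nonneg (multBulk_anti (by linarith))
        fun i _ _ => Real.rpow_nonneg (hq i) _).trans hs
    set Y := ∑ i ∈ B, (p i - q i) ^ 2 / q i ^ ((2 : ℝ) / 3) with hY
    have hY0 : 0 ≤ Y := Finset.sum_nonneg fun i _ =>
      div_nonneg (sq_nonneg _) (Real.rpow_nonneg (hq i) _)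
    set y := Real.sqrt Y with hy
    have hy0 : 0 ≤ y := Real.sqrt_nonneg _
    have hyY : Y = y ^ 2 := (Real.sq_sqrt hY0).symm
    -- Cauchy-Schwarz
    have hCS : ε ≤ 16 * (s * y) := by
      have e := Finset.sum_mul_sq_le_sq_mul_sq B (fun i => q i ^ ((1 : ℝ) / 3))
        (fun i => |p i - q i| / q i ^ ((1 : ℝ) / 3))
      have e1 : ∑ i ∈ B, q i ^ ((1 : ℝ) / 3) * (|p i - q i| / q i ^ ((1 : ℝ) / 3)) =
          ∑ i ∈ B, |p i - q i| := Finset.sum_congr rfl fun i hi => by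
        have := Real.rpow_pos_of_pos (hqB i hi) ((1 : ℝ) / 3)
        field_simp
      have e2 : ∀ i ∈ B, (q i ^ ((1 : ℝ) / 3)) ^ 2 = q i ^ ((2 : ℝ) / 3) := fun i hi => by
        rw [← Real.rpow_natCast, ← Real.rpow_mul (hqB i hi).le]; norm_num
      have e3 : ∑ i ∈ B, (|p i - q i| / q i ^ ((1 : ℝ) / 3)) ^ 2 = Y :=
        Finset.sum_congr rfl fun i hi => by rw [div_pow, sq_abs, e2 i hi]
      rw [e1, e3, Finset.sum_congr rfl e2] at e
      have e4 : (∑ i ∈ B, |p i - q i|) ^ 2 ≤ (s * y) ^ 2 := by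
        rw [mul_pow, ← hyY]
        exact e.trans (by gcongr)
      have e5 := (sq_le_sq₀ (Finset.sum_nonneg fun i _ => abs_nonneg _) (by positivity)).1 e4
      linarith
    have hsy : 0 < s * y := by linarith
    have hs1 : 0 < s := pos_of_mul_pos_left hsy hy0
    have hy1 : 0 < y := pos_of_mul_pos_right hsy hs0
    have hnpos : (0 : ℝ) < n := by
      by_contra h
      have : (n : ℝ) = 0 := le_antisymm (not_lt.1 h) hn
      rw [this] at h1; linarith
    set R := 128 * s ^ 2 / ε with hRdef
    have hR0 : 0 < R := by positivity
    have hR : ∀ i ∈ B, 1 ≤ R * q i ^ ((1 : ℝ) / 3) := fun i hi => by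
      have e := half_lt_mul_of_mem_multBulk hq ha (σ := ε / 64) (by positivity) hi
      have e' : ε / 64 / 2 < q i ^ ((1 : ℝ) / 3) * s ^ 2 :=
        e.trans_le (mul_le_mul_of_nonneg_left hs (Real.rpow_nonneg (hq i) _))
      rw [hRdef, div_mul_eq_mul_div, le_div_iff₀ hε]
      linarith
    -- signal-to-noise relations
    have k1 : 512 * M * s ≤ n * y ^ 2 := by
      have a : (n : ℝ) * ε ^ 2 ≤ n * (16 * (s * y)) ^ 2 := by gcongr
      have b : s ^ 2 * (512 * M * s) ≤ s ^ 2 * (n * y ^ 2) := by linarith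
      exact le_of_mul_le_mul_left b (by positivity)
    have k2 : 64 * M * R ≤ n * y := by
      have a : (n : ℝ) * ε * ε ≤ n * ε * (16 * (s * y)) := by gcongr
      have b : s * (8192 * M * s ^ 2) ≤ s * (n * y * ε) := by linarith
      have c := le_of_mul_le_mul_left b hs1
      rw [hRdef, mul_div_assoc', div_le_iff₀ hε]
      linarith
    have m1 : 512 * s ≤ n * y ^ 2 * ζ := le_mul_of_mul_le (by positivity) hζ.le (by linarith) hMζ
    have m2 : 64 * R ≤ n * y * ζ := le_mul_of_mul_le (by positivity) hζ.le (by linarith) hMζ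
    have m5 : 512 * s ≤ n * y ^ 2 * α := le_mul_of_mul_le (by positivity) hα.le (by linarith) hMα
    have m3 : 512 * s ≤ n * y ^ 2 := by
      simpa using le_mul_of_mul_le (z := 1) (by positivity) zero_le_one
        (by linarith : 512 * s * M ≤ n * y ^ 2) (by linarith)
    have m4 : 64 * R ≤ n * y := by
      simpa using le_mul_of_mul_le (z := 1) (by positivity) zero_le_one
        (by linarith : 64 * R * M ≤ n * y) (by linarith)
    refine (measure_mono (t := {x | quadStat n q B x ≤
      Real.sqrt ((∑ j ∈ B, 2 * (n : ℝ) ^ 2 * q j ^ ((2 : ℝ) / 3)) / (α / 2))}) fun x hx => ?_).trans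
      (measure_le_threshold_le (memLp_quadStat B) (integral_quadStat hp B) ?_ ?_ ?_)
    · have hx' : ¬ CompositeRejects n q (ε / 64) α x := hx
      exact not_lt.1 fun h => hx' (Or.inr h)
    · rw [← hY, hyY]; positivity
    · rw [← hY, hyY, Real.sqrt_le_left (by positivity), div_le_iff₀ (by positivity),
        ← Finset.mul_sum]
      calc 2 * (n : ℝ) ^ 2 * ∑ i ∈ B, q i ^ ((2 : ℝ) / 3) ≤ 2 * (n : ℝ) ^ 2 * s ^ 2 := by gcongr
        _ = n ^ 2 * (2 * (s * s)) := by ring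
        _ ≤ n ^ 2 * ((n * y ^ 2) * (n * y ^ 2 * α) / 8) := by
          have := mul_le_mul m3 m5 (by positivity) (by positivity)
          gcongr
          have h : 0 ≤ s * s := by positivity
          linarith
        _ = _ := by ring
    · rw [← hY, hyY]
      refine (mul_le_mul_of_nonneg_left (variance_quadStat_le hp hqB hs0 hy0 hsB
        (hY ▸ hyY) hR) (by norm_num)).trans ?_
      exact four_mul_variance_bound_le hn hs1.le hR0.le hy0 m1 m2 m3 m4

end Composite

/-! ### Volume and diameter of cubes -/

lemma gam_pos (d : ℕ) : 0 < gam d := by unfold gam; positivity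

lemma gam_mul (d : ℕ) : gam d * (3 + d) = 2 := by
  unfold gam
  have : (3 + d : ℝ) ≠ 0 := by positivity
  field_simp

lemma gam_lt_one (d : ℕ) : gam d < 1 := by
  have h := gam_mul d
  have h0 := gam_pos d
  have hd : (0 : ℝ) ≤ d := d.cast_nonneg
  nlinarith

namespace Cube

variable {d : ℕ}

lemma toSet_eq_preimage (Q : Cube d) :
    Q.toSet = (WithLp.ofLp : Pt d → Fin d → ℝ) ⁻¹'
      Set.pi Set.univ fun i => Set.Ico (Q.corner i) (Q.corner i + Q.side) := by
  ext x
  simp [toSet]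

lemma measurableSet_toSet (Q : Cube d) : MeasurableSet Q.toSet := by
  rw [toSet_eq_preimage]
  exact (PiLp.volume_preserving_ofLp (Fin d)).measurable
    (MeasurableSet.univ_pi fun i => measurableSet_Ico)

lemma volume_toSet (Q : Cube d) (hs : 0 ≤ Q.side) :
    volume Q.toSet = ENNReal.ofReal (Q.side ^ d) := by
  rw [toSet_eq_preimage, (PiLp.volume_preserving_ofLp (Fin d)).measure_preimage
    (MeasurableSet.univ_pi fun i => measurableSet_Ico).nullMeasurableSet, Real.volume_pi_Ico]
  simp [ENNReal.ofReal_pow hs]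

lemma volume_real_toSet (Q : Cube d) (hs : 0 ≤ Q.side) : volume.real Q.toSet = Q.side ^ d := by
  rw [measureReal_def, volume_toSet Q hs, ENNReal.toReal_ofReal (by positivity)]

lemma volume_toSet_ne_top (Q : Cube d) (hs : 0 ≤ Q.side) : volume Q.toSet ≠ ∞ := by
  rw [volume_toSet Q hs]; exact ENNReal.ofReal_ne_top

end Cube

section Norm

variable {d : ℕ}

lemma norm_le_sqrt_mul {x : Pt d} {r : ℝ} (hr : 0 ≤ r) (h : ∀ i, |x i| ≤ r) :
    ‖x‖ ≤ Real.sqrt d * r := by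
  rw [EuclideanSpace.norm_eq]
  calc Real.sqrt (∑ i, ‖x i‖ ^ 2) ≤ Real.sqrt (∑ _i : Fin d, r ^ 2) := by
        refine Real.sqrt_le_sqrt (Finset.sum_le_sum fun i _ => ?_)
        rw [Real.norm_eq_abs]
        exact pow_le_pow_left₀ (abs_nonneg _) (h i) 2
    _ = Real.sqrt (d * r ^ 2) := by simp
    _ = Real.sqrt d * r := by rw [Real.sqrt_mul (by positivity), Real.sqrt_sq hr]

lemma Cube.norm_sub_center_le {Q : Cube d} {x : Pt d} (hx : x ∈ Q.toSet) (hs : 0 ≤ Q.side) :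
    ‖x - Q.center‖ ≤ Q.diam / 2 := by
  have := norm_le_sqrt_mul (x := x - Q.center) (r := Q.side / 2) (by positivity) fun i => by
    have := hx i
    simp only [PiLp.sub_apply, Cube.center]
    exact abs_le.2 ⟨by linarith [this.1], by linarith [this.2]⟩
  unfold Cube.diam
  linarith

lemma Cube.norm_center_child_sub_le (Q : Cube d) (s : Fin d → Bool) (hs : 0 ≤ Q.side) :
    ‖(Q.child s).center - Q.center‖ ≤ (Q.child s).diam / 2 := by
  have := norm_le_sqrt_mul (x := (Q.child s).center - Q.center) (r := Q.side / 4) (by positivity)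
    fun i => by
      simp only [PiLp.sub_apply, Cube.center, Cube.child]
      split_ifs
      · rw [abs_le]; constructor <;> linarith
      · rw [abs_le]; constructor <;> linarith
  have e : (Q.child s).diam = Real.sqrt d * (Q.side / 2) := rfl
  rw [e]
  linarith

lemma cubeAt_center (x : Pt d) (r : ℝ) : (cubeAt x r).center = x := by
  ext i
  simp [Cube.center, cubeAt]

lemma cubeAt_mono (x : Pt d) {r s : ℝ} (h : r ≤ s) : (cubeAt x r).toSet ⊆ (cubeAt x s).toSet := by
  intro y hy i
  have := hy i
  simp only [cubeAt] at this ⊢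
  constructor <;> linarith [this.1, this.2]

end Norm

/-! ### Lipschitz densities -/

section LipDensity

variable {d : ℕ} {L : ℝ} {p : Pt d → ℝ}

lemma IsLipDensity.integrable (hp : IsLipDensity L p) : Integrable p := by
  by_contra h
  have := hp.integral_eq_one
  rw [integral_undef h] at this
  exact zero_ne_one this

lemma IsLipDensity.lipschitzWith (hp : IsLipDensity L p) : LipschitzWith L.toNNReal p := by
  refine LipschitzWith.of_dist_le_mul fun x y => ?_
  rw [Real.dist_eq, dist_eq_norm]
  exact (hp.lipschitz x y).trans
    (mul_le_mul_of_nonneg_right (Real.le_coe_toNNReal L) (norm_nonneg _))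

lemma IsLipDensity.continuous (hp : IsLipDensity L p) : Continuous p :=
  hp.lipschitzWith.continuous

lemma IsLipDensity.measurable (hp : IsLipDensity L p) : Measurable p := hp.continuous.measurable

lemma IsLipDensity.mono (hp : IsLipDensity L p) {L' : ℝ} (h : L ≤ L') : IsLipDensity L' p :=
  ⟨hp.nonneg, hp.integral_eq_one, fun x y => (hp.lipschitz x y).trans (by gcongr)⟩

lemma IsLipDensity.isProbabilityMeasure (hp : IsLipDensity L p) : IsProbabilityMeasure (law p) := by
  constructor
  rw [law, withDensity_apply _ MeasurableSet.univ, Measure.restrict_univ,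
    ← ofReal_integral_eq_lintegral_ofReal hp.integrable (ae_of_all _ hp.nonneg),
    hp.integral_eq_one, ENNReal.ofReal_one]

lemma IsLipDensity.law_apply (hp : IsLipDensity L p) {A : Set (Pt d)} (hA : MeasurableSet A) :
    law p A = ENNReal.ofReal (∫ x in A, p x) := by
  rw [law, withDensity_apply _ hA, ofReal_integral_eq_lintegral_ofReal hp.integrable.integrableOn
    (ae_of_all _ hp.nonneg)]

lemma IsLipDensity.mass_eq (hp : IsLipDensity L p) {A : Set (Pt d)} (hA : MeasurableSet A) :
    mass p A = ∫ x in A, p x := by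
  rw [mass, measureReal_def, hp.law_apply hA,
    ENNReal.toReal_ofReal (integral_nonneg hp.nonneg)]

lemma mass_nonneg (A : Set (Pt d)) : 0 ≤ mass p A := measureReal_nonneg

lemma IsLipDensity.mass_mono (hp : IsLipDensity L p) {A B : Set (Pt d)} (h : A ⊆ B) :
    mass p A ≤ mass p B :=
  have := hp.isProbabilityMeasure
  measureReal_mono h

lemma IsLipDensity.mass_le_one (hp : IsLipDensity L p) (A : Set (Pt d)) : mass p A ≤ 1 :=
  have := hp.isProbabilityMeasure
  measureReal_le_one

lemma IsLipDensity.mass_compl (hp : IsLipDensity L p) {A : Set (Pt d)} (hA : MeasurableSet A) :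
    mass p Aᶜ = 1 - mass p A :=
  have := hp.isProbabilityMeasure
  probReal_compl_eq_one_sub hA

lemma IsLipDensity.mass_union_le (hp : IsLipDensity L p) (A B : Set (Pt d)) :
    mass p (A ∪ B) ≤ mass p A + mass p B :=
  have := hp.isProbabilityMeasure
  measureReal_union_le A B

lemma IsLipDensity.mass_le_mul_volume (hp : IsLipDensity L p) {A : Set (Pt d)}
    (hA : MeasurableSet A) (hfin : volume A ≠ ∞) {M : ℝ} (h : ∀ x ∈ A, p x ≤ M) :
    mass p A ≤ M * volume.real A := by
  rw [hp.mass_eq hA]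
  calc ∫ x in A, p x ≤ ∫ _x in A, M :=
        setIntegral_mono_on hp.integrable.integrableOn (integrableOn_const hfin) hA h
    _ = _ := by rw [setIntegral_const, smul_eq_mul, mul_comm]

lemma IsLipDensity.mul_volume_le_mass (hp : IsLipDensity L p) {A : Set (Pt d)}
    (hA : MeasurableSet A) (hfin : volume A ≠ ∞) {M : ℝ} (h : ∀ x ∈ A, M ≤ p x) :
    M * volume.real A ≤ mass p A := by
  rw [hp.mass_eq hA]
  calc M * volume.real A = ∫ _x in A, M := by rw [setIntegral_const, smul_eq_mul, mul_comm]
    _ ≤ ∫ x in A, p x :=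
        setIntegral_mono_on (integrableOn_const hfin) hp.integrable.integrableOn hA h

lemma IsLipDensity.lip_pos (hd : 1 ≤ d) (hp : IsLipDensity L p) : 0 < L := by
  by_contra! hL
  have hconst : ∀ x, p x = p 0 := fun x => by
    have h := hp.lipschitz x 0
    have h1 : L * ‖x - 0‖ ≤ 0 := mul_nonpos_of_nonpos_of_nonneg hL (norm_nonneg _)
    have h2 : |p x - p 0| = 0 := le_antisymm (h.trans h1) (abs_nonneg _)
    linarith [abs_eq_zero.1 h2]
  have hne : Nonempty (Fin d) := ⟨⟨0, hd⟩⟩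
  have h := hp.integral_eq_one
  simp_rw [hconst] at h
  rw [integral_const] at h
  have h2 : (volume : Measure (Pt d)).real Set.univ = 0 := by
    have : Nontrivial (Pt d) := inferInstance
    rw [measureReal_def, measure_univ_of_isAddLeftInvariant, ENNReal.toReal_top]
  rw [h2, zero_smul] at h
  exact zero_ne_one h

lemma IsLipDensity.abs_sub_center_le (hp : IsLipDensity L p) (hL : 0 ≤ L) {Q : Cube d} {x : Pt d}
    (hx : x ∈ Q.toSet) (hs : 0 ≤ Q.side) : |p x - p Q.center| ≤ L * Q.diam / 2 := by
  have h1 := hp.lipschitz x Q.center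
  have h2 := mul_le_mul_of_nonneg_left (Cube.norm_sub_center_le hx hs) hL
  linarith

/-- A Lipschitz density is bounded: above a point where the value is `h`, the density is at least
`h / 2` on a cube of diameter `h / L`, whose mass is at most `1`. -/
lemma IsLipDensity.pow_le (hd : 1 ≤ d) (hp : IsLipDensity L p) (x : Pt d) :
    p x ^ (d + 1) ≤ 2 * (Real.sqrt d * L) ^ d := by
  have hL := hp.lip_pos hd
  have hd0 : 0 < Real.sqrt d := Real.sqrt_pos.2 (by exact_mod_cast hd)
  have hx0 := hp.nonneg x
  set Q := cubeAt x (p x / (L * Real.sqrt d) / 2) with hQ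
  have hside : Q.side = p x / (L * Real.sqrt d) := by simp [hQ, cubeAt]; ring
  have hs0 : 0 ≤ Q.side := by rw [hside]; positivity
  have hdiam : L * Q.diam = p x := by
    rw [Cube.diam, hside]; field_simp
  have h : p x / 2 * volume.real Q.toSet ≤ mass p Q.toSet := by
    refine hp.mul_volume_le_mass Q.measurableSet_toSet (Q.volume_toSet_ne_top hs0) fun y hy => ?_
    have := hp.abs_sub_center_le hL.le hy hs0
    rw [hdiam, hQ, cubeAt_center] at this
    linarith [(abs_le.1 this).1]
  have h1 := h.trans (hp.mass_le_one _)
  rw [Q.volume_real_toSet hs0, hside, div_pow, div_mul_div_comm, div_le_one (by positivity)] at h1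
  rw [pow_succ', mul_comm (Real.sqrt d)]
  exact h1

/-- An explicit upper bound for Lipschitz densities. -/
def supBound (d : ℕ) (L : ℝ) : ℝ := (2 * (Real.sqrt d * L) ^ d) ^ ((1 : ℝ) / (d + 1))

lemma supBound_pos (hd : 1 ≤ d) (hL : 0 < L) : 0 < supBound d L := by
  have hd0 : 0 < Real.sqrt d := Real.sqrt_pos.2 (by exact_mod_cast hd)
  unfold supBound; positivity

lemma IsLipDensity.le_supBound (hd : 1 ≤ d) (hp : IsLipDensity L p) (x : Pt d) :
    p x ≤ supBound d L := by
  have h := hp.pow_le hd x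
  have hL := hp.lip_pos hd
  have h2 := Real.rpow_le_rpow (z := (1 : ℝ) / (d + 1)) (pow_nonneg (hp.nonneg x) _) h
    (by positivity)
  rw [← Real.rpow_natCast, ← Real.rpow_mul (hp.nonneg x)] at h2
  have e : ((d + 1 : ℕ) : ℝ) * (1 / (d + 1)) = 1 := by
    push_cast; field_simp
  rw [e, Real.rpow_one] at h2
  exact h2

/-! ### The effective support -/

lemma iUnion_cubeAt (x : Pt d) : ⋃ m : ℕ, (cubeAt x m).toSet = Set.univ := by
  refine Set.eq_univ_of_forall fun y => Set.mem_iUnion.2 ?_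
  obtain ⟨m, hm⟩ := exists_nat_gt ‖y - x‖
  refine ⟨m, fun i => ?_⟩
  have h1 : |y i - x i| ≤ ‖y - x‖ := by
    have := PiLp.norm_apply_le (y - x) i
    simpa using this
  have h2 := abs_le.1 h1
  simp only [cubeAt]
  constructor <;> linarith [h2.1, h2.2]

lemma IsLipDensity.mass_cubeAt_le (hd : 1 ≤ d) (hp : IsLipDensity L p) (x : Pt d) {r s : ℝ}
    (hr : 0 ≤ r) (hrs : r ≤ s) :
    mass p (cubeAt x s).toSet ≤
      mass p (cubeAt x r).toSet + supBound d L * ((2 * s) ^ d - (2 * r) ^ d) := by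
  have hs : 0 ≤ s := hr.trans hrs
  have hr' : 0 ≤ (cubeAt x r).side := by simp [cubeAt, hr]
  have hs' : 0 ≤ (cubeAt x s).side := by simp [cubeAt, hs]
  have hsub := cubeAt_mono x hrs
  have h1 : mass p ((cubeAt x s).toSet \ (cubeAt x r).toSet) ≤
      supBound d L * ((2 * s) ^ d - (2 * r) ^ d) := by
    refine (hp.mass_le_mul_volume ((Cube.measurableSet_toSet _).diff (Cube.measurableSet_toSet _))
      (measure_ne_top_of_subset Set.sdiff_subset (Cube.volume_toSet_ne_top _ hs'))
      fun y _ => hp.le_supBound hd y).trans_eq ?_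
    rw [measureReal_sdiff hsub (Cube.measurableSet_toSet _) (Cube.volume_toSet_ne_top _ hs'),
      Cube.volume_real_toSet _ hr', Cube.volume_real_toSet _ hs']
    rfl
  have h2 := hp.mass_union_le (cubeAt x r).toSet ((cubeAt x s).toSet \ (cubeAt x r).toSet)
  rw [Set.union_sdiff_cancel hsub] at h2
  linarith

lemma effSupport_spec (hd : 1 ≤ d) (hp : IsLipDensity L p) {a : ℝ} (ha : 0 < a) (ha1 : a < 1) :
    0 < (effSupport p a).side ∧ 1 - a ≤ mass p (effSupport p a).toSet := by
  set R := {r : ℝ | 0 < r ∧ 1 - a ≤ mass p (cubeAt (mean p) r).toSet} with hR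
  have hbdd : BddBelow R := ⟨0, fun r hr => hr.1.le⟩
  have hne : R.Nonempty := by
    have := hp.isProbabilityMeasure
    have h := tendsto_measure_iUnion_atTop (μ := law p)
      (s := fun m : ℕ => (cubeAt (mean p) m).toSet)
      fun m k hmk => cubeAt_mono _ (by exact_mod_cast hmk)
    rw [iUnion_cubeAt, measure_univ] at h
    have h' := (ENNReal.tendsto_toReal ENNReal.one_ne_top).comp h
    have h2 := h'.eventually (lt_mem_nhds (show 1 - a < ENNReal.toReal 1 by simpa using ha))
    obtain ⟨m, hm, hm0⟩ := (h2.and (Filter.eventually_gt_atTop 0)).exists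
    exact ⟨m, by exact_mod_cast hm0, le_of_lt hm⟩
  set r := sInf R with hr
  have hr0 : 0 ≤ r := le_csInf hne fun r hr => hr.1.le
  have hgt : ∀ s, r < s → 1 - a ≤ mass p (cubeAt (mean p) s).toSet := fun s hs => by
    obtain ⟨u, hu, hus⟩ := exists_lt_of_csInf_lt hne hs
    exact hu.2.trans (hp.mass_mono (cubeAt_mono _ hus.le))
  have hmass : 1 - a ≤ mass p (cubeAt (mean p) r).toSet := by
    have hcont : Filter.Tendsto (fun s : ℝ => mass p (cubeAt (mean p) r).toSet +
        supBound d L * ((2 * s) ^ d - (2 * r) ^ d)) (nhdsWithin r (Set.Ioi r))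
        (nhds (mass p (cubeAt (mean p) r).toSet +
        supBound d L * ((2 * r) ^ d - (2 * r) ^ d))) := by
      apply Filter.Tendsto.mono_left _ nhdsWithin_le_nhds
      exact Continuous.tendsto (by fun_prop) r
    rw [sub_self, mul_zero, add_zero] at hcont
    refine ge_of_tendsto hcont ?_
    filter_upwards [self_mem_nhdsWithin] with s hs
    exact (hgt s hs).trans (hp.mass_cubeAt_le hd _ hr0 (le_of_lt hs))
  have hrpos : 0 < r := by
    rcases hr0.eq_or_lt with h | h
    · exfalso
      have h1 := hp.mass_le_mul_volume (Cube.measurableSet_toSet (cubeAt (mean p) r))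
        (Cube.volume_toSet_ne_top _ (by simp [cubeAt, hr0])) fun y _ => hp.le_supBound hd y
      rw [Cube.volume_real_toSet _ (by simp [cubeAt, hr0])] at h1
      have h2 : (cubeAt (mean p) r).side = 0 := by simp [cubeAt, ← h]
      rw [h2, zero_pow (by omega), mul_zero] at h1
      linarith
    · exact h
  exact ⟨mul_pos two_pos hrpos, hmass⟩

end LipDensity

/-! ### The recursive partition -/

section Partition

variable {d : ℕ} {p₀ : Pt d → ℝ} {t θ₁ θ₂ : ℝ}

/-- The kept cubes of the recursive partition started at `Q`. -/
def keptCubes (p₀ : Pt d → ℝ) (t θ₁ θ₂ : ℝ) (Q : Cube d) : Set (Cube d) :=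
  {R | Visited p₀ t θ₁ θ₂ Q R ∧ ¬ Removed p₀ t R ∧ SmallEnough p₀ θ₁ θ₂ R}

lemma Visited.trans_child {Q R : Cube d} {s : Fin d → Bool} (h₁ : ¬ Removed p₀ t Q)
    (h₂ : ¬ SmallEnough p₀ θ₁ θ₂ Q) (h : Visited p₀ t θ₁ θ₂ (Q.child s) R) :
    Visited p₀ t θ₁ θ₂ Q R := by
  induction h with
  | root => exact .split Q s .root h₁ h₂
  | split P u _ h₁' h₂' ih => exact .split P u ih h₁' h₂'

lemma Visited.eq_or_child {Q R : Cube d} (h : Visited p₀ t θ₁ θ₂ Q R) :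
    R = Q ∨ (¬ Removed p₀ t Q ∧ ¬ SmallEnough p₀ θ₁ θ₂ Q ∧
      ∃ s, Visited p₀ t θ₁ θ₂ (Q.child s) R) := by
  induction h with
  | root => exact Or.inl rfl
  | split P u _ h₁ h₂ ih =>
    rcases ih with rfl | ⟨h₁', h₂', s, hs⟩
    · exact Or.inr ⟨h₁, h₂, u, .root⟩
    · exact Or.inr ⟨h₁', h₂', s, .split P u hs h₁ h₂⟩

lemma Cube.child_subset (Q : Cube d) (s : Fin d → Bool) :
    (Q.child s).toSet ⊆ Q.toSet := by
  intro x hx i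
  have := hx i
  simp only [Cube.child] at this
  split_ifs at this <;> constructor <;> linarith [this.1, this.2]

lemma Cube.exists_mem_child (Q : Cube d) {x : Pt d} (hx : x ∈ Q.toSet) :
    ∃ s, x ∈ (Q.child s).toSet := by
  classical
  refine ⟨fun i => decide (Q.corner i + Q.side / 2 ≤ x i), fun i => ?_⟩
  have := hx i
  simp only [Cube.child, decide_eq_true_eq]
  split_ifs with h
  · constructor <;> linarith [this.1, this.2]
  · constructor <;> linarith [this.1, this.2]

lemma Cube.disjoint_child (Q : Cube d) {s u : Fin d → Bool} (h : s ≠ u) :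
    Disjoint (Q.child s).toSet (Q.child u).toSet := by
  obtain ⟨i, hi⟩ := Function.ne_iff.1 h
  rw [Set.disjoint_left]
  intro x hs hu
  have h1 := hs i
  have h2 := hu i
  simp only [Cube.child] at h1 h2
  cases hsi : s i <;> cases hui : u i <;> simp_all <;> linarith [h1.1, h1.2, h2.1, h2.2]

/-- The recursive partition started at `Q` terminates: its kept cubes are finitely many disjoint
subcubes of `Q`, and they cover the points of `Q` at which the density exceeds `t`. -/
structure GoodPartition (p₀ : Pt d → ℝ) (t θ₁ θ₂ : ℝ) (Q : Cube d) : Prop where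
  finite : (keptCubes p₀ t θ₁ θ₂ Q).Finite
  subset : ∀ R ∈ keptCubes p₀ t θ₁ θ₂ Q, R.toSet ⊆ Q.toSet
  disjoint : (keptCubes p₀ t θ₁ θ₂ Q).Pairwise fun R R' => Disjoint R.toSet R'.toSet
  cover : ∀ x ∈ Q.toSet, p₀ x ≤ t ∨ ∃ R ∈ keptCubes p₀ t θ₁ θ₂ Q, x ∈ R.toSet

lemma goodPartition_of_stop {Q : Cube d} (h : Removed p₀ t Q ∨ SmallEnough p₀ θ₁ θ₂ Q) :
    GoodPartition p₀ t θ₁ θ₂ Q := by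
  have hsub : keptCubes p₀ t θ₁ θ₂ Q ⊆ {Q} := by
    rintro R ⟨hR, -, -⟩
    rcases hR.eq_or_child with rfl | ⟨h₁, h₂, -⟩
    · rfl
    · exact absurd h (not_or.2 ⟨h₁, h₂⟩)
  refine ⟨(Set.finite_singleton Q).subset hsub, fun R hR => ?_, ?_, fun x hx => ?_⟩
  · rw [hsub hR]
  · exact (Set.pairwise_singleton Q _).mono hsub
  · by_cases hr : Removed p₀ t Q
    · exact Or.inl (hr x hx)
    · exact Or.inr ⟨Q, ⟨.root, hr, h.resolve_left hr⟩, hx⟩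

lemma goodPartition_of_children {Q : Cube d} (hs : 0 ≤ Q.side) (h₁ : ¬ Removed p₀ t Q)
    (h₂ : ¬ SmallEnough p₀ θ₁ θ₂ Q) (h : ∀ s, GoodPartition p₀ t θ₁ θ₂ (Q.child s)) :
    GoodPartition p₀ t θ₁ θ₂ Q := by
  have hK : ∀ R, R ∈ keptCubes p₀ t θ₁ θ₂ Q ↔ ∃ s, R ∈ keptCubes p₀ t θ₁ θ₂ (Q.child s) := by
    intro R
    constructor
    · rintro ⟨hR, hR₁, hR₂⟩
      rcases hR.eq_or_child with rfl | ⟨-, -, s, hv⟩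
      · exact absurd hR₂ h₂
      · exact ⟨s, hv, hR₁, hR₂⟩
    · rintro ⟨s, hv, hR₁, hR₂⟩
      exact ⟨hv.trans_child h₁ h₂, hR₁, hR₂⟩
  refine ⟨?_, fun R hR => ?_, fun R hR R' hR' hne => ?_, fun x hx => ?_⟩
  · refine (Set.finite_iUnion fun s => (h s).finite).subset fun R hR => ?_
    obtain ⟨s, hs⟩ := (hK R).1 hR
    exact Set.mem_iUnion.2 ⟨s, hs⟩
  · obtain ⟨s, hR⟩ := (hK R).1 hR
    exact ((h s).subset R hR).trans (Q.child_subset s)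
  · obtain ⟨s, hR⟩ := (hK R).1 hR
    obtain ⟨u, hR'⟩ := (hK R').1 hR'
    by_cases hsu : s = u
    · subst hsu
      exact (h s).disjoint hR hR' hne
    · exact (Q.disjoint_child hsu).mono ((h s).subset R hR) ((h u).subset R' hR')
  · obtain ⟨s, hxs⟩ := Q.exists_mem_child hx
    refine ((h s).cover x hxs).imp_right ?_
    rintro ⟨R, hR, hxR⟩
    exact ⟨R, (hK R).2 ⟨s, hR⟩, hxR⟩

variable {L : ℝ}

/-- Cubes of small diameter are not split: if the density exceeds `t` somewhere on the cube, it is at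
least `t / 2` at the centre. -/
lemma removed_or_smallEnough (hp : IsLipDensity L p₀) (hL : 0 < L) (ht : 0 < t) (hθ₁ : 0 < θ₁)
    (hθ₂ : 0 < θ₂) {Q : Cube d} (hs : 0 ≤ Q.side)
    (hQ : Q.diam ≤ min (t / L) (min (θ₁ * (t / 2)) (θ₂ * (t / 2) ^ gam d))) :
    Removed p₀ t Q ∨ SmallEnough p₀ θ₁ θ₂ Q := by
  by_cases hr : Removed p₀ t Q
  · exact Or.inl hr
  right
  unfold Removed at hr
  push Not at hr
  obtain ⟨x, hx, hxt⟩ := hr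
  have h1 := abs_le.1 (hp.abs_sub_center_le hL.le hx hs)
  have h2 : L * Q.diam ≤ t := by
    have := mul_le_mul_of_nonneg_left (hQ.trans (min_le_left _ _)) hL.le
    rwa [mul_div_cancel₀ _ hL.ne'] at this
  have h3 : t / 2 ≤ p₀ Q.center := by linarith [h1.2]
  refine (hQ.trans (min_le_right _ _)).trans (min_le_min ?_ ?_)
  · gcongr
  · have := gam_pos d
    gcongr

lemma goodPartition (hp : IsLipDensity L p₀) (hL : 0 < L) (ht : 0 < t) (hθ₁ : 0 < θ₁)
    (hθ₂ : 0 < θ₂) {Q : Cube d} (hs : 0 ≤ Q.side) : GoodPartition p₀ t θ₁ θ₂ Q := by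
  set δ := min (t / L) (min (θ₁ * (t / 2)) (θ₂ * (t / 2) ^ gam d)) with hδ
  have hδ0 : 0 < δ := by
    refine lt_min (by positivity) (lt_min (by positivity) (by positivity))
  -- cubes of diameter at most `δ` are not split, and each split halves the diameter
  have key : ∀ k : ℕ, ∀ Q : Cube d, 0 ≤ Q.side → Q.diam ≤ 2 ^ k * δ →
      GoodPartition p₀ t θ₁ θ₂ Q := by
    intro k
    induction k with
    | zero =>
      intro Q hs hQ
      rw [pow_zero, one_mul] at hQ
      exact goodPartition_of_stop (removed_or_smallEnough hp hL ht hθ₁ hθ₂ hs hQ)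
    | succ k ih =>
      intro Q hs hQ
      by_cases h : Removed p₀ t Q ∨ SmallEnough p₀ θ₁ θ₂ Q
      · exact goodPartition_of_stop h
      · obtain ⟨h₁, h₂⟩ := not_or.1 h
        refine goodPartition_of_children hs h₁ h₂ fun s => ih _ ?_ ?_
        · simp only [Cube.child]; linarith
        · rw [pow_succ] at hQ
          unfold Cube.diam at hQ ⊢
          simp only [Cube.child]
          linarith
  obtain ⟨k, hk⟩ := pow_unbounded_of_one_lt (Q.diam / δ) one_lt_two
  exact key k Q hs ((div_lt_iff₀ hδ0).1 hk).le

lemma Visited.side_pos {Q R : Cube d} (hs : 0 < Q.side) (h : Visited p₀ t θ₁ θ₂ Q R) :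
    0 < R.side := by
  induction h with
  | root => exact hs
  | split P u _ _ _ ih => simp only [Cube.child]; linarith

/-- The diameter `min (θ₁ ρ) (θ₂ ρ^γ)` of the bins of the adaptive partition at density level `ρ`. -/
def binDiam (d : ℕ) (θ₁ θ₂ ρ : ℝ) : ℝ := min (θ₁ * ρ) (θ₂ * ρ ^ gam d)

lemma binDiam_mono (hθ₁ : 0 ≤ θ₁) (hθ₂ : 0 ≤ θ₂) {ρ ρ' : ℝ} (hρ : 0 ≤ ρ) (h : ρ ≤ ρ') :
    binDiam d θ₁ θ₂ ρ ≤ binDiam d θ₁ θ₂ ρ' := by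
  have := gam_pos d
  exact min_le_min (by gcongr) (by gcongr)

lemma mul_binDiam_le (hθ₂ : 0 ≤ θ₂) {ρ u : ℝ} (hρ : 0 ≤ ρ) (hu0 : 0 < u) (hu : u ≤ 1) :
    u * binDiam d θ₁ θ₂ ρ ≤ binDiam d θ₁ θ₂ (u * ρ) := by
  unfold binDiam
  rw [mul_min_of_nonneg _ _ hu0.le]
  refine min_le_min (le_of_eq (by ring)) ?_
  rw [Real.mul_rpow hu0.le hρ, mul_left_comm]
  have h1 : u ≤ u ^ gam d := by
    simpa using Real.rpow_le_rpow_of_exponent_ge hu0 hu (gam_lt_one d).le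
  have h2 : 0 ≤ ρ ^ gam d := Real.rpow_nonneg hρ _
  gcongr

/-- What a bin inherits from the two stopping rules. The density on the bin is comparable to the
level `ρ`, and the diameter is comparable to the target diameter `min (θ₁ ρ) (θ₂ ρ^γ)`. -/
structure BinAtLevel (p₀ : Pt d → ℝ) (θ₁ θ₂ : ℝ) (Q : Cube d) (ρ : ℝ) : Prop where
  pos : 0 < ρ
  side_pos : 0 < Q.side
  lower : ∀ x ∈ Q.toSet, 3 / 4 * ρ ≤ p₀ x
  upper : ∀ x ∈ Q.toSet, p₀ x ≤ 5 / 4 * ρ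
  diam_le : Q.diam ≤ binDiam d θ₁ θ₂ ρ
  le_diam : 3 / 10 * binDiam d θ₁ θ₂ ρ ≤ Q.diam

/-- A Lipschitz density cannot put almost all of its mass in a single cube on which it is nearly
constant, so the effective support is always split. -/
lemma effSupport_not_smallEnough (hd : 1 ≤ d) (hp : IsLipDensity L p₀) {a : ℝ} (ha : 0 < a)
    (ha1 : a < 1 / 4) : ¬ SmallEnough p₀ (1 / (2 * L)) θ₂ (effSupport p₀ a) := by
  intro h
  have hL := hp.lip_pos hd
  obtain ⟨hs, hm⟩ := effSupport_spec hd hp ha (by linarith)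
  set r := sInf {r : ℝ | 0 < r ∧ 1 - a ≤ mass p₀ (cubeAt (mean p₀) r).toSet} with hr
  have hS : effSupport p₀ a = cubeAt (mean p₀) r := rfl
  rw [hS] at h hs hm
  set S := cubeAt (mean p₀) r with hSdef
  have hr0 : 0 < r := by simpa [hSdef, cubeAt] using hs
  set ρ := p₀ S.center with hρ
  have hdiam : L * S.diam ≤ ρ / 2 := by
    have := mul_le_mul_of_nonneg_left (h.trans (min_le_left _ _)) hL.le
    refine this.trans_eq ?_
    rw [← hρ]
    field_simp
  -- the doubled cube has at least as much mass outside `S` as a fixed part of the mass of `S`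
  set D := cubeAt (mean p₀) (2 * r) with hD
  have hDs : 0 ≤ D.side := by simp [hD, cubeAt, hr0.le]
  have hsub : S.toSet ⊆ D.toSet := cubeAt_mono _ (by linarith)
  have hDc : D.center = S.center := by rw [hD, hSdef, cubeAt_center, cubeAt_center]
  have hDd : D.diam = 2 * S.diam := by simp [Cube.diam, hD, hSdef, cubeAt]; ring
  have h1 : mass p₀ S.toSet ≤ 5 / 4 * ρ * S.side ^ d := by
    rw [← S.volume_real_toSet hs.le]
    refine hp.mass_le_mul_volume S.measurableSet_toSet (S.volume_toSet_ne_top hs.le) fun x hx => ?_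
    have := abs_le.1 (hp.abs_sub_center_le hL.le hx hs.le)
    linarith [this.2]
  have h2 : ρ / 2 * (D.side ^ d - S.side ^ d) ≤ mass p₀ (D.toSet \ S.toSet) := by
    rw [← S.volume_real_toSet hs.le, ← D.volume_real_toSet hDs,
      ← measureReal_sdiff hsub S.measurableSet_toSet (D.volume_toSet_ne_top hDs)]
    refine hp.mul_volume_le_mass (D.measurableSet_toSet.diff S.measurableSet_toSet)
      (measure_ne_top_of_subset Set.sdiff_subset (D.volume_toSet_ne_top hDs)) fun x hx => ?_
    have := abs_le.1 (hp.abs_sub_center_le hL.le hx.1 hDs)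
    rw [hDc, hDd] at this
    linarith [this.1]
  have h3 : mass p₀ (D.toSet \ S.toSet) ≤ a := by
    have e := hp.mass_mono (A := D.toSet \ S.toSet) (B := S.toSetᶜ) fun x hx => hx.2
    rw [hp.mass_compl S.measurableSet_toSet] at e
    linarith
  have h4 : S.side ^ d ≤ D.side ^ d - S.side ^ d := by
    have e : D.side = 2 * S.side := by simp [hD, hSdef, cubeAt]
    rw [e, mul_pow]
    have : (2 : ℝ) ≤ 2 ^ d := by
      simpa using pow_le_pow_right₀ (one_le_two (α := ℝ)) hd
    nlinarith [pow_pos hs d]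
  have h5 : ρ / 2 * S.side ^ d ≤ a := by
    have hρ0 : 0 ≤ ρ := hp.nonneg _
    exact (mul_le_mul_of_nonneg_left h4 (by positivity)).trans (h2.trans h3)
  linarith

/-- The kept cubes have the diameter prescribed by the density level at their centre up to a
constant: the parent of a kept cube violates the second stopping rule, and its centre is close. -/
lemma keptCube_diam (hd : 1 ≤ d) (hp : IsLipDensity L p₀) (hθ₂ : 0 < θ₂) {S Q : Cube d}
    (hS : 0 < S.side) (hroot : ¬ SmallEnough p₀ (1 / (2 * L)) θ₂ S)
    (hQ : Q ∈ keptCubes p₀ t (1 / (2 * L)) θ₂ S) :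
    0 < Q.side ∧ 0 < p₀ Q.center ∧ L * Q.diam ≤ p₀ Q.center / 2 ∧
      Q.diam ≤ binDiam d (1 / (2 * L)) θ₂ (p₀ Q.center) ∧
      3 / 8 * binDiam d (1 / (2 * L)) θ₂ (p₀ Q.center) ≤ Q.diam := by
  have hL := hp.lip_pos hd
  obtain ⟨hv, -, hsm⟩ := hQ
  have hs := hv.side_pos hS
  have hdiam0 : 0 < Q.diam := mul_pos (Real.sqrt_pos.2 (by exact_mod_cast hd)) hs
  have hdiam : L * Q.diam ≤ p₀ Q.center / 2 := by
    have := mul_le_mul_of_nonneg_left (hsm.trans (min_le_left _ _)) hL.le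
    refine this.trans_eq ?_
    field_simp
  have hρ : 0 < p₀ Q.center := by nlinarith
  refine ⟨hs, hρ, hdiam, hsm, ?_⟩
  cases hv with
  | root => exact absurd hsm hroot
  | split P s hvP h₁ h₂ =>
    have hPs := hvP.side_pos hS
    have h1 := abs_le.1 ((hp.lipschitz (P.child s).center P.center).trans
      (mul_le_mul_of_nonneg_left (P.norm_center_child_sub_le s hPs.le) hL.le))
    have h2 : 3 / 4 * p₀ (P.child s).center ≤ p₀ P.center := by linarith [h1.2]
    have h3 : binDiam d (1 / (2 * L)) θ₂ (p₀ P.center) < P.diam := not_le.1 h₂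
    have h4 := binDiam_mono (d := d) (θ₁ := 1 / (2 * L)) (by positivity) hθ₂.le
      (by positivity) h2
    have h5 := mul_binDiam_le (d := d) (θ₁ := 1 / (2 * L)) hθ₂.le hρ.le
      (show (0 : ℝ) < 3 / 4 by norm_num) (by norm_num)
    have h6 : P.diam = 2 * (P.child s).diam := by
      unfold Cube.diam Cube.child; simp only; ring
    linarith

end Partition

/-! ### The normalization `μ` -/

section Mu

variable {d : ℕ} {L : ℝ} {p₀ : Pt d → ℝ} {ε : ℝ}

lemma IsLipDensity.measurable_rpow (hp : IsLipDensity L p₀) :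
    Measurable fun x => p₀ x ^ gam d := hp.measurable.pow_const _

/-- The integrand in the definition of `μ`. -/
def truncDensity (p₀ : Pt d → ℝ) (ε m : ℝ) (y : Pt d) : ℝ :=
  min (p₀ y / (1 / 4)) (ε * p₀ y ^ gam d / m)

lemma truncDensity_nonneg (hp : IsLipDensity L p₀) (hε : 0 ≤ ε) {m : ℝ} (hm : 0 ≤ m) (y : Pt d) :
    0 ≤ truncDensity p₀ ε m y := by
  have := hp.nonneg y
  unfold truncDensity
  positivity

lemma truncDensity_le (m : ℝ) (y : Pt d) : truncDensity p₀ ε m y ≤ 4 * p₀ y :=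
  (min_le_left _ _).trans_eq (by ring)

lemma measurable_truncDensity (hp : IsLipDensity L p₀) (m : ℝ) :
    Measurable (truncDensity p₀ ε m) :=
  (hp.measurable.div_const _).min ((hp.measurable_rpow.const_mul _).div_const _)

lemma integrable_truncDensity (hp : IsLipDensity L p₀) (hε : 0 ≤ ε) {m : ℝ} (hm : 0 ≤ m) :
    Integrable (truncDensity p₀ ε m) := by
  refine (hp.integrable.const_mul 4).mono' (measurable_truncDensity hp m).aestronglyMeasurable
    (ae_of_all _ fun y => ?_)
  rw [Real.norm_eq_abs, abs_of_nonneg (truncDensity_nonneg hp hε hm y)]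
  exact truncDensity_le m y

lemma tendsto_integral_truncDensity (hp : IsLipDensity L p₀) (hε : 0 ≤ ε) {l : Filter ℝ}
    [l.IsCountablyGenerated] (hl : ∀ᶠ m in l, 0 ≤ m) {f : Pt d → ℝ}
    (hf : ∀ y, Filter.Tendsto (fun m => truncDensity p₀ ε m y) l (nhds (f y))) :
    Filter.Tendsto (fun m => ∫ y, truncDensity p₀ ε m y) l (nhds (∫ y, f y)) := by
  refine tendsto_integral_filter_of_dominated_convergence (fun y => 4 * p₀ y)
    (Filter.Eventually.of_forall fun m => (measurable_truncDensity hp m).aestronglyMeasurable)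
    ?_ (hp.integrable.const_mul 4) (ae_of_all _ hf)
  filter_upwards [hl] with m hm
  refine ae_of_all _ fun y => ?_
  rw [Real.norm_eq_abs, abs_of_nonneg (truncDensity_nonneg hp hε hm y)]
  exact truncDensity_le m y

/-- The infimum in the definition of `μ` is attained: the set of solutions is nonempty, closed and
bounded away from `0`. -/
lemma muFun_spec (hp : IsLipDensity L p₀) (hε : 0 < ε) (hε2 : ε ≤ 2) :
    0 < muFun p₀ ε (1 / 4) ∧ ε = ∫ y, truncDensity p₀ ε (muFun p₀ ε (1 / 4)) y := by
  -- `F` is continuous with limits `4 > ε` at `0` and `0` at infinity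
  set F : ℝ → ℝ := fun m => ∫ y, truncDensity p₀ ε m y with hF
  have hcont : ContinuousOn F (Set.Ioi 0) := by
    intro m hm
    have hm' : m ≠ 0 := ne_of_gt hm
    refine tendsto_integral_truncDensity hp hε.le ?_ fun y => ?_
    · filter_upwards [self_mem_nhdsWithin] with x hx using le_of_lt hx
    · apply Filter.Tendsto.mono_left _ nhdsWithin_le_nhds
      unfold truncDensity
      exact tendsto_const_nhds.min (tendsto_const_nhds.div Filter.tendsto_id hm')
  have hzero : Filter.Tendsto F (nhdsWithin 0 (Set.Ioi 0)) (nhds 4) := by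
    have h4 : (4 : ℝ) = ∫ y, 4 * p₀ y := by
      rw [integral_const_mul, hp.integral_eq_one, mul_one]
    rw [h4]
    refine tendsto_integral_truncDensity hp hε.le ?_ fun y => ?_
    · filter_upwards [self_mem_nhdsWithin] with x hx using le_of_lt hx
    · refine tendsto_const_nhds.congr' ?_
      rcases (hp.nonneg y).eq_or_lt with h0 | h0
      · refine Filter.Eventually.of_forall fun m => ?_
        simp [truncDensity, ← h0, (gam_pos d).ne']
      · have hr : 0 < ε * p₀ y ^ gam d / (4 * p₀ y) := by positivity
        filter_upwards [Ioc_mem_nhdsGT hr] with m hm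
        have hm0 : 0 < m := hm.1
        rw [truncDensity, min_eq_left]
        · ring
        · rw [le_div_iff₀ hm0]
          have := (le_div_iff₀ (by positivity)).1 hm.2
          linarith
  have hinf : Filter.Tendsto F Filter.atTop (nhds 0) := by
    rw [← integral_zero (Pt d) ℝ (μ := volume)]
    refine tendsto_integral_truncDensity hp hε.le (Filter.eventually_ge_atTop 0) fun y => ?_
    have h1 : Filter.Tendsto (fun m : ℝ => ε * p₀ y ^ gam d / m) Filter.atTop (nhds 0) :=
      tendsto_const_nhds.div_atTop Filter.tendsto_id
    have h2 := (tendsto_const_nhds (x := p₀ y / (1 / 4))).min h1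
    rwa [min_eq_right (by have := hp.nonneg y; positivity)] at h2
  obtain ⟨m₀, hm₀, hlow⟩ : ∃ m₀ > 0, ∀ m, 0 < m → m ≤ m₀ → ε < F m := by
    have h := hzero.eventually (lt_mem_nhds (show ε < 4 by linarith))
    obtain ⟨u, hu, hsub⟩ := (mem_nhdsGT_iff_exists_Ioc_subset).1 h
    exact ⟨u, hu, fun m hm hmu => hsub ⟨hm, hmu⟩⟩
  obtain ⟨m₁, hm₁, hhigh⟩ : ∃ m₁, m₀ ≤ m₁ ∧ F m₁ < ε :=
    ((Filter.eventually_ge_atTop m₀).and (hinf.eventually (gt_mem_nhds hε))).exists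
  obtain ⟨m₂, hm₂, hFm₂⟩ : ∃ m ∈ Set.Icc m₀ m₁, F m = ε :=
    intermediate_value_Icc' hm₁ (hcont.mono fun x hx => lt_of_lt_of_le hm₀ hx.1)
      ⟨hhigh.le, (hlow m₀ hm₀ le_rfl).le⟩
  set R := {m : ℝ | 0 < m ∧ ε = F m} with hR
  have hReq : R = {m | m ∈ Set.Ici m₀ ∧ F m = ε} := by
    ext m
    constructor
    · rintro ⟨h0, h1⟩
      refine ⟨?_, h1.symm⟩
      by_contra hlt
      exact absurd h1 (hlow m h0 (not_le.1 hlt).le).ne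
    · rintro ⟨h0, h1⟩
      exact ⟨lt_of_lt_of_le hm₀ h0, h1.symm⟩
  have hclosed : IsClosed R := by
    rw [hReq]
    exact (hcont.mono fun x hx => lt_of_lt_of_le hm₀ hx).preimage_isClosed_of_isClosed
      isClosed_Ici isClosed_singleton
  have hmem : sInf R ∈ R :=
    hclosed.csInf_mem ⟨m₂, lt_of_lt_of_le hm₀ hm₂.1, hFm₂.symm⟩ ⟨0, fun m hm => hm.1.le⟩
  exact hmem

/-- `μ` is at most twice `∫_B p₀^γ` for every set `B` carrying a mass of at least `1 - ε / 8`. -/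
lemma muFun_le (hp : IsLipDensity L p₀) (hε : 0 < ε) (hε2 : ε ≤ 2) {B : Set (Pt d)}
    (hB : MeasurableSet B) (hmass : 1 - ε / 8 ≤ mass p₀ B)
    (hint : IntegrableOn (fun x => p₀ x ^ gam d) B) :
    muFun p₀ ε (1 / 4) ≤ 2 * ∫ x in B, p₀ x ^ gam d := by
  obtain ⟨hμ, heq⟩ := muFun_spec hp hε hε2
  set μ := muFun p₀ ε (1 / 4)
  have hI := integrable_truncDensity hp hε.le hμ.le
  have h1 : ∫ y in B, truncDensity p₀ ε μ y ≤ ε / μ * ∫ x in B, p₀ x ^ gam d := by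
    rw [← integral_const_mul]
    refine setIntegral_mono_on hI.integrableOn (hint.const_mul _) hB fun y _ => ?_
    exact (min_le_right _ _).trans_eq (by ring)
  have h2 : ∫ y in Bᶜ, truncDensity p₀ ε μ y ≤ 4 * mass p₀ Bᶜ := by
    rw [hp.mass_eq hB.compl, ← integral_const_mul]
    exact setIntegral_mono_on hI.integrableOn (hp.integrable.const_mul 4).integrableOn hB.compl
      fun y _ => truncDensity_le _ _
  rw [hp.mass_compl hB] at h2
  have h3 := integral_add_compl hB hI
  have h4 : ε / 2 ≤ ε / μ * ∫ x in B, p₀ x ^ gam d := by linarith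
  rw [div_mul_eq_mul_div, le_div_iff₀ hμ] at h4
  have h5 : ε * μ ≤ ε * (2 * ∫ x in B, p₀ x ^ gam d) := by linarith
  exact le_of_mul_le_mul_left h5 hε

end Mu

/-! ### The truncated functional -/

section TruncT

variable {d : ℕ} {L : ℝ} {p₀ : Pt d → ℝ}

/-- The infimum of `∫_B p₀^γ`, before the power `1 / γ` is taken. -/
def truncV (p₀ : Pt d → ℝ) (σ : ℝ) : ℝ≥0∞ :=
  ⨅ B ∈ {B : Set (Pt d) | MeasurableSet B ∧ ENNReal.ofReal (1 - σ) ≤ law p₀ B},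
    ∫⁻ x in B, ENNReal.ofReal (p₀ x ^ gam d)

lemma truncT_eq_rpow (p₀ : Pt d → ℝ) (σ : ℝ) : truncT p₀ σ = truncV p₀ σ ^ (1 / gam d) := by
  have h : 0 < 1 / gam d := one_div_pos.2 (gam_pos d)
  have e : ∀ u : ℝ≥0∞, u ^ (1 / gam d) = ENNReal.orderIsoRpow _ h u := fun _ => rfl
  unfold truncT truncV
  simp_rw [e, OrderIso.map_iInf]

lemma IsLipDensity.ofReal_le_law_iff (hp : IsLipDensity L p₀) {B : Set (Pt d)} {u : ℝ} :
    ENNReal.ofReal u ≤ law p₀ B ↔ u ≤ mass p₀ B := by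
  have := hp.isProbabilityMeasure
  rw [mass, measureReal_def, ENNReal.ofReal_le_iff_le_toReal (measure_ne_top _ _)]

lemma truncV_le {σ : ℝ} (hp : IsLipDensity L p₀) {B : Set (Pt d)} (hB : MeasurableSet B)
    (h : 1 - σ ≤ mass p₀ B) : truncV p₀ σ ≤ ∫⁻ x in B, ENNReal.ofReal (p₀ x ^ gam d) :=
  iInf₂_le B ⟨hB, hp.ofReal_le_law_iff.2 h⟩

lemma le_truncV {σ : ℝ} (hp : IsLipDensity L p₀) {u : ℝ≥0∞}
    (h : ∀ B, MeasurableSet B → 1 - σ ≤ mass p₀ B →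
      u ≤ ∫⁻ x in B, ENNReal.ofReal (p₀ x ^ gam d)) : u ≤ truncV p₀ σ :=
  le_iInf₂ fun B hB => h B hB.1 (hp.ofReal_le_law_iff.1 hB.2)

lemma truncV_anti (hp : IsLipDensity L p₀) {σ τ : ℝ} (h : σ ≤ τ) : truncV p₀ τ ≤ truncV p₀ σ :=
  le_truncV hp fun _ hB hm => truncV_le hp hB (by linarith)

lemma truncV_eq_zero (hp : IsLipDensity L p₀) {σ : ℝ} (h : 1 ≤ σ) : truncV p₀ σ = 0 := by
  refine le_antisymm ?_ zero_le
  have := truncV_le (σ := σ) hp MeasurableSet.empty (by have := mass_nonneg (p := p₀) ∅; linarith)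
  simpa using this

lemma truncV_ne_top (hd : 1 ≤ d) (hp : IsLipDensity L p₀) {σ : ℝ} (h : 0 < σ) :
    truncV p₀ σ ≠ ∞ := by
  have hm := effSupport_spec hd hp (a := min σ (1 / 2)) (by positivity)
    (lt_of_le_of_lt (min_le_right _ _) (by norm_num))
  set S := effSupport p₀ (min σ (1 / 2))
  have h1 := truncV_le (σ := σ) hp S.measurableSet_toSet
    (by have := min_le_left σ (1 / 2); linarith [hm.2])
  refine ne_top_of_le_ne_top ?_ h1
  have hle : ∀ x ∈ S.toSet, ENNReal.ofReal (p₀ x ^ gam d) ≤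
      ENNReal.ofReal (supBound d L ^ gam d) := fun x _ => by
    refine ENNReal.ofReal_le_ofReal (Real.rpow_le_rpow (hp.nonneg x) (hp.le_supBound hd x)
      (gam_pos d).le)
  refine ne_top_of_le_ne_top ?_ (setLIntegral_mono measurable_const hle)
  rw [setLIntegral_const]
  exact ENNReal.mul_ne_top ENNReal.ofReal_ne_top (S.volume_toSet_ne_top hm.1.le)

/-- The real value of the truncated functional. -/
def realT (p₀ : Pt d → ℝ) (σ : ℝ) : ℝ := (truncV p₀ σ).toReal ^ (1 / gam d)

lemma realT_nonneg (p₀ : Pt d → ℝ) (σ : ℝ) : 0 ≤ realT p₀ σ :=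
  Real.rpow_nonneg ENNReal.toReal_nonneg _

lemma truncT_eq_ofReal (hd : 1 ≤ d) (hp : IsLipDensity L p₀) {σ : ℝ} (h : 0 < σ) :
    truncT p₀ σ = ENNReal.ofReal (realT p₀ σ) := by
  rw [truncT_eq_rpow, realT, ← ENNReal.ofReal_rpow_of_nonneg ENNReal.toReal_nonneg
    (one_div_pos.2 (gam_pos d)).le, ENNReal.ofReal_toReal (truncV_ne_top hd hp h)]

lemma realT_anti (hd : 1 ≤ d) (hp : IsLipDensity L p₀) {σ τ : ℝ} (hσ : 0 < σ) (h : σ ≤ τ) :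
    realT p₀ τ ≤ realT p₀ σ :=
  Real.rpow_le_rpow ENNReal.toReal_nonneg
    (ENNReal.toReal_mono (truncV_ne_top hd hp hσ) (truncV_anti hp h))
    (one_div_pos.2 (gam_pos d)).le

lemma realT_eq_zero (hp : IsLipDensity L p₀) {σ : ℝ} (h : 1 ≤ σ) : realT p₀ σ = 0 := by
  rw [realT, truncV_eq_zero hp h, ENNReal.toReal_zero,
    Real.zero_rpow (one_div_pos.2 (gam_pos d)).ne']

/-- On a set where the density is at least `τ`, the integral of `p₀^γ` is controlled by the mass. -/
lemma lintegral_rpow_le (hp : IsLipDensity L p₀) {E : Set (Pt d)} (hE : MeasurableSet E) {τ : ℝ}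
    (hτ : 0 < τ) (h : ∀ x ∈ E, τ ≤ p₀ x) :
    ∫⁻ x in E, ENNReal.ofReal (p₀ x ^ gam d) ≤
      ENNReal.ofReal (τ ^ (gam d - 1) * mass p₀ E) := by
  have h1 : ∀ x ∈ E, ENNReal.ofReal (p₀ x ^ gam d) ≤
      ENNReal.ofReal (τ ^ (gam d - 1)) * ENNReal.ofReal (p₀ x) := fun x hx => by
    have hx0 : 0 < p₀ x := hτ.trans_le (h x hx)
    rw [← ENNReal.ofReal_mul (by positivity)]
    refine ENNReal.ofReal_le_ofReal ?_
    calc p₀ x ^ gam d = p₀ x ^ (gam d - 1) * p₀ x := by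
          rw [Real.rpow_sub_one hx0.ne', div_mul_cancel₀ _ hx0.ne']
      _ ≤ τ ^ (gam d - 1) * p₀ x := by
          have := Real.rpow_le_rpow_of_nonpos hτ (h x hx)
            (show gam d - 1 ≤ 0 by linarith [gam_lt_one d])
          gcongr
  refine (setLIntegral_mono (hp.measurable.ennreal_ofReal.const_mul _) h1).trans_eq ?_
  rw [lintegral_const_mul _ hp.measurable.ennreal_ofReal, ENNReal.ofReal_mul (by positivity),
    hp.mass_eq hE, ofReal_integral_eq_lintegral_ofReal hp.integrable.integrableOn
    (ae_of_all _ hp.nonneg)]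

/-- Lipschitz densities have no atoms in the sense of intermediate values. -/
lemma exists_subset_mass_eq (hd : 1 ≤ d) (hp : IsLipDensity L p₀) {G : Set (Pt d)}
    (hG : MeasurableSet G) {η : ℝ} (hη : 0 ≤ η) (h : η < mass p₀ G) :
    ∃ E ⊆ G, MeasurableSet E ∧ mass p₀ E = η := by
  have := hp.isProbabilityMeasure
  set g : ℝ → ℝ := fun r => mass p₀ (G ∩ (cubeAt 0 r).toSet) with hg
  have hmono : ∀ r s, 0 ≤ r → r ≤ s → g s - g r ≤
      supBound d L * (2 * s) ^ d - supBound d L * (2 * r) ^ d ∧ g r ≤ g s := by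
    intro r s hr hrs
    refine ⟨?_, hp.mass_mono (Set.inter_subset_inter_right _ (cubeAt_mono _ hrs))⟩
    have h1 := hp.mass_cubeAt_le hd 0 hr hrs
    have h2 : G ∩ (cubeAt 0 s).toSet ⊆ (G ∩ (cubeAt 0 r).toSet) ∪
        ((cubeAt 0 s).toSet \ (cubeAt 0 r).toSet) := fun x hx => by
      by_cases hxr : x ∈ (cubeAt (0 : Pt d) r).toSet
      · exact Or.inl ⟨hx.1, hxr⟩
      · exact Or.inr ⟨hx.2, hxr⟩
    have h3 := (hp.mass_mono h2).trans (hp.mass_union_le _ _)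
    have h4 : mass p₀ ((cubeAt 0 s).toSet \ (cubeAt 0 r).toSet) =
        mass p₀ (cubeAt 0 s).toSet - mass p₀ (cubeAt 0 r).toSet :=
      measureReal_sdiff (cubeAt_mono _ hrs) (Cube.measurableSet_toSet _)
    simp only [hg]
    linarith
  have hcont : ContinuousOn g (Set.Ici 0) := by
    intro r hr
    have hh : Filter.Tendsto (fun s : ℝ => |supBound d L * (2 * s) ^ d -
        supBound d L * (2 * r) ^ d|) (nhdsWithin r (Set.Ici 0)) (nhds 0) := by
      apply Filter.Tendsto.mono_left _ nhdsWithin_le_nhds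
      have : Continuous fun s : ℝ => |supBound d L * (2 * s) ^ d -
        supBound d L * (2 * r) ^ d| := by fun_prop
      simpa using this.tendsto r
    refine tendsto_iff_dist_tendsto_zero.2 (squeeze_zero' (Filter.Eventually.of_forall
      fun _ => dist_nonneg) ?_ hh)
    filter_upwards [self_mem_nhdsWithin] with s hs
    rw [Real.dist_eq]
    rcases le_total r s with hrs | hrs
    · obtain ⟨a, b⟩ := hmono r s hr hrs
      rw [abs_of_nonneg (by linarith), abs_of_nonneg (by linarith)]
      exact a
    · obtain ⟨a, b⟩ := hmono s r hs hrs
      rw [abs_sub_comm, abs_of_nonneg (by linarith), abs_sub_comm, abs_of_nonneg (by linarith)]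
      exact a
  have hlim : Filter.Tendsto (fun m : ℕ => g m) Filter.atTop (nhds (mass p₀ G)) := by
    have h1 := tendsto_measure_iUnion_atTop (μ := law p₀)
      (s := fun m : ℕ => G ∩ (cubeAt (0 : Pt d) m).toSet)
      fun m k hmk => Set.inter_subset_inter_right _ (cubeAt_mono _ (by exact_mod_cast hmk))
    rw [← Set.inter_iUnion, iUnion_cubeAt, Set.inter_univ] at h1
    exact (ENNReal.tendsto_toReal (measure_ne_top _ _)).comp h1
  obtain ⟨m, hm⟩ := (hlim.eventually (lt_mem_nhds h)).exists
  have hg0 : g 0 = 0 := by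
    refine le_antisymm ((hp.mass_mono Set.inter_subset_right).trans ?_) (mass_nonneg _)
    have h1 := hp.mass_le_mul_volume (Cube.measurableSet_toSet (cubeAt (0 : Pt d) 0))
      (Cube.volume_toSet_ne_top _ (by simp [cubeAt])) fun y _ => hp.le_supBound hd y
    rw [Cube.volume_real_toSet _ (by simp [cubeAt])] at h1
    have h2 : (cubeAt (0 : Pt d) 0).side = 0 := by simp [cubeAt]
    rwa [h2, zero_pow (by omega), mul_zero] at h1
  obtain ⟨r, -, hr⟩ := intermediate_value_Icc (show (0 : ℝ) ≤ m by positivity)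
    (hcont.mono fun x hx => hx.1) ⟨hg0.le.trans hη, hm.le⟩
  exact ⟨_, Set.inter_subset_left, hG.inter (Cube.measurableSet_toSet _), hr⟩

lemma exists_level_mass_lt (hp : IsLipDensity L p₀) {s : ℝ} (hs : 0 < s) :
    ∃ τ > 0, mass p₀ {x | p₀ x < τ} < s := by
  have := hp.isProbabilityMeasure
  have h := tendsto_measure_iInter_atTop (μ := law p₀)
    (s := fun m : ℕ => {x | p₀ x < 1 / ((m : ℝ) + 1)})
    (fun m => (measurableSet_lt hp.measurable measurable_const).nullMeasurableSet)
    (fun m k hmk x (hx : p₀ x < 1 / ((k : ℝ) + 1)) => by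
      have : (m : ℝ) ≤ k := by exact_mod_cast hmk
      have h1 : 1 / ((k : ℝ) + 1) ≤ 1 / ((m : ℝ) + 1) :=
        one_div_le_one_div_of_le (by positivity) (by linarith)
      exact hx.trans_le h1) ⟨0, measure_ne_top _ _⟩
  have h0 : law p₀ (⋂ m : ℕ, {x | p₀ x < 1 / ((m : ℝ) + 1)}) = 0 := by
    have hm : MeasurableSet (⋂ m : ℕ, {x | p₀ x < 1 / ((m : ℝ) + 1)}) :=
      MeasurableSet.iInter fun m => measurableSet_lt hp.measurable measurable_const
    rw [hp.law_apply hm, setIntegral_eq_zero_of_forall_eq_zero, ENNReal.ofReal_zero]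
    intro x hx
    refine le_antisymm ?_ (hp.nonneg x)
    by_contra hx0
    obtain ⟨m, hm⟩ := exists_nat_one_div_lt (not_le.1 hx0)
    exact absurd (Set.mem_iInter.1 hx m) (not_lt.2 hm.le)
  rw [h0] at h
  have h' := (ENNReal.tendsto_toReal ENNReal.zero_ne_top).comp h
  obtain ⟨m, hm⟩ := (h'.eventually (gt_mem_nhds (show (0 : ℝ≥0∞).toReal < s by simpa using hs))).exists
  exact ⟨1 / ((m : ℝ) + 1), by positivity, hm⟩

/-- Lowering the truncation level by a small amount `η` costs at most a multiple of `η`: a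
competitor can be enlarged by a set of mass `η` inside a superlevel set of the density. -/
lemma truncV_le_add (hd : 1 ≤ d) (hp : IsLipDensity L p₀) {s : ℝ} (hs : 0 < s) :
    ∃ K : ℝ, 0 ≤ K ∧ ∀ σ₁ σ₂ : ℝ, s ≤ σ₁ → σ₁ ≤ σ₂ → σ₂ ≤ σ₁ + s / 2 →
      truncV p₀ σ₁ ≤ truncV p₀ σ₂ + ENNReal.ofReal (K * (σ₂ - σ₁)) := by
  obtain ⟨τ, hτ, hm⟩ := exists_level_mass_lt hp (show 0 < s / 4 by positivity)
  refine ⟨τ ^ (gam d - 1), by positivity, fun σ₁ σ₂ h1 h12 h2 => ?_⟩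
  refine tsub_le_iff_right.1 (le_truncV hp fun B hB hBm => tsub_le_iff_right.2 ?_)
  by_cases hB1 : 1 - σ₁ ≤ mass p₀ B
  · exact (truncV_le hp hB hB1).trans le_self_add
  have hlev : MeasurableSet {x | p₀ x < τ} := measurableSet_lt hp.measurable measurable_const
  have hG : MeasurableSet (Bᶜ \ {x | p₀ x < τ}) := hB.compl.diff hlev
  have hGm : σ₂ - σ₁ < mass p₀ (Bᶜ \ {x | p₀ x < τ}) := by
    have e1 : Bᶜ ⊆ (Bᶜ \ {x | p₀ x < τ}) ∪ {x | p₀ x < τ} := fun x hx => by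
      by_cases h : p₀ x < τ
      · exact Or.inr h
      · exact Or.inl ⟨hx, h⟩
    have e2 := (hp.mass_mono e1).trans (hp.mass_union_le _ _)
    rw [hp.mass_compl hB] at e2
    linarith
  -- enlarge `B` by a set `E` of mass `σ₂ - σ₁` on which `p₀ ≥ τ`
  obtain ⟨E, hEG, hE, hEm⟩ := exists_subset_mass_eq hd hp hG (by linarith) hGm
  have hBE : mass p₀ (B ∪ E) = mass p₀ B + mass p₀ E := by
    have := hp.isProbabilityMeasure
    exact measureReal_union (Set.disjoint_right.2 fun x hx => (hEG hx).1) hE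
  refine (truncV_le hp (hB.union hE) (by linarith)).trans ((lintegral_union_le _ _ _).trans ?_)
  rw [← hEm]
  gcongr
  exact lintegral_rpow_le hp hE hτ fun x hx => not_lt.1 (hEG hx).2

lemma continuousOn_realT (hd : 1 ≤ d) (hp : IsLipDensity L p₀) :
    ContinuousOn (realT p₀) (Set.Ioi 0) := by
  refine ContinuousOn.rpow_const ?_ fun _ _ => Or.inr (one_div_pos.2 (gam_pos d)).le
  intro σ hσ
  have hσ' : (0 : ℝ) < σ := hσ
  obtain ⟨K, hK, h⟩ := truncV_le_add hd hp (show 0 < σ / 2 by positivity)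
  have hreal : ∀ σ₁ σ₂ : ℝ, σ / 2 ≤ σ₁ → σ₁ ≤ σ₂ → σ₂ ≤ σ₁ + σ / 2 / 2 →
      |(truncV p₀ σ₁).toReal - (truncV p₀ σ₂).toReal| ≤ K * (σ₂ - σ₁) := by
    intro σ₁ σ₂ h1 h12 h2
    have h1' : 0 < σ₁ := by linarith
    have h2' : 0 < σ₂ := by linarith
    have a := ENNReal.toReal_mono (truncV_ne_top hd hp h1') (truncV_anti hp h12)
    have b := ENNReal.toReal_mono (ENNReal.add_ne_top.2 ⟨truncV_ne_top hd hp h2',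
      ENNReal.ofReal_ne_top⟩) (h σ₁ σ₂ h1 h12 h2)
    rw [ENNReal.toReal_add (truncV_ne_top hd hp h2') ENNReal.ofReal_ne_top,
      ENNReal.toReal_ofReal (mul_nonneg hK (by linarith))] at b
    rw [abs_of_nonneg (by linarith)]
    linarith
  have hh : Filter.Tendsto (fun s : ℝ => K * |s - σ|) (nhds σ) (nhds 0) := by
    have : Continuous fun s : ℝ => K * |s - σ| := by fun_prop
    simpa using this.tendsto σ
  refine ContinuousAt.continuousWithinAt (tendsto_iff_dist_tendsto_zero.2
    (squeeze_zero' (Filter.Eventually.of_forall fun _ => dist_nonneg) ?_ hh))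
  filter_upwards [Icc_mem_nhds (show σ - σ / 4 < σ by linarith) (show σ < σ + σ / 4 by linarith)]
    with s hs
  rw [Real.dist_eq]
  rcases le_total s σ with hsσ | hsσ
  · rw [abs_sub_comm s σ, abs_of_nonneg (sub_nonneg.2 hsσ)]
    exact hreal s σ (by linarith [hs.1]) hsσ (by linarith [hs.1])
  · rw [abs_of_nonneg (sub_nonneg.2 hsσ), abs_sub_comm]
    exact hreal σ s (by linarith) hsσ (by linarith [hs.2])

/-- The constant in the scale invariant lower bound for the truncated functional. -/
def lowerConst (d : ℕ) : ℝ :=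
  (1 / 2) ^ (1 / gam d) * (2 * Real.sqrt d ^ d) ^ (-(1 / 2) : ℝ)

lemma lowerConst_pos (hd : 1 ≤ d) : 0 < lowerConst d := by
  have hd0 : 0 < Real.sqrt d := Real.sqrt_pos.2 (by exact_mod_cast hd)
  unfold lowerConst; positivity

/-- The truncated functional of a Lipschitz density is bounded below by a multiple of `L^(-d/2)`,
since the density is bounded by a multiple of `L^(d/(d+1))`. -/
lemma lowerConst_le (hd : 1 ≤ d) (hp : IsLipDensity L p₀) {σ : ℝ} (h0 : 0 < σ) (h : σ ≤ 1 / 2) :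
    lowerConst d ≤ L ^ ((d : ℝ) / 2) * realT p₀ σ := by
  have hL := hp.lip_pos hd
  have hd0 : 0 < Real.sqrt d := Real.sqrt_pos.2 (by exact_mod_cast hd)
  have hH := supBound_pos hd hL
  have hγ := gam_pos d
  have h1 : ENNReal.ofReal (supBound d L ^ (gam d - 1) * (1 / 2)) ≤ truncV p₀ σ := by
    refine le_truncV hp fun B hB hm => ?_
    have e1 : ∀ x ∈ B, ENNReal.ofReal (supBound d L ^ (gam d - 1)) * ENNReal.ofReal (p₀ x) ≤
        ENNReal.ofReal (p₀ x ^ gam d) := fun x _ => by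
      rw [← ENNReal.ofReal_mul (by positivity)]
      refine ENNReal.ofReal_le_ofReal ?_
      rcases (hp.nonneg x).eq_or_lt with hx | hx
      · rw [← hx, mul_zero]; exact Real.rpow_nonneg le_rfl _
      · calc supBound d L ^ (gam d - 1) * p₀ x ≤ p₀ x ^ (gam d - 1) * p₀ x := by
              have := Real.rpow_le_rpow_of_nonpos hx (hp.le_supBound hd x)
                (show gam d - 1 ≤ 0 by linarith [gam_lt_one d])
              gcongr
          _ = p₀ x ^ gam d := by rw [Real.rpow_sub_one hx.ne', div_mul_cancel₀ _ hx.ne']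
    refine le_trans ?_ (setLIntegral_mono hp.measurable_rpow.ennreal_ofReal e1)
    rw [lintegral_const_mul _ hp.measurable.ennreal_ofReal, ENNReal.ofReal_mul (by positivity)]
    gcongr
    rw [← ofReal_integral_eq_lintegral_ofReal hp.integrable.integrableOn
      (ae_of_all _ hp.nonneg), ← hp.mass_eq hB]
    exact ENNReal.ofReal_le_ofReal (by linarith)
  have h2 := (ENNReal.ofReal_le_iff_le_toReal (truncV_ne_top hd hp h0)).1 h1
  have h3 : (supBound d L ^ (gam d - 1) * (1 / 2)) ^ (1 / gam d) ≤ realT p₀ σ :=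
    Real.rpow_le_rpow (by positivity) h2 (by positivity)
  have h4 : L ^ ((d : ℝ) / 2) * (supBound d L ^ (gam d - 1) * (1 / 2)) ^ (1 / gam d) =
      lowerConst d := by
    have e1 : (gam d - 1) * (1 / gam d) = -((d + 1) / 2) := by
      unfold gam; field_simp; ring
    have e2 : (supBound d L ^ (gam d - 1)) ^ (1 / gam d) =
        (2 * Real.sqrt d ^ d) ^ (-(1 / 2) : ℝ) * L ^ (-((d : ℝ) / 2)) := by
      rw [← Real.rpow_mul hH.le, e1, supBound, ← Real.rpow_mul (by positivity)]
      have e3 : (1 : ℝ) / (d + 1) * -((d + 1) / 2) = -(1 / 2) := by field_simp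
      rw [e3, mul_pow, ← mul_assoc, Real.mul_rpow (by positivity) (by positivity)]
      congr 1
      rw [← Real.rpow_natCast, ← Real.rpow_mul hL.le]
      congr 1
      ring
    rw [Real.mul_rpow (by positivity) (by positivity), e2, lowerConst, Real.rpow_neg hL.le]
    have : 0 < L ^ ((d : ℝ) / 2) := Real.rpow_pos_of_pos hL _
    field_simp
  rw [← h4]
  gcongr

end TruncT

/-! ### The adaptive critical radius -/

section Radius

variable {d : ℕ} {L : ℝ} {p₀ : Pt d → ℝ} {c : ℝ} {n : ℕ}

/-- The right-hand side of the adaptive critical equation, as a real number. -/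
def critRHS (c : ℝ) (n : ℕ) (p₀ : Pt d → ℝ) (L w : ℝ) : ℝ :=
  (L ^ ((d : ℝ) / 2) * Real.log n / n * realT p₀ (c * w)) ^ ((2 : ℝ) / (4 + d))

lemma solvesAdaptiveEq_iff (hd : 1 ≤ d) (hp : IsLipDensity L p₀) (hc : 0 < c) {L' w : ℝ}
    (hL' : 0 ≤ L') : SolvesAdaptiveEq c n p₀ L' w ↔ 0 < w ∧ w = critRHS c n p₀ L' w := by
  refine and_congr_right fun hw => ?_
  have h0 : 0 ≤ L' ^ ((d : ℝ) / 2) * Real.log n / n := by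
    have := Real.log_natCast_nonneg n
    positivity
  have h1 : 0 ≤ critRHS c n p₀ L' w :=
    Real.rpow_nonneg (mul_nonneg h0 (realT_nonneg _ _)) _
  rw [truncT_eq_ofReal hd hp (by positivity), ← ENNReal.ofReal_mul h0,
    ENNReal.ofReal_rpow_of_nonneg (mul_nonneg h0 (realT_nonneg _ _)) (by positivity)]
  exact ENNReal.ofReal_eq_ofReal_iff hw.le h1

lemma critRHS_anti (hd : 1 ≤ d) (hp : IsLipDensity L p₀) (hc : 0 < c) {L' w w' : ℝ}
    (hL' : 0 ≤ L') (hw : 0 < w) (h : w ≤ w') : critRHS c n p₀ L' w' ≤ critRHS c n p₀ L' w := by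
  have h0 : 0 ≤ L' ^ ((d : ℝ) / 2) * Real.log n / n := by
    have := Real.log_natCast_nonneg n
    positivity
  refine Real.rpow_le_rpow (mul_nonneg h0 (realT_nonneg _ _)) ?_ (by positivity)
  exact mul_le_mul_of_nonneg_left (realT_anti hd hp (by positivity) (by gcongr)) h0

theorem existsUnique_solvesAdaptiveEq (hd : 1 ≤ d) (hp : IsLipDensity L p₀) (hc : 0 < c)
    (hn : 2 ≤ n) {L' : ℝ} (hL' : 0 < L') : ∃! w, SolvesAdaptiveEq c n p₀ L' w := by
  have hlog : 0 < Real.log n := Real.log_pos (by exact_mod_cast hn)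
  have hn0 : (0 : ℝ) < n := by exact_mod_cast (by omega : 0 < n)
  have hcoef : 0 < L' ^ ((d : ℝ) / 2) * Real.log n / n := by positivity
  have hpos : 0 < critRHS c n p₀ L' (1 / (2 * c)) := by
    have h1 := lowerConst_le hd hp (σ := 1 / 2) (by norm_num) le_rfl
    have h2 := lowerConst_pos hd
    have hT : 0 < realT p₀ (1 / 2) := by
      have h3 := Real.rpow_pos_of_pos (hp.lip_pos hd) ((d : ℝ) / 2)
      by_contra h
      have : realT p₀ (1 / 2) = 0 := le_antisymm (not_lt.1 h) (realT_nonneg _ _)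
      rw [this, mul_zero] at h1
      linarith
    have e : c * (1 / (2 * c)) = 1 / 2 := by field_simp
    rw [critRHS, e]
    positivity
  -- the right-hand side is antitone and continuous, at least `w₁` at `w₁`, and vanishes at `1 / c`
  set w₁ := min (1 / (2 * c)) (critRHS c n p₀ L' (1 / (2 * c))) with hw₁
  have hw₁0 : 0 < w₁ := lt_min (by positivity) hpos
  have hcont : ContinuousOn (fun w => critRHS c n p₀ L' w - w) (Set.Icc w₁ (1 / c)) := by
    refine ContinuousOn.sub ?_ continuousOn_id
    refine ContinuousOn.rpow_const ?_ fun _ _ => Or.inr (by positivity)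
    refine continuousOn_const.mul ((continuousOn_realT hd hp).comp
      (continuousOn_const.mul continuousOn_id) fun w hw => ?_)
    exact mul_pos hc (lt_of_lt_of_le hw₁0 hw.1)
  have hle : w₁ ≤ 1 / c := (min_le_left _ _).trans (by
    rw [div_le_div_iff₀ (by positivity) hc]; linarith)
  have h1 : 0 ≤ critRHS c n p₀ L' w₁ - w₁ := by
    have := critRHS_anti (n := n) hd hp hc hL'.le hw₁0 (min_le_left (1 / (2 * c)) _)
    have := min_le_right (1 / (2 * c)) (critRHS c n p₀ L' (1 / (2 * c)))
    linarith
  have h2 : critRHS c n p₀ L' (1 / c) - 1 / c ≤ 0 := by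
    rw [critRHS, mul_one_div_cancel hc.ne', realT_eq_zero hp le_rfl, mul_zero,
      Real.zero_rpow (by positivity)]
    have : 0 < 1 / c := by positivity
    linarith
  obtain ⟨w, hw, hw0⟩ := intermediate_value_Icc' hle hcont ⟨h2, h1⟩
  have hwpos : 0 < w := lt_of_lt_of_le hw₁0 hw.1
  refine ⟨w, (solvesAdaptiveEq_iff hd hp hc hL'.le).2 ⟨hwpos, ?_⟩, fun v hv => ?_⟩
  · simp only at hw0; linarith
  · obtain ⟨hv0, hv1⟩ := (solvesAdaptiveEq_iff hd hp hc hL'.le).1 hv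
    simp only at hw0
    rcases le_total v w with h | h
    · have := critRHS_anti (n := n) hd hp hc hL'.le hv0 h
      linarith
    · have := critRHS_anti (n := n) hd hp hc hL'.le hwpos h
      linarith

lemma adaptiveRadius_spec (hd : 1 ≤ d) (hp : IsLipDensity L p₀) (hc : 0 < c)
    (hn : 2 ≤ n) {L' : ℝ} (hL' : 0 < L') :
    0 < adaptiveRadius c n p₀ L' ∧
      adaptiveRadius c n p₀ L' = critRHS c n p₀ L' (adaptiveRadius c n p₀ L') := by
  obtain ⟨w, hw, huniq⟩ := existsUnique_solvesAdaptiveEq (n := n) hd hp hc hn hL'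
  have : {w | SolvesAdaptiveEq c n p₀ L' w} = {w} := by
    ext v
    exact ⟨fun hv => huniq v hv, fun hv => by rw [hv]; exact hw⟩
  rw [adaptiveRadius, this, csInf_singleton]
  exact (solvesAdaptiveEq_iff hd hp hc hL'.le).1 hw

lemma adaptiveRadius_pow (hd : 1 ≤ d) (hp : IsLipDensity L p₀) (hc : 0 < c)
    (hn : 2 ≤ n) {L' : ℝ} (hL' : 0 < L') :
    adaptiveRadius c n p₀ L' ^ ((4 + d : ℝ) / 2) =
      L' ^ ((d : ℝ) / 2) * Real.log n / n * realT p₀ (c * adaptiveRadius c n p₀ L') := by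
  obtain ⟨-, h⟩ := adaptiveRadius_spec (n := n) hd hp hc hn hL'
  have h0 : 0 ≤ L' ^ ((d : ℝ) / 2) * Real.log n / n := by
    have := Real.log_natCast_nonneg n
    positivity
  conv_lhs => rw [h]
  rw [critRHS, ← Real.rpow_mul (mul_nonneg h0 (realT_nonneg _ _))]
  have e : (2 : ℝ) / (4 + d) * ((4 + d) / 2) = 1 := by
    have : (4 + d : ℝ) ≠ 0 := by positivity
    field_simp
  rw [e, Real.rpow_one]

/-- Multiplying the Lipschitz constant by at most `2` multiplies the radius by at most `2`. -/
lemma adaptiveRadius_le_two_mul (hd : 1 ≤ d) (hp : IsLipDensity L p₀) (hc : 0 < c)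
    (hn : 2 ≤ n) {L₁ L₂ : ℝ} (hL₁ : 0 < L₁) (hL₂ : 0 < L₂) (h : L₂ ≤ 2 * L₁) :
    adaptiveRadius c n p₀ L₂ ≤ 2 * adaptiveRadius c n p₀ L₁ := by
  obtain ⟨h1, -⟩ := adaptiveRadius_spec (n := n) hd hp hc hn hL₁
  have e1 := adaptiveRadius_pow (n := n) hd hp hc hn hL₁
  have e2 := adaptiveRadius_pow (n := n) hd hp hc hn hL₂
  set w₁ := adaptiveRadius c n p₀ L₁
  set w₂ := adaptiveRadius c n p₀ L₂
  by_contra! hlt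
  have hT : realT p₀ (c * w₂) ≤ realT p₀ (c * w₁) :=
    realT_anti hd hp (by positivity) (by gcongr; linarith)
  have hlog := Real.log_natCast_nonneg n
  have hT0 := realT_nonneg p₀ (c * w₂)
  have a1 : w₂ ^ ((4 + d : ℝ) / 2) ≤ 2 ^ ((d : ℝ) / 2) * w₁ ^ ((4 + d : ℝ) / 2) := by
    rw [e1, e2]
    calc L₂ ^ ((d : ℝ) / 2) * Real.log n / n * realT p₀ (c * w₂)
        ≤ (2 * L₁) ^ ((d : ℝ) / 2) * Real.log n / n * realT p₀ (c * w₁) := by gcongr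
      _ = _ := by rw [Real.mul_rpow (by norm_num) hL₁.le]; ring
  have a2 : 2 ^ ((d : ℝ) / 2) * w₁ ^ ((4 + d : ℝ) / 2) ≤ (2 * w₁) ^ ((4 + d : ℝ) / 2) := by
    rw [Real.mul_rpow (by norm_num) h1.le]
    have := Real.rpow_le_rpow_of_exponent_le (one_le_two (α := ℝ))
      (show (d : ℝ) / 2 ≤ (4 + d) / 2 by linarith)
    gcongr
  have a3 : (2 * w₁) ^ ((4 + d : ℝ) / 2) < w₂ ^ ((4 + d : ℝ) / 2) :=
    Real.rpow_lt_rpow (by positivity) hlt (by positivity)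
  linarith

end Radius

/-! ### The pruned partition -/

section Pruned

variable {d : ℕ} {L : ℝ} {p₀ : Pt d → ℝ} {ε : ℝ}

/-- The parameter `θ₂` of the binning test. -/
def thetaTwo (p₀ : Pt d → ℝ) (L ε : ℝ) : ℝ := ε / (8 * L * muFun p₀ ε (1 / 4))

lemma thetaTwo_pos (hd : 1 ≤ d) (hp : IsLipDensity L p₀) (hε : 0 < ε) (hε2 : ε ≤ 2) :
    0 < thetaTwo p₀ L ε := by
  have := hp.lip_pos hd
  have := (muFun_spec hp hε hε2).1
  unfold thetaTwo
  positivity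

lemma thetaTwo_mul (hd : 1 ≤ d) (hp : IsLipDensity L p₀) (hε : 0 < ε) (hε2 : ε ≤ 2) (ρ : ℝ) :
    8 * L * (thetaTwo p₀ L ε * ρ ^ gam d) = ε * ρ ^ gam d / muFun p₀ ε (1 / 4) := by
  have := hp.lip_pos hd
  have := (muFun_spec hp hε hε2).1
  unfold thetaTwo
  field_simp

/-- A bin on which the density is nearly constant has small volume: dilated about its centre until
its diameter is `ρ / L`, it still lies in a region where the density is at least `ρ / 2`, and the
normalization `ε = ∫ min (4 p₀) (ε p₀^γ / μ)` bounds the volume of the dilated cube. -/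
lemma two_mul_level_mul_volume_le (hd : 1 ≤ d) (hp : IsLipDensity L p₀) (hε : 0 < ε)
    (hε2 : ε ≤ 2) {Q : Cube d} (hs : 0 < Q.side) (hρ : 0 < p₀ Q.center)
    (hdiam : Q.diam ≤ binDiam d (1 / (2 * L)) (thetaTwo p₀ L ε) (p₀ Q.center)) :
    2 * p₀ Q.center * (2 ^ d * Q.side ^ d) ≤ ε := by
  have hL := hp.lip_pos hd
  obtain ⟨hμ, heq⟩ := muFun_spec hp hε hε2
  have hθ := thetaTwo_mul hd hp hε hε2 (p₀ Q.center)
  set μ := muFun p₀ ε (1 / 4)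
  set ρ := p₀ Q.center with hρdef
  have hdiam0 : 0 < Q.diam := mul_pos (Real.sqrt_pos.2 (by exact_mod_cast hd)) hs
  -- the dilation factor is `2 / s`
  set s := 2 * L * Q.diam / ρ with hsdef
  have hs0 : 0 < s := by positivity
  have hsρ : s * ρ = 2 * L * Q.diam := div_mul_cancel₀ _ hρ.ne'
  have hs1 : s ≤ 1 := by
    rw [hsdef, div_le_one hρ]
    have := mul_le_mul_of_nonneg_left (hdiam.trans (min_le_left _ _))
      (show 0 ≤ 2 * L by positivity)
    refine this.trans_eq ?_
    field_simp
  have hs2 : 4 * (s * ρ) ≤ ε * ρ ^ gam d / μ := by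
    have := mul_le_mul_of_nonneg_left (hdiam.trans (min_le_right _ _))
      (show 0 ≤ 8 * L by positivity)
    rw [hθ] at this
    linarith
  set D := cubeAt Q.center (Q.side / s) with hD
  have hDs : D.side = 2 * Q.side / s := by simp [hD, cubeAt]; ring
  have hDs0 : 0 ≤ D.side := by rw [hDs]; positivity
  have hDd : L * D.diam = ρ := by
    have : D.diam = 2 * Q.diam / s := by rw [Cube.diam, hDs, Cube.diam]; ring
    rw [this, mul_div_assoc', div_eq_iff hs0.ne']
    linarith
  have hlow : ∀ y ∈ D.toSet, 2 * (s * ρ) ≤ truncDensity p₀ ε μ y := by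
    intro y hy
    have h1 := abs_le.1 (hp.abs_sub_center_le hL.le hy hDs0)
    rw [hDd, hD, cubeAt_center, ← hρdef] at h1
    have h2 : ρ / 2 ≤ p₀ y := by linarith [h1.1]
    refine le_min ?_ ?_
    · have : s * ρ ≤ 1 * ρ := by gcongr
      linarith
    · have hγ := gam_pos d
      have h3 : (1 / 2 * ρ) ^ gam d ≤ p₀ y ^ gam d := by
        apply Real.rpow_le_rpow (by positivity) (by linarith) hγ.le
      rw [Real.mul_rpow (by norm_num) hρ.le] at h3
      have h4 : (1 / 2 : ℝ) ≤ (1 / 2) ^ gam d := by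
        simpa using Real.rpow_le_rpow_of_exponent_ge (show (0 : ℝ) < 1 / 2 by norm_num)
          (by norm_num) (gam_lt_one d).le
      have h5 : 1 / 2 * ρ ^ gam d ≤ p₀ y ^ gam d :=
        le_trans (by gcongr) h3
      calc 2 * (s * ρ) ≤ 1 / 2 * (ε * ρ ^ gam d / μ) := by linarith
        _ = ε * (1 / 2 * ρ ^ gam d) / μ := by ring
        _ ≤ ε * p₀ y ^ gam d / μ := by gcongr
  have hI := integrable_truncDensity hp hε.le hμ.le
  have h1 : 2 * (s * ρ) * volume.real D.toSet ≤ ε := by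
    conv_rhs => rw [heq]
    calc 2 * (s * ρ) * volume.real D.toSet = ∫ _y in D.toSet, 2 * (s * ρ) := by
          rw [setIntegral_const, smul_eq_mul, mul_comm]
      _ ≤ ∫ y in D.toSet, truncDensity p₀ ε μ y :=
          setIntegral_mono_on (integrableOn_const (D.volume_toSet_ne_top hDs0))
            hI.integrableOn D.measurableSet_toSet hlow
      _ ≤ ∫ y, truncDensity p₀ ε μ y :=
          setIntegral_le_integral hI (ae_of_all _ fun y => truncDensity_nonneg hp hε.le hμ.le y)
  rw [D.volume_real_toSet hDs0, hDs, div_pow, mul_pow] at h1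
  refine le_trans ?_ h1
  have h2 : s ^ d ≤ s := by
    simpa using pow_le_pow_of_le_one hs0.le hs1 hd
  calc 2 * ρ * (2 ^ d * Q.side ^ d) = 2 * ρ * (2 ^ d * Q.side ^ d) * 1 := by ring
    _ ≤ 2 * ρ * (2 ^ d * Q.side ^ d) * (s / s ^ d) := by
        gcongr
        rwa [one_le_div (by positivity)]
    _ = _ := by ring

lemma Cube.shrink_subset (Q : Cube d) {t : ℝ} (hs : 0 ≤ Q.side) (ht : t ≤ 1) :
    (Q.shrink t).toSet ⊆ Q.toSet := by
  intro x hx i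
  have h := hx i
  simp only [Cube.shrink] at h
  have : t * Q.side ≤ 1 * Q.side := by gcongr
  exact ⟨h.1, by linarith [h.2]⟩

/-- Shrinking the last retained cube releases a mass of at most `ε / 16`. The volume bound for bins
makes the estimate uniform in the dimension. -/
lemma mass_diff_shrink_le (hd : 1 ≤ d) (hp : IsLipDensity L p₀) (hε : 0 < ε)
    (hε2 : ε ≤ 2) {Q : Cube d} (hs : 0 < Q.side) (hρ : 0 < p₀ Q.center)
    (hLd : L * Q.diam ≤ p₀ Q.center / 2)
    (hdiam : Q.diam ≤ binDiam d (1 / (2 * L)) (thetaTwo p₀ L ε) (p₀ Q.center)) {t : ℝ}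
    (ht : 4 / 5 ≤ t) (ht1 : t ≤ 1) : mass p₀ (Q.toSet \ (Q.shrink t).toSet) ≤ ε / 16 := by
  have hL := hp.lip_pos hd
  have hvol := two_mul_level_mul_volume_le hd hp hε hε2 hs hρ hdiam
  set ρ := p₀ Q.center
  have hss : 0 ≤ (Q.shrink t).side := by
    have h : 0 ≤ t := by linarith
    exact mul_nonneg h hs.le
  have h1 : mass p₀ (Q.toSet \ (Q.shrink t).toSet) ≤
      5 / 4 * ρ * (Q.side ^ d - (Q.shrink t).side ^ d) := by
    rw [← Q.volume_real_toSet hs.le, ← (Q.shrink t).volume_real_toSet hss,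
      ← measureReal_sdiff (Q.shrink_subset hs.le ht1) (Cube.measurableSet_toSet _)
        (Q.volume_toSet_ne_top hs.le)]
    refine hp.mass_le_mul_volume (Q.measurableSet_toSet.diff (Cube.measurableSet_toSet _))
      (measure_ne_top_of_subset Set.sdiff_subset (Q.volume_toSet_ne_top hs.le)) fun x hx => ?_
    have := abs_le.1 (hp.abs_sub_center_le hL.le hx.1 hs.le)
    linarith [this.2]
  -- Bernoulli's inequality
  have h2 : 1 - (d : ℝ) / 5 ≤ t ^ d := by
    have := one_add_mul_le_pow (a := (-(1 / 5) : ℝ)) (by norm_num) d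
    calc 1 - (d : ℝ) / 5 = 1 + d * (-(1 / 5)) := by ring
      _ ≤ (1 + -(1 / 5)) ^ d := this
      _ ≤ t ^ d := by
        apply pow_le_pow_left₀ (by norm_num)
        linarith
  have h3 : (Q.shrink t).side ^ d = t ^ d * Q.side ^ d := by simp [Cube.shrink, mul_pow]
  have h4 : (d : ℝ) ≤ 2 ^ d / 2 := by
    have : d ≤ 2 ^ (d - 1) := by
      have := Nat.lt_two_pow_self (n := d - 1); omega
    have h : (d : ℝ) ≤ 2 ^ (d - 1) := by exact_mod_cast this
    have e : (2 : ℝ) ^ d = 2 ^ (d - 1) * 2 := by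
      rw [← pow_succ]; congr 1; omega
    linarith
  have h5 : 0 < Q.side ^ d := pow_pos hs d
  calc mass p₀ (Q.toSet \ (Q.shrink t).toSet)
      ≤ 5 / 4 * ρ * (Q.side ^ d - (Q.shrink t).side ^ d) := h1
    _ = 5 / 4 * ρ * ((1 - t ^ d) * Q.side ^ d) := by rw [h3]; ring
    _ ≤ 5 / 4 * ρ * ((2 ^ d / 2 / 5) * Q.side ^ d) := by gcongr; linarith
    _ = (2 * ρ * (2 ^ d * Q.side ^ d)) / 16 := by ring
    _ ≤ ε / 16 := by gcongr

/-- The list consists of disjoint cubes which carry all but a small part of the mass and on which the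
density level determines the diameter up to a constant. -/
structure PartitionSpec (p₀ : Pt d → ℝ) (L ε : ℝ) (l : List (Cube d)) : Prop where
  side_pos : ∀ Q ∈ l, 0 < Q.side
  level_pos : ∀ Q ∈ l, 0 < p₀ Q.center
  lip_diam : ∀ Q ∈ l, L * Q.diam ≤ p₀ Q.center / 2
  diam_le : ∀ Q ∈ l, Q.diam ≤ binDiam d (1 / (2 * L)) (thetaTwo p₀ L ε) (p₀ Q.center)
  le_diam : ∀ Q ∈ l, 3 / 8 * binDiam d (1 / (2 * L)) (thetaTwo p₀ L ε) (p₀ Q.center) ≤ Q.diam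
  disjoint : l.Pairwise fun Q R => Disjoint Q.toSet R.toSet
  mass_compl : mass p₀ (⋃ Q ∈ l, Q.toSet)ᶜ ≤ ε / 512

lemma sortByMass_perm {β : Type} (f : β → Set (Pt d)) (l : List β) :
    (sortByMass p₀ f l).Perm l := List.mergeSort_perm _ _

lemma measurableSet_biUnion_list (l : List (Cube d)) : MeasurableSet (⋃ Q ∈ l, Q.toSet) := by
  have : (⋃ Q ∈ l, Q.toSet) = ⋃ Q ∈ {Q | Q ∈ l}, Q.toSet := rfl
  rw [this]
  exact MeasurableSet.biUnion (List.finite_toSet l).countable fun Q _ => Q.measurableSet_toSet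

lemma partitionSpec_partitionList (hd : 1 ≤ d) (hp : IsLipDensity L p₀) (hε : 0 < ε)
    (hε2 : ε ≤ 2) : PartitionSpec p₀ L ε
      (partitionList p₀ (1 / (2 * L)) (thetaTwo p₀ L ε) (ε / 1024) (ε / 1024)) := by
  classical
  have hL := hp.lip_pos hd
  have hθ₂ := thetaTwo_pos hd hp hε hε2
  obtain ⟨hS, hSm⟩ := effSupport_spec hd hp (a := ε / 1024) (by positivity) (by linarith)
  have hroot := effSupport_not_smallEnough (θ₂ := thetaTwo p₀ L ε) hd hp (a := ε / 1024)
    (by positivity) (by linarith)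
  set S := effSupport p₀ (ε / 1024) with hSdef
  have hvol : 0 < S.vol := pow_pos hS d
  have hgood := goodPartition (t := ε / 1024 / S.vol) (θ₁ := 1 / (2 * L)) hp hL (by positivity)
    (by positivity) hθ₂ hS.le
  set K := keptCubes p₀ (ε / 1024 / S.vol) (1 / (2 * L)) (thetaTwo p₀ L ε) S with hK
  have hKeq : partitionCubes p₀ (1 / (2 * L)) (thetaTwo p₀ L ε) (ε / 1024) (ε / 1024) = K := rfl
  have hfin : (partitionCubes p₀ (1 / (2 * L)) (thetaTwo p₀ L ε) (ε / 1024) (ε / 1024)).Finite :=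
    hgood.finite
  rw [partitionList, dif_pos hfin]
  set l := sortByMass p₀ Cube.toSet hfin.toFinset.toList with hl
  have hperm : l.Perm hfin.toFinset.toList := sortByMass_perm _ _
  have hmem : ∀ Q, Q ∈ l ↔ Q ∈ K := fun Q => by
    rw [hperm.mem_iff, Finset.mem_toList, Set.Finite.mem_toFinset, hKeq]
  have hkept := fun Q (hQ : Q ∈ l) => keptCube_diam hd hp hθ₂ hS hroot ((hmem Q).1 hQ)
  refine ⟨fun Q hQ => (hkept Q hQ).1, fun Q hQ => (hkept Q hQ).2.1, fun Q hQ => (hkept Q hQ).2.2.1,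
    fun Q hQ => (hkept Q hQ).2.2.2.1, fun Q hQ => (hkept Q hQ).2.2.2.2, ?_, ?_⟩
  · rw [hperm.pairwise_iff fun h => h.symm]
    refine (Finset.nodup_toList _).pairwise_of_forall_ne fun Q hQ R hR hne => ?_
    rw [Finset.mem_toList, Set.Finite.mem_toFinset] at hQ hR
    exact hgood.disjoint hQ hR hne
  · have hlow : MeasurableSet (S.toSet ∩ {x | p₀ x ≤ ε / 1024 / S.vol}) :=
      S.measurableSet_toSet.inter (measurableSet_le hp.measurable measurable_const)
    have hsub : (⋃ Q ∈ l, Q.toSet)ᶜ ⊆ S.toSetᶜ ∪ (S.toSet ∩ {x | p₀ x ≤ ε / 1024 / S.vol}) := by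
      intro x hx
      by_cases hxS : x ∈ S.toSet
      · refine Or.inr ⟨hxS, ?_⟩
        refine (hgood.cover x hxS).resolve_right ?_
        rintro ⟨R, hR, hxR⟩
        exact hx (Set.mem_iUnion₂.2 ⟨R, (hmem R).2 hR, hxR⟩)
      · exact Or.inl hxS
    have h1 := (hp.mass_mono hsub).trans (hp.mass_union_le _ _)
    rw [hp.mass_compl S.measurableSet_toSet] at h1
    have h2 : mass p₀ (S.toSet ∩ {x | p₀ x ≤ ε / 1024 / S.vol}) ≤ ε / 1024 := by
      have hSv := S.volume_toSet_ne_top hS.le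
      refine (hp.mass_le_mul_volume hlow (measure_ne_top_of_subset Set.inter_subset_left hSv)
        fun x hx => hx.2).trans ?_
      calc ε / 1024 / S.vol * volume.real (S.toSet ∩ {x | p₀ x ≤ ε / 1024 / S.vol})
          ≤ ε / 1024 / S.vol * volume.real S.toSet := by
            gcongr
            exact Set.inter_subset_left
        _ = ε / 1024 := by
            rw [S.volume_real_toSet hS.le]
            exact div_mul_cancel₀ _ hvol.ne'
    linarith

lemma mass_biUnion_list_le (hp : IsLipDensity L p₀) (l : List (Cube d)) :
    mass p₀ (⋃ Q ∈ l, Q.toSet) ≤ (l.map fun Q => mass p₀ Q.toSet).sum := by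
  induction l with
  | nil => simp [mass]
  | cons Q l ih =>
    have : (⋃ R ∈ Q :: l, R.toSet) = Q.toSet ∪ ⋃ R ∈ l, R.toSet := by
      ext x; simp
    rw [this, List.map_cons, List.sum_cons]
    exact (hp.mass_union_le _ _).trans (by linarith)

lemma tailMass_pruneCount_le {c : ℝ} (hc : 0 ≤ c) (l : List (Cube d)) :
    tailMass p₀ l (pruneCount p₀ c l) ≤ c :=
  Nat.sInf_mem (s := {j | tailMass p₀ l j ≤ c}) ⟨l.length, by
    rw [Set.mem_ofPred_eq, tailMass, List.drop_length]
    simpa using hc⟩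

lemma PartitionSpec.binAtLevel (hd : 1 ≤ d) (hp : IsLipDensity L p₀) (hε : 0 < ε) (hε2 : ε ≤ 2)
    {l : List (Cube d)} (h : PartitionSpec p₀ L ε l) {Q : Cube d} (hQ : Q ∈ l) {t : ℝ}
    (ht : 4 / 5 ≤ t) (ht1 : t ≤ 1) :
    BinAtLevel p₀ (1 / (2 * L)) (thetaTwo p₀ L ε) (Q.shrink t) (p₀ Q.center) := by
  have hL := hp.lip_pos hd
  have hθ := thetaTwo_pos hd hp hε hε2
  have hs := h.side_pos Q hQ
  have hρ := h.level_pos Q hQ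
  have hdiam : (Q.shrink t).diam = t * Q.diam := by simp [Cube.diam, Cube.shrink]; ring
  have hdist : ∀ x ∈ (Q.shrink t).toSet, |p₀ x - p₀ Q.center| ≤ 1 / 4 * p₀ Q.center := by
    intro x hx
    have h1 := hp.abs_sub_center_le hL.le (Q.shrink_subset hs.le ht1 hx) hs.le
    have h2 := h.lip_diam Q hQ
    linarith
  have hb : 0 ≤ binDiam d (1 / (2 * L)) (thetaTwo p₀ L ε) (p₀ Q.center) :=
    le_min (by positivity) (by positivity)
  have hD : 0 ≤ Q.diam := mul_nonneg (Real.sqrt_nonneg _) hs.le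
  refine ⟨hρ, mul_pos (by linarith) hs, fun x hx => ?_, fun x hx => ?_, ?_, ?_⟩
  · linarith [(abs_le.1 (hdist x hx)).1]
  · linarith [(abs_le.1 (hdist x hx)).2]
  · rw [hdiam]
    have := h.diam_le Q hQ
    nlinarith
  · rw [hdiam]
    have := h.le_diam Q hQ
    nlinarith

lemma Cube.shrink_one (Q : Cube d) : Q.shrink 1 = Q := by simp [Cube.shrink]

/-- The pruned cubes are disjoint bins, and they miss only a small part of the null mass. -/
theorem prunedCubes_spec (hd : 1 ≤ d) (hp : IsLipDensity L p₀) (hε : 0 < ε) (hε2 : ε ≤ 2) :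
    (∀ Q ∈ prunedCubes p₀ L ε, ∃ ρ, BinAtLevel p₀ (1 / (2 * L)) (thetaTwo p₀ L ε) Q ρ) ∧
      (prunedCubes p₀ L ε).Pairwise (fun Q R => Disjoint Q.toSet R.toSet) ∧
      mass p₀ (⋃ Q ∈ prunedCubes p₀ L ε, Q.toSet)ᶜ ≤ ε / 15 := by
  have hspec := partitionSpec_partitionList hd hp hε hε2
  have hdef : prunedCubes p₀ L ε = prune p₀ (ε / 512)
    (partitionList p₀ (1 / (2 * L)) (thetaTwo p₀ L ε) (ε / 1024) (ε / 1024)) := rfl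
  rw [hdef]
  set l := partitionList p₀ (1 / (2 * L)) (thetaTwo p₀ L ε) (ε / 1024) (ε / 1024)
  set N := pruneCount p₀ (ε / 512) l with hN
  have htail : tailMass p₀ l N ≤ ε / 512 := tailMass_pruneCount_le (by positivity) l
  have hkept : ∀ Q ∈ l.take N, Q ∈ l := fun Q hQ => List.mem_of_mem_take hQ
  have hdisj : (l.take N).Pairwise fun Q R => Disjoint Q.toSet R.toSet :=
    hspec.disjoint.sublist (List.take_sublist _ _)
  have hmass : mass p₀ (⋃ Q ∈ l.take N, Q.toSet)ᶜ ≤ ε / 256 := by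
    have hsub : (⋃ Q ∈ l.take N, Q.toSet)ᶜ ⊆
        (⋃ Q ∈ l, Q.toSet)ᶜ ∪ ⋃ Q ∈ l.drop N, Q.toSet := by
      intro x hx
      by_cases hxl : x ∈ ⋃ Q ∈ l, Q.toSet
      · obtain ⟨Q, hQ, hxQ⟩ := Set.mem_iUnion₂.1 hxl
        rw [← List.take_append_drop N l] at hQ
        rcases List.mem_append.1 hQ with h | h
        · exact absurd (Set.mem_iUnion₂.2 ⟨Q, h, hxQ⟩) hx
        · exact Or.inr (Set.mem_iUnion₂.2 ⟨Q, h, hxQ⟩)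
      · exact Or.inl hxl
    have h1 := (hp.mass_mono hsub).trans (hp.mass_union_le _ _)
    have h2 := hspec.mass_compl
    have h3 := (mass_biUnion_list_le hp (l.drop N)).trans htail
    linarith
  have hbin : ∀ Q ∈ l, ∀ t : ℝ, 4 / 5 ≤ t → t ≤ 1 →
      ∃ ρ, BinAtLevel p₀ (1 / (2 * L)) (thetaTwo p₀ L ε) (Q.shrink t) ρ := fun Q hQ t ht ht1 =>
    ⟨_, hspec.binAtLevel hd hp hε hε2 hQ ht ht1⟩
  have hbin1 : ∀ Q ∈ l, ∃ ρ, BinAtLevel p₀ (1 / (2 * L)) (thetaTwo p₀ L ε) Q ρ := fun Q hQ => by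
    simpa [Cube.shrink_one] using hbin Q hQ 1 (by norm_num) le_rfl
  unfold prune
  simp only [← hN]
  split_ifs with hcase
  · exact ⟨fun Q hQ => hbin1 Q (hkept Q hQ), hdisj, by linarith⟩
  rcases List.eq_nil_or_concat (l.take N) with hnil | ⟨init, Q, hcat⟩
  · rw [hnil] at hmass hdisj ⊢
    simp only [List.dropLast_nil, List.getLast?_nil, Option.map_none, Option.toList_none,
      List.append_nil]
    exact ⟨by simp, List.Pairwise.nil, by linarith⟩
  · rw [List.concat_eq_append] at hcat
    rw [hcat] at hmass hdisj hkept ⊢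
    rw [List.dropLast_concat, List.getLast?_concat]
    simp only [Option.map_some, Option.toList_some]
    set t := 1 - min (ε / 512 / (5 * mass p₀ Q.toSet)) (1 / 5) with ht
    have ht1 : t ≤ 1 := by
      have : 0 ≤ min (ε / 512 / (5 * mass p₀ Q.toSet)) (1 / 5) :=
        le_min (div_nonneg (by positivity) (mul_nonneg (by norm_num) (mass_nonneg _)))
          (by norm_num)
      linarith
    have ht0 : 4 / 5 ≤ t := by
      have := min_le_right (ε / 512 / (5 * mass p₀ Q.toSet)) (1 / 5)
      linarith
    have hQl : Q ∈ l := hkept Q (by simp)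
    have hs := hspec.side_pos Q hQl
    refine ⟨fun R hR => ?_, ?_, ?_⟩
    · rcases List.mem_append.1 hR with h | h
      · exact hbin1 R (hkept R (List.mem_append_left _ h))
      · rw [List.mem_singleton.1 h]
        exact hbin Q hQl t ht0 ht1
    · rw [List.pairwise_append] at hdisj ⊢
      refine ⟨hdisj.1, List.pairwise_singleton _ _, fun R hR R' hR' => ?_⟩
      rw [List.mem_singleton.1 hR']
      exact (hdisj.2.2 R hR Q (by simp)).mono_right (Q.shrink_subset hs.le ht1)
    · have hsub : (⋃ R ∈ init ++ [Q.shrink t], R.toSet)ᶜ ⊆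
          (⋃ R ∈ init ++ [Q], R.toSet)ᶜ ∪ (Q.toSet \ (Q.shrink t).toSet) := by
        intro x hx
        by_cases hxl : x ∈ ⋃ R ∈ init ++ [Q], R.toSet
        · obtain ⟨R, hR, hxR⟩ := Set.mem_iUnion₂.1 hxl
          rcases List.mem_append.1 hR with h | h
          · exact absurd (Set.mem_iUnion₂.2 ⟨R, List.mem_append_left _ h, hxR⟩) hx
          · rw [List.mem_singleton.1 h] at hxR
            exact Or.inr ⟨hxR, fun h' => hx (Set.mem_iUnion₂.2 ⟨Q.shrink t, by simp, h'⟩)⟩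
        · exact Or.inl hxl
      have h1 := (hp.mass_mono hsub).trans (hp.mass_union_le _ _)
      have h2 := mass_diff_shrink_le hd hp hε hε2 hs (hspec.level_pos Q hQl)
        (hspec.lip_diam Q hQl) (hspec.diam_le Q hQl) ht0 ht1
      linarith

end Pruned

/-! ### The bins -/

section Bins

variable {d : ℕ} {L : ℝ} {p₀ : Pt d → ℝ} {ε : ℝ}

/-- The properties of the bins on which the analysis of the binning test rests: they form a
measurable partition sorted by null mass, and all of them except the residual bin `i₀` come from
the adaptive partition. -/
structure GoodBins (p₀ : Pt d → ℝ) (L ε : ℝ) {k : ℕ} (A : Fin k → Set (Pt d)) (i₀ : Fin k) :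
    Prop where
  meas : ∀ i, MeasurableSet (A i)
  disj : Pairwise fun i j => Disjoint (A i) (A j)
  cover : ⋃ i, A i = Set.univ
  anti : Antitone fun i => mass p₀ (A i)
  level : ∀ i, i ≠ i₀ → ∃ Q ρ, A i = Cube.toSet Q ∧
    BinAtLevel p₀ (1 / (2 * L)) (thetaTwo p₀ L ε) Q ρ
  residual : mass p₀ (A i₀) ≤ ε / 15

lemma exists_index_of_perm {α : Type} {B l : List α} {a : α} (h : B.Perm (l ++ [a])) :
    ∃ i₀ : Fin B.length, B.get i₀ = a ∧ ∀ i, i ≠ i₀ → B.get i ∈ l := by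
  obtain ⟨i₀, hi₀⟩ := List.get_of_mem (h.mem_iff.2 (by simp : a ∈ l ++ [a]))
  refine ⟨i₀, hi₀, fun i hi => ?_⟩
  have h1 : (a :: B.eraseIdx i₀).Perm (a :: l) := by
    have h2 := List.getElem_cons_eraseIdx_perm i₀.2
    have h3 : B[(i₀ : ℕ)] = a := hi₀
    rw [h3] at h2
    exact (h2.trans h).trans List.perm_append_comm
  refine (h1.cons_inv).mem_iff.1 (List.mem_eraseIdx_iff_getElem.2 ⟨i, i.2, ?_, rfl⟩)
  exact fun h => hi (Fin.ext h)

/-- The bins of the binning test have the properties on which its analysis rests. -/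
theorem goodBins_bins (hd : 1 ≤ d) (hp : IsLipDensity L p₀) (hε : 0 < ε) (hε2 : ε ≤ 2) :
    ∃ i₀, GoodBins p₀ L ε (fun i => (bins p₀ L ε).get i) i₀ := by
  obtain ⟨hlev, hdis, hres⟩ := prunedCubes_spec hd hp hε hε2
  set l := prunedCubes p₀ L ε with hl
  set R : Set (Pt d) := (⋃ Q ∈ l, Q.toSet)ᶜ with hR
  have hperm : (bins p₀ L ε).Perm (l.map Cube.toSet ++ [R]) := sortByMass_perm _ _
  obtain ⟨i₀, hi₀, hi⟩ := exists_index_of_perm hperm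
  have hpair : (bins p₀ L ε).Pairwise Disjoint := by
    rw [hperm.pairwise_iff fun h => h.symm, List.pairwise_append]
    refine ⟨List.pairwise_map.2 hdis, List.pairwise_singleton _ _, fun A hA B hB => ?_⟩
    obtain ⟨Q, hQ, rfl⟩ := List.mem_map.1 hA
    rw [List.mem_singleton.1 hB]
    exact Set.disjoint_compl_right_iff_subset.2 (Set.subset_biUnion_of_mem (u := fun Q : Cube d =>
      Q.toSet) hQ)
  have hmeas : ∀ A ∈ bins p₀ L ε, MeasurableSet A := by
    intro A hA
    rcases List.mem_append.1 (hperm.mem_iff.1 hA) with h | h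
    · obtain ⟨Q, -, rfl⟩ := List.mem_map.1 h
      exact Q.measurableSet_toSet
    · rw [List.mem_singleton.1 h]
      exact (measurableSet_biUnion_list l).compl
  refine ⟨i₀, fun i => hmeas _ (List.get_mem _ _), fun i j hij => ?_, ?_, fun i j hij => ?_,
    fun i hne => ?_, ?_⟩
  · rw [List.pairwise_iff_get] at hpair
    rcases lt_or_gt_of_ne hij with h | h
    · exact hpair i j h
    · exact (hpair j i h).symm
  · refine Set.eq_univ_of_forall fun x => Set.mem_iUnion.2 ?_
    have : ∃ A ∈ bins p₀ L ε, x ∈ A := by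
      by_cases hx : x ∈ ⋃ Q ∈ l, Q.toSet
      · obtain ⟨Q, hQ, hxQ⟩ := Set.mem_iUnion₂.1 hx
        exact ⟨Q.toSet, hperm.mem_iff.2 (List.mem_append_left _ (List.mem_map_of_mem hQ)), hxQ⟩
      · exact ⟨R, hperm.mem_iff.2 (by simp), hx⟩
    obtain ⟨A, hA, hxA⟩ := this
    obtain ⟨i, rfl⟩ := List.get_of_mem hA
    exact ⟨i, hxA⟩
  · have hsort := List.pairwise_mergeSort (le := fun A B : Set (Pt d) =>
      decide (mass p₀ (id B) ≤ mass p₀ (id A))) (fun A B C h1 h2 => by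
        simp only [decide_eq_true_eq] at h1 h2 ⊢
        exact h2.trans h1) (fun A B => by
        simp only [Bool.or_eq_true, decide_eq_true_eq]
        exact le_total _ _) (l.map Cube.toSet ++ [R])
    rw [List.pairwise_iff_get] at hsort
    rcases hij.eq_or_lt with rfl | h
    · exact le_rfl
    · exact of_decide_eq_true (hsort i j h)
  · obtain ⟨Q, hQ, hQi⟩ := List.mem_map.1 (hi i hne)
    obtain ⟨ρ, hρ⟩ := hlev Q hQ
    exact ⟨Q, ρ, hQi.symm, hρ⟩
  · simp only [hi₀]
    exact hres

end Bins

/-! ### Separation of the binned distributions -/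

lemma mul_le_rpow_gam {d : ℕ} {x M : ℝ} (hx : 0 ≤ x) (h : x ≤ M) :
    M ^ (gam d - 1) * x ≤ x ^ gam d := by
  rcases hx.eq_or_lt with rfl | hx
  · rw [mul_zero]; exact Real.rpow_nonneg le_rfl _
  · calc M ^ (gam d - 1) * x ≤ x ^ (gam d - 1) * x := by
          have := Real.rpow_le_rpow_of_nonpos hx h (show gam d - 1 ≤ 0 by linarith [gam_lt_one d])
          gcongr
      _ = x ^ gam d := by rw [Real.rpow_sub_one hx.ne', div_mul_cancel₀ _ hx.ne']

lemma rpow_gam_le_mul {d : ℕ} {x τ : ℝ} (hτ : 0 < τ) (h : τ ≤ x) :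
    x ^ gam d ≤ τ ^ (gam d - 1) * x := by
  have hx : 0 < x := hτ.trans_le h
  calc x ^ gam d = x ^ (gam d - 1) * x := by
        rw [Real.rpow_sub_one hx.ne', div_mul_cancel₀ _ hx.ne']
    _ ≤ τ ^ (gam d - 1) * x := by
        have := Real.rpow_le_rpow_of_nonpos hτ h (show gam d - 1 ≤ 0 by linarith [gam_lt_one d])
        gcongr

lemma inv_mul_rpow_le {d : ℕ} {u ρ : ℝ} (hu : 1 ≤ u) (hρ : 0 < ρ) :
    u⁻¹ * ρ ^ (gam d - 1) ≤ (u * ρ) ^ (gam d - 1) := by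
  rw [Real.mul_rpow (by linarith) hρ.le]
  have h : u⁻¹ ≤ u ^ (gam d - 1) := by
    rw [← Real.rpow_neg_one]
    exact Real.rpow_le_rpow_of_exponent_le hu (by linarith [gam_pos d])
  gcongr

lemma l1Dist_le_two {d : ℕ} {L L' : ℝ} {p p₀ : Pt d → ℝ} (hp : IsLipDensity L p)
    (hp₀ : IsLipDensity L' p₀) : l1Dist p p₀ ≤ 2 := by
  have h : l1Dist p p₀ ≤ ∫ x, (p x + p₀ x) := by
    refine integral_mono (hp.integrable.sub hp₀.integrable).abs
      (hp.integrable.add hp₀.integrable) fun x => ?_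
    have := hp.nonneg x
    have := hp₀.nonneg x
    exact abs_le.2 ⟨by linarith, by linarith⟩
  rw [integral_add hp.integrable hp₀.integrable, hp.integral_eq_one, hp₀.integral_eq_one] at h
  linarith

section Bins

variable {d : ℕ} {L : ℝ} {p₀ p : Pt d → ℝ} {ε : ℝ} {k : ℕ} {A : Fin k → Set (Pt d)} {i₀ : Fin k}

lemma GoodBins.integral_eq_sum (h : GoodBins p₀ L ε A i₀) {f : Pt d → ℝ} (hf : Integrable f) :
    ∫ x, f x = ∑ i, ∫ x in A i, f x := by
  rw [← integral_iUnion_fintype h.meas h.disj fun i => hf.integrableOn, h.cover,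
    Measure.restrict_univ]

lemma GoodBins.sum_mass (h : GoodBins p₀ L ε A i₀) (hp : IsLipDensity L p) :
    ∑ i, mass p (A i) = 1 := by
  rw [← hp.integral_eq_one, h.integral_eq_sum hp.integrable]
  exact Finset.sum_congr rfl fun i _ => hp.mass_eq (h.meas i)

/-- Binning loses little of the `L¹` distance inside a bin, because the difference of two
`L`-Lipschitz densities oscillates by at most `2 L` times the diameter there. -/
lemma setIntegral_abs_sub_le (hd : 1 ≤ d) (hp : IsLipDensity L p) (hp₀ : IsLipDensity L p₀)
    (hε : 0 < ε) (hε2 : ε ≤ 2) {Q : Cube d} {ρ : ℝ}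
    (hQ : BinAtLevel p₀ (1 / (2 * L)) (thetaTwo p₀ L ε) Q ρ) :
    ∫ x in Q.toSet, |p x - p₀ x| ≤ |mass p Q.toSet - mass p₀ Q.toSet| +
      1 / 3 * ∫ x in Q.toSet, truncDensity p₀ ε (muFun p₀ ε (1 / 4)) x := by
  have hL := hp₀.lip_pos hd
  obtain ⟨hμ, -⟩ := muFun_spec hp₀ hε hε2
  have hθ := thetaTwo_mul hd hp₀ hε hε2 ρ
  set μ := muFun p₀ ε (1 / 4)
  have hs := hQ.side_pos.le
  have hvol := Q.volume_toSet_ne_top hs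
  have hQm := Q.measurableSet_toSet
  set f : Pt d → ℝ := fun x => p x - p₀ x with hf
  have hfi : Integrable f := hp.integrable.sub hp₀.integrable
  set fc := f Q.center
  have hosc : ∀ x ∈ Q.toSet, |f x - fc| ≤ L * Q.diam := fun x hx => by
    have h1 := abs_le.1 (hp.abs_sub_center_le hL.le hx hs)
    have h2 := abs_le.1 (hp₀.abs_sub_center_le hL.le hx hs)
    simp only [hf, fc]
    exact abs_le.2 ⟨by linarith [h1.1, h2.2], by linarith [h1.2, h2.1]⟩
  have hconst : ∀ u : ℝ, ∫ _x in Q.toSet, u = u * volume.real Q.toSet := fun u => by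
    rw [setIntegral_const, smul_eq_mul, mul_comm]
  set v := volume.real Q.toSet with hv
  have hv0 : 0 ≤ v := measureReal_nonneg
  have h1 : ∫ x in Q.toSet, |f x| ≤ (|fc| + L * Q.diam) * v := by
    rw [← hconst]
    refine setIntegral_mono_on hfi.abs.integrableOn (integrableOn_const hvol) hQm fun x hx => ?_
    have := hosc x hx
    have h3 := abs_add_le (f x - fc) fc
    rw [sub_add_cancel] at h3
    linarith
  have h2 : |∫ x in Q.toSet, f x| ≥ |fc| * v - L * Q.diam * v := by
    have e1 : ∫ x in Q.toSet, (f x - fc) = (∫ x in Q.toSet, f x) - fc * v := by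
      rw [integral_sub hfi.integrableOn (integrableOn_const hvol), hconst]
    have e2 : |∫ x in Q.toSet, (f x - fc)| ≤ L * Q.diam * v := by
      rw [← hconst]
      refine abs_integral_le_integral_abs.trans (setIntegral_mono_on
        (hfi.integrableOn.sub (integrableOn_const hvol)).abs (integrableOn_const hvol) hQm hosc)
    rw [e1] at e2
    have e3 : |fc| * v = |fc * v| := by rw [abs_mul, abs_of_nonneg hv0]
    have e4 := abs_sub_abs_le_abs_sub (fc * v) (∫ x in Q.toSet, f x)
    rw [abs_sub_comm] at e4
    linarith
  have h3 : mass p Q.toSet - mass p₀ Q.toSet = ∫ x in Q.toSet, f x := by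
    rw [hp.mass_eq hQm, hp₀.mass_eq hQm,
      ← integral_sub hp.integrable.integrableOn hp₀.integrable.integrableOn]
  have h4 : 2 * L * Q.diam * v ≤
      1 / 3 * ∫ x in Q.toSet, truncDensity p₀ ε μ x := by
    rw [← hconst, ← integral_const_mul]
    refine setIntegral_mono_on (integrableOn_const hvol)
      ((integrable_truncDensity hp₀ hε.le hμ.le).const_mul _).integrableOn hQm fun x hx => ?_
    have hx1 := hQ.lower x hx
    have hρ := hQ.pos
    have k1 : 2 * L * Q.diam ≤ ρ := by
      have := mul_le_mul_of_nonneg_left (hQ.diam_le.trans (min_le_left _ _))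
        (show 0 ≤ 2 * L by positivity)
      refine this.trans_eq ?_
      field_simp
    have k2 : 8 * L * Q.diam ≤ ε * ρ ^ gam d / μ := by
      have := mul_le_mul_of_nonneg_left (hQ.diam_le.trans (min_le_right _ _))
        (show 0 ≤ 8 * L by positivity)
      rwa [hθ] at this
    -- each branch of the minimum that defines the diameter controls one branch of the integrand
    have k3 : 6 * L * Q.diam ≤ truncDensity p₀ ε μ x := by
      refine le_min (by linarith) ?_
      have hγ := gam_pos d
      have e1 : (3 / 4 * ρ) ^ gam d ≤ p₀ x ^ gam d := by gcongr
      rw [Real.mul_rpow (by norm_num) hρ.le] at e1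
      have e2 : (3 / 4 : ℝ) ≤ (3 / 4) ^ gam d := by
        simpa using Real.rpow_le_rpow_of_exponent_ge (show (0 : ℝ) < 3 / 4 by norm_num)
          (by norm_num) (gam_lt_one d).le
      have e3 : 3 / 4 * ρ ^ gam d ≤ p₀ x ^ gam d := le_trans (by gcongr) e1
      calc 6 * L * Q.diam ≤ 3 / 4 * (ε * ρ ^ gam d / μ) := by linarith
        _ = ε * (3 / 4 * ρ ^ gam d) / μ := by ring
        _ ≤ ε * p₀ x ^ gam d / μ := by gcongr
    linarith
  rw [h3]
  linarith

/-- Binning keeps half of an `L¹` separation of size `ε`. -/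
theorem GoodBins.half_le_sum (hd : 1 ≤ d) (hp : IsLipDensity L p) (hp₀ : IsLipDensity L p₀)
    (hε : 0 < ε) (hε2 : ε ≤ 2) (h : GoodBins p₀ L ε A i₀) (hsep : ε ≤ l1Dist p p₀) :
    ε / 2 ≤ ∑ i, |mass p (A i) - mass p₀ (A i)| := by
  obtain ⟨hμ, heq⟩ := muFun_spec hp₀ hε hε2
  set μ := muFun p₀ ε (1 / 4)
  have hfi : Integrable fun x => |p x - p₀ x| := (hp.integrable.sub hp₀.integrable).abs
  have hI := integrable_truncDensity hp₀ hε.le hμ.le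
  have hbin : ∀ i ≠ i₀, ∫ x in A i, |p x - p₀ x| ≤ |mass p (A i) - mass p₀ (A i)| +
      1 / 3 * ∫ x in A i, truncDensity p₀ ε μ x := fun i hi => by
    obtain ⟨Q, ρ, hQ, hlev⟩ := h.level i hi
    rw [hQ]
    exact setIntegral_abs_sub_le hd hp hp₀ hε hε2 hlev
  have hres : ∫ x in A i₀, |p x - p₀ x| ≤
      |mass p (A i₀) - mass p₀ (A i₀)| + 2 * mass p₀ (A i₀) := by
    have e1 : ∫ x in A i₀, |p x - p₀ x| ≤ ∫ x in A i₀, (p x + p₀ x) :=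
      setIntegral_mono_on hfi.integrableOn (hp.integrable.add hp₀.integrable).integrableOn
        (h.meas i₀) fun x _ => by
          have := hp.nonneg x
          have := hp₀.nonneg x
          exact abs_le.2 ⟨by linarith, by linarith⟩
    rw [integral_add hp.integrable.integrableOn hp₀.integrable.integrableOn,
      ← hp.mass_eq (h.meas i₀), ← hp₀.mass_eq (h.meas i₀)] at e1
    linarith [le_abs_self (mass p (A i₀) - mass p₀ (A i₀))]
  have hnn : ∀ i, 0 ≤ ∫ x in A i, truncDensity p₀ ε μ x := fun i =>
    integral_nonneg fun y => truncDensity_nonneg hp₀ hε.le hμ.le y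
  have hall : ∀ i, ∫ x in A i, |p x - p₀ x| ≤ (|mass p (A i) - mass p₀ (A i)| +
      1 / 3 * ∫ x in A i, truncDensity p₀ ε μ x) + (if i = i₀ then 2 * mass p₀ (A i₀) else 0) := by
    intro i
    split_ifs with hi
    · subst hi
      linarith [hnn i]
    · linarith [hbin i hi]
  have hsum := Finset.sum_le_sum fun i (_ : i ∈ Finset.univ) => hall i
  rw [Finset.sum_add_distrib, Finset.sum_add_distrib, ← Finset.mul_sum,
    ← h.integral_eq_sum hfi, ← h.integral_eq_sum hI, ← heq, Finset.sum_ite_eq'] at hsum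
  simp only [Finset.mem_univ, if_true] at hsum
  have hr := h.residual
  unfold l1Dist at hsep
  linarith

/-! ### The `2/3`-norm of the bulk -/

/-- The ratio by which the density level can increase when the mass of the bin does not. -/
def binRatio (d : ℕ) : ℝ := 5 / 3 * (10 / 3) ^ d

lemma one_le_binRatio (d : ℕ) : 1 ≤ binRatio d := by
  have : (1 : ℝ) ≤ (10 / 3) ^ d := one_le_pow₀ (by norm_num)
  unfold binRatio
  linarith

/-- Bins of smaller mass have smaller density level, up to a constant. -/
lemma BinAtLevel.level_le (hd : 1 ≤ d) (hp : IsLipDensity L p₀) {θ₁ θ₂ : ℝ} (hθ₁ : 0 ≤ θ₁)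
    (hθ₂ : 0 ≤ θ₂) {Q Q' : Cube d} {ρ ρ' : ℝ} (h : BinAtLevel p₀ θ₁ θ₂ Q ρ)
    (h' : BinAtLevel p₀ θ₁ θ₂ Q' ρ') (hm : mass p₀ Q'.toSet ≤ mass p₀ Q.toSet) :
    ρ' ≤ binRatio d * ρ := by
  have hρ := h.pos
  rcases le_total ρ' ρ with hle | hle
  · have := one_le_binRatio d
    nlinarith
  have hs := h.side_pos
  have hs' := h'.side_pos
  have hd0 : 0 < Real.sqrt d := Real.sqrt_pos.2 (by exact_mod_cast hd)
  have h1 : 3 / 10 * Q.side ≤ Q'.side := by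
    have e1 := binDiam_mono (d := d) hθ₁ hθ₂ hρ.le hle
    have e2 : Real.sqrt d * (3 / 10 * Q.side) ≤ Real.sqrt d * Q'.side := by
      have := h.diam_le
      have := h'.le_diam
      unfold Cube.diam at *
      linarith
    exact le_of_mul_le_mul_left e2 hd0
  have h2 : mass p₀ Q.toSet ≤ 5 / 4 * ρ * Q.side ^ d := by
    rw [← Q.volume_real_toSet hs.le]
    exact hp.mass_le_mul_volume Q.measurableSet_toSet (Q.volume_toSet_ne_top hs.le) h.upper
  have h3 : 3 / 4 * ρ' * Q'.side ^ d ≤ mass p₀ Q'.toSet := by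
    rw [← Q'.volume_real_toSet hs'.le]
    exact hp.mul_volume_le_mass Q'.measurableSet_toSet (Q'.volume_toSet_ne_top hs'.le) h'.lower
  have h4 : (3 / 10) ^ d * Q.side ^ d ≤ Q'.side ^ d := by
    rw [← mul_pow]
    exact pow_le_pow_left₀ (by positivity) h1 d
  have hρ' := h'.pos
  have h5 : 3 / 4 * ρ' * ((3 / 10) ^ d * Q.side ^ d) ≤ 5 / 4 * ρ * Q.side ^ d :=
    le_trans (by gcongr) (h3.trans (hm.trans h2))
  have h6 : 3 / 4 * ρ' * (3 / 10) ^ d ≤ 5 / 4 * ρ :=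
    le_of_mul_le_mul_right (by linarith) (pow_pos hs d)
  have h7 : ((3 : ℝ) / 10) ^ d * (10 / 3) ^ d = 1 := by rw [← mul_pow]; norm_num
  have h8 : (0 : ℝ) < (10 / 3) ^ d := by positivity
  calc ρ' = 4 / 3 * (3 / 4 * ρ' * (3 / 10) ^ d) * (10 / 3) ^ d := by
        linear_combination (-ρ') * h7
    _ ≤ 4 / 3 * (5 / 4 * ρ) * (10 / 3) ^ d := by gcongr
    _ = binRatio d * ρ := by unfold binRatio; ring

/-- A regular bin in the bulk dominates at least half of the truncation mass through regular bins:
if the residual bin comes later in the order, it is no heavier than the bin itself. -/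
lemma half_lt_sum_erase {q : Fin k → ℝ} (hq : ∀ i, 0 ≤ q i) (ha : Antitone q) {σ : ℝ}
    {i : Fin k} (hi : i ∈ multBulk q σ) (hne : i ≠ i₀) :
    σ / 2 < ∑ j ∈ (Finset.Ici i).erase i₀, q j := by
  have h1 := (mem_multBulk.1 hi).2
  by_cases h0 : i₀ ∈ Finset.Ici i
  · rw [← Finset.add_sum_erase _ _ h0] at h1
    have h2 : q i₀ ≤ q i := ha (Finset.mem_Ici.1 h0)
    have h3 : q i ≤ ∑ j ∈ (Finset.Ici i).erase i₀, q j :=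
      Finset.single_le_sum (fun j _ => hq j)
        (Finset.mem_erase.2 ⟨hne, Finset.mem_Ici.2 le_rfl⟩)
    linarith
  · rw [Finset.erase_eq_of_notMem h0]
    have : 0 ≤ ∑ j ∈ Finset.Ici i, q j := Finset.sum_nonneg fun j _ => hq j
    linarith

/-- The constant in the lower bound for the density levels of bulk bins. -/
def levelConst (d : ℕ) : ℝ := 512 * (5 / 4 * binRatio d)

lemma levelConst_ge (d : ℕ) : 640 ≤ levelConst d := by
  have := one_le_binRatio d
  unfold levelConst
  linarith

/-- The density on the regular bulk bins is not too small. The bins of no larger mass carry a mass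
of order `ε` at density levels of at most the same order, and any set `B` which misses little mass
has to contain half of it. -/
lemma GoodBins.level_rpow_le (hd : 1 ≤ d) (hp : IsLipDensity L p₀) (hε : 0 < ε) (hε2 : ε ≤ 2)
    (h : GoodBins p₀ L ε A i₀) {B : Set (Pt d)} (hB : MeasurableSet B)
    (hBm : 1 - ε / 512 ≤ mass p₀ B) (hBi : IntegrableOn (fun x => p₀ x ^ gam d) B) {i : Fin k}
    (hi : i ∈ multBulk (fun i => mass p₀ (A i)) (ε / 64 / 2)) (hne : i ≠ i₀) {Q : Cube d} {ρ : ℝ}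
    (hAi : A i = Q.toSet) (hQ : BinAtLevel p₀ (1 / (2 * L)) (thetaTwo p₀ L ε) Q ρ) :
    ρ ^ (gam d - 1) ≤ levelConst d * (∫ x in B, p₀ x ^ gam d) / ε := by
  have := hp.isProbabilityMeasure
  have hL := hp.lip_pos hd
  have hθ := thetaTwo_pos hd hp hε hε2
  have hρ := hQ.pos
  set U := ⋃ j ∈ (Finset.Ici i).erase i₀, A j with hU
  have hUm : MeasurableSet U := Finset.measurableSet_biUnion _ fun j _ => h.meas j
  have hUmass : ε / 256 ≤ mass p₀ U := by
    have e := half_lt_sum_erase (fun i => mass_nonneg (A i)) h.anti hi hne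
    have e2 : mass p₀ U = ∑ j ∈ (Finset.Ici i).erase i₀, mass p₀ (A j) :=
      measureReal_biUnion_finset (h.disj.set_pairwise _) fun j _ => h.meas j
    rw [e2]
    linarith
  set M := 5 / 4 * binRatio d * ρ with hM
  have hUM : ∀ x ∈ U, p₀ x ≤ M := by
    intro x hx
    obtain ⟨j, hj, hxj⟩ := Set.mem_iUnion₂.1 hx
    obtain ⟨hj0, hji⟩ := Finset.mem_erase.1 hj
    obtain ⟨Q', ρ', hAj, hQ'⟩ := h.level j hj0
    have hm : mass p₀ (A j) ≤ mass p₀ (A i) := h.anti (Finset.mem_Ici.1 hji)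
    rw [hAj, hAi] at hm
    have hlev := BinAtLevel.level_le hd hp (by positivity) hθ.le hQ hQ' hm
    rw [hAj] at hxj
    have := hQ'.upper x hxj
    linarith
  have hUB : ε / 512 ≤ mass p₀ (U ∩ B) := by
    have e1 : U ⊆ (U ∩ B) ∪ Bᶜ := fun x hx => by
      by_cases hxB : x ∈ B
      · exact Or.inl ⟨hx, hxB⟩
      · exact Or.inr hxB
    have e2 := (hp.mass_mono e1).trans (hp.mass_union_le _ _)
    rw [hp.mass_compl hB] at e2
    linarith
  have hM0 : 0 ≤ M ^ (gam d - 1) := Real.rpow_nonneg (by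
    have := one_le_binRatio d
    positivity) _
  have h1 : M ^ (gam d - 1) * (ε / 512) ≤ ∫ x in B, p₀ x ^ gam d := by
    calc M ^ (gam d - 1) * (ε / 512) ≤ M ^ (gam d - 1) * mass p₀ (U ∩ B) := by gcongr
      _ = ∫ x in U ∩ B, M ^ (gam d - 1) * p₀ x := by
          rw [integral_const_mul, hp.mass_eq (hUm.inter hB)]
      _ ≤ ∫ x in U ∩ B, p₀ x ^ gam d :=
          setIntegral_mono_on (hp.integrable.const_mul _).integrableOn
            (hBi.mono_set Set.inter_subset_right) (hUm.inter hB)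
            fun x hx => mul_le_rpow_gam (hp.nonneg x) (hUM x hx.1)
      _ ≤ ∫ x in B, p₀ x ^ gam d :=
          setIntegral_mono_set hBi (ae_of_all _ fun x => Real.rpow_nonneg (hp.nonneg x) _)
            (Filter.Eventually.of_forall Set.inter_subset_right)
  have hu : 1 ≤ 5 / 4 * binRatio d := by have := one_le_binRatio d; linarith
  have h2 := inv_mul_rpow_le (d := d) hu hρ
  rw [← hM] at h2
  have hu0 : 0 < 5 / 4 * binRatio d := by linarith
  rw [inv_mul_le_iff₀ hu0] at h2
  rw [le_div_iff₀ hε]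
  calc ρ ^ (gam d - 1) * ε ≤ 5 / 4 * binRatio d * M ^ (gam d - 1) * ε := by gcongr
    _ = levelConst d * (M ^ (gam d - 1) * (ε / 512)) := by unfold levelConst; ring
    _ ≤ levelConst d * ∫ x in B, p₀ x ^ gam d := by
        have := levelConst_ge d
        gcongr

/-- If the side of a bin is at least `η ρ^γ`, then the `2/3`-power of its mass is at most a multiple
of `η^(-d/3) ∫ p₀^γ`. The exponent `γ = 2 / (3 + d)` is determined by this comparison. -/
lemma BinAtLevel.rpow_mass_le (hp : IsLipDensity L p₀) {θ₁ θ₂ : ℝ} {Q : Cube d} {ρ η : ℝ}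
    (h : BinAtLevel p₀ θ₁ θ₂ Q ρ) (hη : 0 < η) (hside : η * ρ ^ gam d ≤ Q.side) :
    mass p₀ Q.toSet ^ ((2 : ℝ) / 3) ≤
      5 / 3 * η ^ (-((d : ℝ) / 3)) * ∫ x in Q.toSet, p₀ x ^ gam d := by
  have hρ := h.pos
  have hs := h.side_pos
  have hvol := Q.volume_toSet_ne_top hs.le
  have hQm := Q.measurableSet_toSet
  set q := mass p₀ Q.toSet with hq
  set g := ρ ^ (1 - gam d) with hg
  have hg0 : 0 < g := Real.rpow_pos_of_pos hρ _
  have h1 : 3 / 4 * ρ * Q.side ^ d ≤ q := by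
    rw [← Q.volume_real_toSet hs.le]
    exact hp.mul_volume_le_mass hQm hvol h.lower
  have hq0 : 0 < q := lt_of_lt_of_le (by positivity) h1
  have h2 : 3 / 4 * (η ^ d * g ^ 3) ≤ q := by
    refine le_trans ?_ h1
    have e1 : (η * ρ ^ gam d) ^ d ≤ Q.side ^ d := pow_le_pow_left₀ (by positivity) hside d
    have e2 : ρ * (ρ ^ gam d) ^ d = g ^ 3 := by
      rw [hg, ← Real.rpow_natCast, ← Real.rpow_natCast, ← Real.rpow_mul hρ.le,
        ← Real.rpow_mul hρ.le]
      conv_lhs => rw [← Real.rpow_one ρ, ← Real.rpow_mul hρ.le, one_mul, ← Real.rpow_add hρ]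
      congr 1
      have := gam_mul d
      push_cast
      linarith
    calc 3 / 4 * (η ^ d * g ^ 3) = 3 / 4 * ρ * (η * ρ ^ gam d) ^ d := by
          rw [← e2, mul_pow]; ring
      _ ≤ 3 / 4 * ρ * Q.side ^ d := by gcongr
  have h3 : 3 / 4 * (η ^ ((d : ℝ) / 3) * g) ≤ q ^ ((1 : ℝ) / 3) := by
    have e1 : (3 / 4 * (η ^ d * g ^ 3)) ^ ((1 : ℝ) / 3) ≤ q ^ ((1 : ℝ) / 3) := by gcongr
    refine le_trans ?_ e1
    rw [Real.mul_rpow (by norm_num) (by positivity), Real.mul_rpow (by positivity) (by positivity),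
      ← Real.rpow_natCast, ← Real.rpow_natCast, ← Real.rpow_mul hη.le, ← Real.rpow_mul hg0.le]
    have e2 : (3 / 4 : ℝ) ≤ (3 / 4) ^ ((1 : ℝ) / 3) := by
      simpa using Real.rpow_le_rpow_of_exponent_ge (show (0 : ℝ) < 3 / 4 by norm_num)
        (by norm_num) (show (1 : ℝ) / 3 ≤ 1 by norm_num)
    have e3 : ((3 : ℕ) : ℝ) * (1 / 3) = 1 := by norm_num
    have e4 : (d : ℝ) * (1 / 3) = d / 3 := by ring
    rw [e3, e4, Real.rpow_one]
    gcongr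
  have h4 : q ≤ 5 / 4 * g * ∫ x in Q.toSet, p₀ x ^ gam d := by
    have e0 : IntegrableOn (fun x => p₀ x ^ gam d) Q.toSet := by
      refine Integrable.mono' (integrableOn_const (C := (5 / 4 * ρ) ^ gam d) hvol)
        hp.measurable_rpow.aestronglyMeasurable
        ((ae_restrict_iff' hQm).2 (ae_of_all _ fun x hx => ?_))
      rw [Real.norm_eq_abs, abs_of_nonneg (Real.rpow_nonneg (hp.nonneg x) _)]
      exact Real.rpow_le_rpow (hp.nonneg x) (h.upper x hx) (gam_pos d).le
    have e1 : (5 / 4 * ρ) ^ (gam d - 1) * q ≤ ∫ x in Q.toSet, p₀ x ^ gam d := by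
      rw [hq, hp.mass_eq hQm, ← integral_const_mul]
      exact setIntegral_mono_on (hp.integrable.const_mul _).integrableOn e0 hQm
        fun x hx => mul_le_rpow_gam (hp.nonneg x) (h.upper x hx)
    have e2 := inv_mul_rpow_le (d := d) (show (1 : ℝ) ≤ 5 / 4 by norm_num) hρ
    have e3 : g * ρ ^ (gam d - 1) = 1 := by
      rw [hg, ← Real.rpow_add hρ]; simp
    have e4 : (5 / 4 : ℝ)⁻¹ * ρ ^ (gam d - 1) * q ≤ ∫ x in Q.toSet, p₀ x ^ gam d :=
      le_trans (by gcongr) e1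
    calc q = 5 / 4 * g * ((5 / 4 : ℝ)⁻¹ * ρ ^ (gam d - 1) * q) := by
          linear_combination (-q) * e3
      _ ≤ _ := by gcongr
  have h5 : q ^ ((2 : ℝ) / 3) * q ^ ((1 : ℝ) / 3) = q := by
    rw [← Real.rpow_add hq0]; norm_num
  have h6 : q ^ ((2 : ℝ) / 3) * (3 / 4 * (η ^ ((d : ℝ) / 3) * g)) ≤
      5 / 4 * g * ∫ x in Q.toSet, p₀ x ^ gam d := by
    refine le_trans ?_ h4
    calc _ ≤ q ^ ((2 : ℝ) / 3) * q ^ ((1 : ℝ) / 3) := by gcongr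
      _ = q := h5
  have h7 : η ^ ((d : ℝ) / 3) * η ^ (-((d : ℝ) / 3)) = 1 := by
    rw [← Real.rpow_add hη]; simp
  have h8 : 0 < η ^ (-((d : ℝ) / 3)) := Real.rpow_pos_of_pos hη _
  have h9 : g * q ^ ((2 : ℝ) / 3) ≤ g * (5 / 3 * η ^ (-((d : ℝ) / 3)) *
      ∫ x in Q.toSet, p₀ x ^ gam d) :=
    calc g * q ^ ((2 : ℝ) / 3) = 4 / 3 * η ^ (-((d : ℝ) / 3)) *
          (q ^ ((2 : ℝ) / 3) * (3 / 4 * (η ^ ((d : ℝ) / 3) * g))) := by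
          linear_combination (-(g * q ^ ((2 : ℝ) / 3))) * h7
      _ ≤ 4 / 3 * η ^ (-((d : ℝ) / 3)) * (5 / 4 * g * ∫ x in Q.toSet, p₀ x ^ gam d) := by gcongr
      _ = _ := by ring
  exact le_of_mul_le_mul_left h9 hg0

/-- The constant in the bound for the `2/3`-norm of the bulk. -/
def bulkConst (d : ℕ) : ℝ :=
  5 / 3 * (1 + levelConst d) * (3 / (20 * levelConst d * Real.sqrt d)) ^ (-((d : ℝ) / 3))

lemma bulkConst_pos (hd : 1 ≤ d) : 0 < bulkConst d := by
  have hd0 : 0 < Real.sqrt d := Real.sqrt_pos.2 (by exact_mod_cast hd)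
  have := levelConst_ge d
  have : 0 < levelConst d := by linarith
  unfold bulkConst
  positivity

/-- The `2/3`-norm of the bulk is bounded by `(L V / ε)^(d/3) V` with `V = ∫_B p₀^γ`, up to the
contribution of the residual bin. -/
theorem GoodBins.sum_bulk_le (hd : 1 ≤ d) (hp : IsLipDensity L p₀) (hε : 0 < ε) (hε2 : ε ≤ 2)
    (h : GoodBins p₀ L ε A i₀) {B : Set (Pt d)} (hB : MeasurableSet B)
    (hBm : 1 - ε / 512 ≤ mass p₀ B) (hBi : IntegrableOn (fun x => p₀ x ^ gam d) B)
    {V : ℝ} (hV : V = ∫ x in B, p₀ x ^ gam d) (hV0 : 0 < V) :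
    ∑ i ∈ multBulk (fun i => mass p₀ (A i)) (ε / 64 / 2), mass p₀ (A i) ^ ((2 : ℝ) / 3) ≤
      bulkConst d * (ε / (L * V)) ^ (-((d : ℝ) / 3)) * V + mass p₀ (A i₀) ^ ((2 : ℝ) / 3) := by
  have := hp.isProbabilityMeasure
  have hL := hp.lip_pos hd
  have hd0 : 0 < Real.sqrt d := Real.sqrt_pos.2 (by exact_mod_cast hd)
  have hK := levelConst_ge d
  have hK0 : 0 < levelConst d := by linarith
  obtain ⟨hμ, -⟩ := muFun_spec hp hε hε2
  have hμV := muFun_le hp hε hε2 hB (by linarith) hBi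
  rw [← hV] at hμV
  set S := (multBulk (fun i => mass p₀ (A i)) (ε / 64 / 2)).erase i₀ with hS
  have hSmem : ∀ i ∈ S, i ≠ i₀ ∧ i ∈ multBulk (fun i => mass p₀ (A i)) (ε / 64 / 2) := fun i hi =>
    Finset.mem_erase.1 hi
  set η := 3 / (20 * levelConst d * Real.sqrt d) * (ε / (L * V)) with hη
  have hη0 : 0 < η := by positivity
  have hlevel : ∀ i ∈ S, ∃ Q ρ, A i = Cube.toSet Q ∧
      BinAtLevel p₀ (1 / (2 * L)) (thetaTwo p₀ L ε) Q ρ ∧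
      ρ ^ (gam d - 1) ≤ levelConst d * V / ε := fun i hi => by
    obtain ⟨Q, ρ, hAi, hQ⟩ := h.level i (hSmem i hi).1
    refine ⟨Q, ρ, hAi, hQ, ?_⟩
    rw [hV]
    exact h.level_rpow_le hd hp hε hε2 hB hBm hBi (hSmem i hi).2 (hSmem i hi).1 hAi hQ
  have hterm : ∀ i ∈ S, mass p₀ (A i) ^ ((2 : ℝ) / 3) ≤
      5 / 3 * η ^ (-((d : ℝ) / 3)) * ∫ x in A i, p₀ x ^ gam d := by
    intro i hi
    obtain ⟨Q, ρ, hAi, hQ, hρ⟩ := hlevel i hi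
    rw [hAi]
    refine hQ.rpow_mass_le hp hη0 ?_
    have hρ0 := hQ.pos
    -- both branches of the target diameter are at least a multiple of `ε ρ^γ / (L V)`
    have e1 : ε / (2 * levelConst d * (L * V)) * ρ ^ gam d ≤
        binDiam d (1 / (2 * L)) (thetaTwo p₀ L ε) ρ := by
      refine le_min ?_ ?_
      · have e2 : ρ ^ (gam d - 1) * ε ≤ levelConst d * V := (le_div_iff₀ hε).1 hρ
        rw [Real.rpow_sub_one hρ0.ne', div_mul_eq_mul_div, div_le_iff₀ hρ0] at e2
        rw [div_mul_eq_mul_div, one_div_mul_eq_div, div_le_div_iff₀ (by positivity) (by positivity)]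
        calc ε * ρ ^ gam d * (2 * L) = 2 * L * (ρ ^ gam d * ε) := by ring
          _ ≤ 2 * L * (levelConst d * V * ρ) := by gcongr
          _ = _ := by ring
      · have hr : 0 < ρ ^ gam d := Real.rpow_pos_of_pos hρ0 _
        refine mul_le_mul_of_nonneg_right ?_ hr.le
        unfold thetaTwo
        refine div_le_div_of_nonneg_left hε.le (by positivity) ?_
        calc 8 * L * muFun p₀ ε (1 / 4) ≤ 8 * L * (2 * V) := by gcongr
          _ = 16 * (L * V) := by ring
          _ ≤ 2 * levelConst d * (L * V) := by gcongr; linarith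
    have e3 := hQ.le_diam
    have e4 : Real.sqrt d * (η * ρ ^ gam d) ≤ Real.sqrt d * Q.side :=
      calc Real.sqrt d * (η * ρ ^ gam d) =
            3 / 10 * (ε / (2 * levelConst d * (L * V)) * ρ ^ gam d) := by
            rw [hη]; field_simp; ring
        _ ≤ Q.diam := by linarith
    exact le_of_mul_le_mul_left e4 hd0
  -- the integral of `p₀^γ` over all regular bulk bins
  set W := ⋃ i ∈ S, A i with hW
  have hWm : MeasurableSet W := Finset.measurableSet_biUnion _ fun j _ => h.meas j
  have hWle : ∀ x ∈ W, p₀ x ^ gam d ≤ 4 / 3 * (levelConst d * V / ε) * p₀ x := by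
    intro x hx
    obtain ⟨i, hi, hxi⟩ := Set.mem_iUnion₂.1 hx
    obtain ⟨Q, ρ, hAi, hQ, hρ⟩ := hlevel i hi
    rw [hAi] at hxi
    have hρ0 := hQ.pos
    have e1 := rpow_gam_le_mul (d := d) (show 0 < 3 / 4 * ρ by positivity) (hQ.lower x hxi)
    have e2 := inv_mul_rpow_le (d := d) (show (1 : ℝ) ≤ 4 / 3 by norm_num)
      (show 0 < 3 / 4 * ρ by positivity)
    have e3 : 4 / 3 * (3 / 4 * ρ) = ρ := by ring
    rw [e3] at e2
    have hx0 := hp.nonneg x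
    refine e1.trans ?_
    gcongr
    linarith
  have hWi : IntegrableOn (fun x => p₀ x ^ gam d) W := by
    refine Integrable.mono' (hp.integrable.const_mul (4 / 3 * (levelConst d * V / ε))).integrableOn
      hp.measurable_rpow.aestronglyMeasurable
      ((ae_restrict_iff' hWm).2 (ae_of_all _ fun x hx => ?_))
    rw [Real.norm_eq_abs, abs_of_nonneg (Real.rpow_nonneg (hp.nonneg x) _)]
    exact hWle x hx
  have hWint : ∫ x in W, p₀ x ^ gam d ≤ (1 + levelConst d) * V := by
    have e1 : ∫ x in W ∩ B, p₀ x ^ gam d ≤ V := by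
      rw [hV]
      exact setIntegral_mono_set hBi (ae_of_all _ fun x => Real.rpow_nonneg (hp.nonneg x) _)
        (Filter.Eventually.of_forall Set.inter_subset_right)
    have e2 : ∫ x in W \ B, p₀ x ^ gam d ≤ levelConst d * V := by
      calc ∫ x in W \ B, p₀ x ^ gam d
          ≤ ∫ x in W \ B, 4 / 3 * (levelConst d * V / ε) * p₀ x :=
            setIntegral_mono_on (hWi.mono_set Set.sdiff_subset)
              (hp.integrable.const_mul _).integrableOn (hWm.diff hB) fun x hx => hWle x hx.1
        _ = 4 / 3 * (levelConst d * V / ε) * mass p₀ (W \ B) := by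
            rw [integral_const_mul, hp.mass_eq (hWm.diff hB)]
        _ ≤ 4 / 3 * (levelConst d * V / ε) * (ε / 512) := by
            gcongr
            have e := hp.mass_mono (A := W \ B) (B := Bᶜ) fun x hx => hx.2
            rw [hp.mass_compl hB] at e
            linarith
        _ = levelConst d * V * (1 / 384) := by field_simp; ring
        _ ≤ levelConst d * V * 1 := by gcongr; norm_num
        _ = _ := mul_one _
    have e3 := integral_inter_add_sdiff (μ := volume) hB hWi
    linarith
  have hWsum : ∫ x in W, p₀ x ^ gam d = ∑ i ∈ S, ∫ x in A i, p₀ x ^ gam d :=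
    integral_biUnion_finset S (fun i _ => h.meas i) (h.disj.set_pairwise _) fun i hi =>
      hWi.mono_set (Set.subset_biUnion_of_mem (u := fun i => A i) hi)
  have hSsum : ∑ i ∈ S, mass p₀ (A i) ^ ((2 : ℝ) / 3) ≤
      bulkConst d * (ε / (L * V)) ^ (-((d : ℝ) / 3)) * V := by
    refine (Finset.sum_le_sum hterm).trans ?_
    rw [← Finset.mul_sum, ← hWsum]
    calc 5 / 3 * η ^ (-((d : ℝ) / 3)) * ∫ x in W, p₀ x ^ gam d
        ≤ 5 / 3 * η ^ (-((d : ℝ) / 3)) * ((1 + levelConst d) * V) := by gcongr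
      _ = _ := by
          rw [hη, Real.mul_rpow (by positivity) (by positivity)]
          unfold bulkConst
          ring
  by_cases h0 : i₀ ∈ multBulk (fun i => mass p₀ (A i)) (ε / 64 / 2)
  · rw [← Finset.add_sum_erase _ _ h0, add_comm]
    exact add_le_add hSsum le_rfl
  · rw [hS, Finset.erase_eq_of_notMem h0] at hSsum
    have : 0 ≤ mass p₀ (A i₀) ^ ((2 : ℝ) / 3) := Real.rpow_nonneg (mass_nonneg _) _
    linarith

end Bins

/-! ### Error probabilities of the binning test -/

section Binning

variable {d : ℕ} {L ε : ℝ} {p p₀ : Pt d → ℝ}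

lemma one_div_gam (d : ℕ) : 1 / gam d = (3 + d) / 2 := by
  have h : (3 + d : ℝ) ≠ 0 := by positivity
  unfold gam
  field_simp

/-- A set that attains the truncated functional up to the factor `2`. -/
lemma exists_set_rpow_le_realT (hd : 1 ≤ d) (hp : IsLipDensity L p₀) {σ : ℝ} (h0 : 0 < σ)
    (h : σ ≤ 1 / 2) :
    ∃ B, MeasurableSet B ∧ 1 - σ ≤ mass p₀ B ∧ IntegrableOn (fun x => p₀ x ^ gam d) B ∧
      0 < ∫ x in B, p₀ x ^ gam d ∧
      (∫ x in B, p₀ x ^ gam d) ^ (1 / gam d) ≤ 2 * realT p₀ σ := by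
  have hγ := gam_pos d
  have hγ' : 0 < 1 / gam d := one_div_pos.2 hγ
  have hTop := truncV_ne_top hd hp h0
  have hT : 0 < realT p₀ σ := by
    have h1 := lowerConst_le hd hp h0 h
    have h2 := lowerConst_pos hd
    have h3 := Real.rpow_pos_of_pos (hp.lip_pos hd) ((d : ℝ) / 2)
    by_contra hcon
    have : realT p₀ σ = 0 := le_antisymm (not_lt.1 hcon) (realT_nonneg _ _)
    rw [this, mul_zero] at h1
    linarith
  set v := (truncV p₀ σ).toReal with hv
  have hv0 : 0 < v := by
    refine lt_of_le_of_ne ENNReal.toReal_nonneg fun hz => ?_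
    rw [realT, ← hv, ← hz, Real.zero_rpow hγ'.ne'] at hT
    exact lt_irrefl _ hT
  have h2 : 1 < (2 : ℝ) ^ gam d := Real.one_lt_rpow (by norm_num) hγ
  obtain ⟨B, hB, hBm, hBlt⟩ : ∃ B, MeasurableSet B ∧ 1 - σ ≤ mass p₀ B ∧
      ∫⁻ x in B, ENNReal.ofReal (p₀ x ^ gam d) < ENNReal.ofReal (2 ^ gam d * v) := by
    by_contra! hcon
    have h3 := le_truncV hp hcon
    rw [← ENNReal.ofReal_toReal hTop, ENNReal.ofReal_le_ofReal_iff ENNReal.toReal_nonneg] at h3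
    nlinarith
  have hnn : ∀ x, 0 ≤ p₀ x ^ gam d := fun x => Real.rpow_nonneg (hp.nonneg x) _
  have hfin : ∫⁻ x in B, ENNReal.ofReal (p₀ x ^ gam d) ≠ ∞ := ne_top_of_lt hBlt
  have hint : ∫ x in B, p₀ x ^ gam d =
      (∫⁻ x in B, ENNReal.ofReal (p₀ x ^ gam d)).toReal :=
    integral_eq_lintegral_of_nonneg_ae (.of_forall hnn) hp.measurable_rpow.aestronglyMeasurable
  refine ⟨B, hB, hBm, ⟨hp.measurable_rpow.aestronglyMeasurable, ?_⟩, ?_, ?_⟩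
  · rw [hasFiniteIntegral_iff_ofReal (.of_forall hnn)]
    exact hfin.lt_top
  · rw [hint]
    exact hv0.trans_le (ENNReal.toReal_mono hfin (truncV_le hp hB hBm))
  · have h4 : ∫ x in B, p₀ x ^ gam d ≤ 2 ^ gam d * v := by
      rw [hint]
      exact ENNReal.toReal_le_of_le_ofReal (by positivity) hBlt.le
    calc (∫ x in B, p₀ x ^ gam d) ^ (1 / gam d) ≤ (2 ^ gam d * v) ^ (1 / gam d) :=
          Real.rpow_le_rpow (integral_nonneg hnn) h4 hγ'.le
      _ = 2 * realT p₀ σ := by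
          rw [Real.mul_rpow (by positivity) hv0.le, ← Real.rpow_mul (by norm_num),
            mul_one_div_cancel hγ.ne', Real.rpow_one, realT]

/-- The constant in the bound for the cubed square root of the `2/3`-norm of the bulk. -/
def powerConst (d : ℕ) : ℝ := bulkConst d ^ ((3 : ℝ) / 2)

lemma powerConst_pos (hd : 1 ≤ d) : 0 < powerConst d := Real.rpow_pos_of_pos (bulkConst_pos hd) _

/-- The `2/3`-norm of the bulk in terms of the truncated functional. -/
lemma GoodBins.exists_sum_bulk_le {k : ℕ} {A : Fin k → Set (Pt d)} {i₀ : Fin k} (hd : 1 ≤ d)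
    (hp : IsLipDensity L p₀) (hε : 0 < ε) (hε2 : ε ≤ 2) (h : GoodBins p₀ L ε A i₀) :
    ∃ s, 0 ≤ s ∧
      ∑ i ∈ multBulk (fun i => mass p₀ (A i)) (ε / 64 / 2), mass p₀ (A i) ^ ((2 : ℝ) / 3) ≤ s ^ 2 ∧
      s ^ 3 ≤ 8 * powerConst d * (L / ε) ^ ((d : ℝ) / 2) * realT p₀ (ε / 512) + 4 / 15 * ε := by
  have hL := hp.lip_pos hd
  have hb := bulkConst_pos hd
  obtain ⟨B, hB, hBm, hBi, hV0, hVT⟩ :=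
    exists_set_rpow_le_realT hd hp (σ := ε / 512) (by positivity) (by linarith)
  have hsum := h.sum_bulk_le hd hp hε hε2 hB hBm hBi rfl hV0
  set V := ∫ x in B, p₀ x ^ gam d
  set K := bulkConst d * (ε / (L * V)) ^ (-((d : ℝ) / 3)) * V with hK
  have hK0 : 0 < K := by positivity
  set q := mass p₀ (A i₀)
  have hq : 0 ≤ q := mass_nonneg _
  set a := K ^ ((1 : ℝ) / 2) with ha
  set b := q ^ ((1 : ℝ) / 3) with hbdef
  have ha0 : 0 ≤ a := by positivity
  have hb0 : 0 ≤ b := by positivity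
  have ha2 : a ^ 2 = K := by
    rw [ha, ← Real.rpow_natCast, ← Real.rpow_mul hK0.le]; norm_num
  have hb2 : b ^ 2 = q ^ ((2 : ℝ) / 3) := by
    rw [hbdef, ← Real.rpow_natCast, ← Real.rpow_mul hq]; norm_num
  have hb3 : b ^ 3 = q := by
    rw [hbdef, ← Real.rpow_natCast, ← Real.rpow_mul hq]; norm_num
  have ha3 : a ^ 3 = powerConst d * (L / ε) ^ ((d : ℝ) / 2) * V ^ (1 / gam d) := by
    have e0 : ε / (L * V) = (L / ε * V)⁻¹ := by field_simp
    have e1 : a ^ 3 = K ^ ((3 : ℝ) / 2) := by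
      rw [ha, ← Real.rpow_natCast, ← Real.rpow_mul hK0.le]; norm_num
    have e2 : (d : ℝ) / 3 * (3 / 2) = d / 2 := by ring
    rw [e1, hK, e0, Real.inv_rpow (by positivity), ← Real.rpow_neg (by positivity), neg_neg,
      Real.mul_rpow (by positivity) hV0.le, Real.mul_rpow hb.le (by positivity),
      ← Real.rpow_mul (by positivity), e2, Real.mul_rpow (by positivity) hV0.le, powerConst,
      one_div_gam, show ((3 : ℝ) + d) / 2 = d / 2 + 3 / 2 by ring, Real.rpow_add hV0]
    ring
  refine ⟨a + b, by positivity, ?_, ?_⟩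
  · have := mul_nonneg ha0 hb0
    linarith [add_sq a b]
  · have h1 : (a + b) ^ 3 ≤ 4 * (a ^ 3 + b ^ 3) := by
      have := mul_nonneg (add_nonneg ha0 hb0) (sq_nonneg (a - b))
      linarith
    have h2 : a ^ 3 ≤ powerConst d * (L / ε) ^ ((d : ℝ) / 2) * (2 * realT p₀ (ε / 512)) := by
      rw [ha3]
      have := (powerConst_pos hd).le
      gcongr
    have h3 := h.residual
    rw [hb3] at h1
    linarith

lemma toNNReal_mass (p : Pt d → ℝ) (A : Set (Pt d)) :
    (mass p A).toNNReal = (law p A).toNNReal := by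
  rw [mass, measureReal_def, ENNReal.toNNReal_toReal_eq]

lemma poissonProb_mono {n : ℕ} {R R' : Test d} (h : ∀ m, R m ⊆ R' m) :
    poissonProb n p R ≤ poissonProb n p R' :=
  ENNReal.tsum_le_tsum fun m => mul_le_mul_right (measure_mono (h m)) _

lemma GoodBins.poissonProb_eq {k : ℕ} {A : Fin k → Set (Pt d)} {i₀ : Fin k}
    (h : GoodBins p₀ L ε A i₀) {L' : ℝ} (hp : IsLipDensity L' p) (n : ℕ) (S : Set (Fin k → ℕ)) :
    poissonProb n p (fun _ => {z | (fun l => count z (A l)) ∈ S}) =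
      poissonPi n (fun i => mass p (A i)) S := by
  have := hp.isProbabilityMeasure
  rw [poissonProb_eq_pi n h.meas h.disj h.cover, poissonPi]
  simp_rw [toNNReal_mass]

theorem rejectProb_binningTest_le (hd : 1 ≤ d) (hp : IsLipDensity L p₀) (hε : 0 < ε) (hε2 : ε ≤ 2)
    {α : ℝ} (hα : 0 < α) (n : ℕ) :
    rejectProb n p₀ (binningTest n p₀ L ε α) ≤ ENNReal.ofReal α := by
  obtain ⟨i₀, h⟩ := goodBins_bins hd hp hε hε2
  have h1 := h.poissonProb_eq hp n {x | CompositeRejects n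
    (fun i => mass p₀ ((bins p₀ L ε).get i)) (ε / 8 / 8) α x}
  have h2 := composite_typeI (n := n) (fun i => mass_nonneg ((bins p₀ L ε).get i)) h.anti
    (σ := ε / 8 / 8) (by positivity) hα
  exact h1.trans_le h2

/-- Power of the binning test. The factor `M` stands for the reciprocal of the error levels. -/
theorem acceptProb_binningTest_le (hd : 1 ≤ d) (hp₀ : IsLipDensity L p₀) (hp : IsLipDensity L p)
    (hε : 0 < ε) (hε2 : ε ≤ 2) (hsep : ε ≤ l1Dist p p₀) {α ζ M : ℝ} (hα : 0 < α) (hζ : 0 < ζ)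
    (hM : 1 ≤ M) (hMα : 1 ≤ M * α) (hMζ : 1 ≤ M * ζ) {n : ℕ} (h1 : 2 ^ 17 * M ≤ n * ε)
    (h2 : 2 ^ 21 * powerConst d * M * (L ^ ((d : ℝ) / 2) * realT p₀ (ε / 512)) ≤
      n * ε ^ ((4 + d : ℝ) / 2)) :
    acceptProb n p (binningTest n p₀ L ε α) ≤ ENNReal.ofReal ζ := by
  have hL := hp₀.lip_pos hd
  obtain ⟨i₀, h⟩ := goodBins_bins hd hp₀ hε hε2
  obtain ⟨s, hs0, hs2, hs3⟩ := h.exists_sum_bulk_le hd hp₀ hε hε2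
  have e1 := h.poissonProb_eq hp n {x | ¬ CompositeRejects n
    (fun i => mass p₀ ((bins p₀ L ε).get i)) (ε / 8 / 8) α x}
  have e2 : ε / 8 / 8 = ε / 64 := by ring
  refine e1.trans_le ?_
  rw [e2]
  refine composite_typeII (fun i => mass_nonneg _) h.anti (fun i => mass_nonneg _)
    (h.sum_mass hp₀) (h.sum_mass hp) hε (h.half_le_sum hd hp hp₀ hε hε2 hsep) hα hζ hM hMα hMζ
    (by linarith) hs0 hs2 ?_
  -- the contribution of the cubes and that of the residual bin each take half of `n ε ^ 2`
  have hεd : 0 < ε ^ ((d : ℝ) / 2) := by positivity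
  have h3 : 2 ^ 21 * powerConst d * M * ((L / ε) ^ ((d : ℝ) / 2) * realT p₀ (ε / 512)) ≤
      n * ε ^ 2 := by
    refine le_of_mul_le_mul_right ?_ hεd
    have e3 : ε ^ ((4 + d : ℝ) / 2) = ε ^ 2 * ε ^ ((d : ℝ) / 2) := by
      rw [show (4 + d : ℝ) / 2 = (2 : ℕ) + d / 2 by push_cast; ring, Real.rpow_add hε,
        Real.rpow_natCast]
    have e4 : (L / ε) ^ ((d : ℝ) / 2) * ε ^ ((d : ℝ) / 2) = L ^ ((d : ℝ) / 2) := by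
      rw [← Real.mul_rpow (by positivity) hε.le, div_mul_cancel₀ _ hε.ne']
    rw [e3] at h2
    calc _ = 2 ^ 21 * powerConst d * M *
          ((L / ε) ^ ((d : ℝ) / 2) * ε ^ ((d : ℝ) / 2) * realT p₀ (ε / 512)) := by ring
      _ ≤ _ := by rw [e4]; linarith
  have h4 := mul_le_mul_of_nonneg_left hs3 (a := 2 ^ 17 * M) (by positivity)
  have h5 := mul_le_mul_of_nonneg_right h1 hε.le
  have h6 : 0 ≤ M * ε := by positivity
  linarith

end Binning

/-! ### The dyadic grid of Lipschitz constants -/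

section Grid

variable {d : ℕ} {L : ℝ} {p₀ : Pt d → ℝ} {c : ℝ} {n : ℕ}

lemma half_lt_log {n : ℕ} (hn : 2 ≤ n) : 1 / 2 < Real.log n := by
  have h1 := Real.log_two_gt_d9
  have h2 : Real.log 2 ≤ Real.log n := Real.log_le_log (by norm_num) (by exact_mod_cast hn)
  linarith

lemma one_le_mul_rpow {A : ℝ} (hA : 1 ≤ A) (d : ℕ) (hn : 2 ≤ n) :
    1 ≤ A * (n : ℝ) ^ ((2 : ℝ) / d) :=
  one_le_mul_of_one_le_of_one_le hA
    (Real.one_le_rpow (by exact_mod_cast (by omega : 1 ≤ n)) (by positivity))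

lemma gridSize_pos {A : ℝ} (hA : 1 ≤ A) (d : ℕ) (hn : 2 ≤ n) : 0 < gridSize d A n := by
  have := Real.logb_nonneg one_lt_two (one_le_mul_rpow hA d hn)
  exact Nat.ceil_pos.2 (by linarith)

/-- The factor in the logarithmic bound for the size of the grid. -/
def gridConst (A : ℝ) : ℝ := 2 * Real.logb 2 A + 8

lemma gridConst_pos {A : ℝ} (hA : 1 ≤ A) : 0 < gridConst A := by
  have := Real.logb_nonneg one_lt_two hA
  unfold gridConst
  linarith

/-- The grid has `O(log n)` points. -/
lemma gridSize_le (hd : 1 ≤ d) {A : ℝ} (hA : 1 ≤ A) (hn : 2 ≤ n) :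
    (gridSize d A n : ℝ) ≤ gridConst A * Real.log n := by
  have hn0 : (0 : ℝ) < n := by exact_mod_cast (by omega : 0 < n)
  have hA0 : (0 : ℝ) < A := by linarith
  have h0 := Real.logb_nonneg one_lt_two (one_le_mul_rpow hA d hn)
  have hlA := Real.logb_nonneg one_lt_two hA
  have hl := half_lt_log hn
  have h1 : (gridSize d A n : ℝ) < Real.logb 2 (A * (n : ℝ) ^ ((2 : ℝ) / d)) + 1 + 1 :=
    Nat.ceil_lt_add_one (by linarith)
  rw [Real.logb_mul hA0.ne' (by positivity), Real.logb_rpow_eq_mul_logb_of_pos hn0] at h1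
  have h2 : (2 : ℝ) / d ≤ 2 := div_le_self (by norm_num) (by exact_mod_cast hd)
  have h3 : Real.logb 2 n ≤ 2 * Real.log n := by
    have := Real.log_two_gt_d9
    rw [Real.logb, div_le_iff₀ (by linarith)]
    nlinarith
  have h4 : (2 : ℝ) / d * Real.logb 2 n ≤ 2 * (2 * Real.log n) :=
    mul_le_mul h2 h3 (Real.logb_nonneg one_lt_two (by exact_mod_cast (by omega : 1 ≤ n)))
      (by norm_num)
  have h5 := mul_le_mul_of_nonneg_left hl.le hlA
  unfold gridConst
  linarith

/-- Every Lipschitz constant in the range of the grid is at most a grid point, which exceeds it by a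
factor of at most `2`. -/
lemma exists_lt_gridSize {A L₀ : ℝ} (hA : 1 ≤ A) (hn : 2 ≤ n) (hL₀ : 0 < L₀) (hL : L₀ ≤ L)
    (hle : L ≤ A * (n : ℝ) ^ ((2 : ℝ) / d) * L₀) :
    ∃ j < gridSize d A n, L ≤ 2 ^ j * L₀ ∧ 2 ^ j * L₀ ≤ 2 * L := by
  have h0 := Real.logb_nonneg one_lt_two (one_le_mul_rpow hA d hn)
  have hr : 1 ≤ L / L₀ := (one_le_div hL₀).2 hL
  have hr0 : 0 < L / L₀ := by linarith
  have hx := Real.logb_nonneg one_lt_two hr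
  have e : (2 : ℝ) ^ Real.logb 2 (L / L₀) = L / L₀ :=
    Real.rpow_logb (by norm_num) (by norm_num) hr0
  refine ⟨⌈Real.logb 2 (L / L₀)⌉₊, ?_, ?_, ?_⟩
  · rw [gridSize, Nat.ceil_add_one h0, Nat.lt_succ_iff]
    exact Nat.ceil_le_ceil (Real.logb_le_logb_of_le one_lt_two hr0 ((div_le_iff₀ hL₀).2 hle))
  · have h1 := Real.rpow_le_rpow_of_exponent_le (one_le_two (α := ℝ))
      (Nat.le_ceil (Real.logb 2 (L / L₀)))
    rw [e, Real.rpow_natCast] at h1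
    exact (div_le_iff₀ hL₀).1 h1
  · have h1 := Real.rpow_le_rpow_of_exponent_le (one_le_two (α := ℝ)) (Nat.ceil_lt_add_one hx).le
    rw [Real.rpow_add (by norm_num), e, Real.rpow_natCast, Real.rpow_one] at h1
    calc _ ≤ L / L₀ * 2 * L₀ := by gcongr
      _ = 2 * L := by field_simp

/-- A small radius is at least of order `log n / n`. -/
lemma mul_log_le_mul_adaptiveRadius (hd : 1 ≤ d) (hp : IsLipDensity L p₀) (hc : 0 < c)
    (hn : 2 ≤ n) (hw : c * adaptiveRadius c n p₀ L ≤ 1 / 2) :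
    min (lowerConst d) 1 * Real.log n ≤ n * adaptiveRadius c n p₀ L := by
  have hL := hp.lip_pos hd
  obtain ⟨h1, -⟩ := adaptiveRadius_spec (n := n) hd hp hc hn hL
  have h2 := adaptiveRadius_pow (n := n) hd hp hc hn hL
  have h3 := lowerConst_le hd hp (by positivity) hw
  have hn0 : (0 : ℝ) < n := by exact_mod_cast (by omega : 0 < n)
  have hl := half_lt_log hn
  have hl0 : 0 < Real.log n := by linarith
  set w := adaptiveRadius c n p₀ L
  set y := min (lowerConst d) 1 * Real.log n / n with hy
  have hy1 : y ≤ 1 := by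
    rw [hy, div_le_one hn0]
    have := Real.log_le_self hn0.le
    have := mul_le_mul_of_nonneg_right (min_le_right (lowerConst d) 1) hl0.le
    linarith
  have hyw : y ≤ w ^ ((4 + d : ℝ) / 2) := by
    rw [h2]
    calc y ≤ lowerConst d * (Real.log n / n) := by
          rw [hy, mul_div_assoc]
          gcongr
          exact min_le_left _ _
      _ ≤ L ^ ((d : ℝ) / 2) * realT p₀ (c * w) * (Real.log n / n) := by gcongr
      _ = _ := by ring
  have hle : y ≤ w := by
    by_contra! hlt
    have h4 : w ^ ((4 + d : ℝ) / 2) ≤ w ^ (1 : ℝ) :=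
      Real.rpow_le_rpow_of_exponent_ge h1 (by linarith) (by
        have : (0 : ℝ) ≤ d := d.cast_nonneg
        linarith)
    rw [Real.rpow_one] at h4
    linarith
  rwa [hy, div_le_iff₀ hn0, mul_comm w] at hle

/-- Above the range of the grid the radius is so large that no alternative remains. -/
lemma one_div_le_adaptiveRadius (hd : 1 ≤ d) {L₀ : ℝ} (hp : IsLipDensity L₀ p₀) (hc : 0 < c)
    (hn : 2 ≤ n) {A : ℝ} (hA1 : 1 ≤ A)
    (hA : (2 / lowerConst d * (1 / (2 * c)) ^ ((4 + d : ℝ) / 2)) ^ 2 ≤ A)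
    (hlt : A * (n : ℝ) ^ ((2 : ℝ) / d) * L₀ < L) : 1 / (2 * c) ≤ adaptiveRadius c n p₀ L := by
  have hL₀ := hp.lip_pos hd
  have hn0 : (0 : ℝ) < n := by exact_mod_cast (by omega : 0 < n)
  have hd0 : (0 : ℝ) < d := by exact_mod_cast hd
  have hA0 : 0 < A := by linarith
  have hL : 0 < L := lt_trans (by positivity) hlt
  have hκ := lowerConst_pos hd
  have hl := half_lt_log hn
  by_contra! hw
  obtain ⟨h1, -⟩ := adaptiveRadius_spec (n := n) hd hp hc hn hL
  have h2 := adaptiveRadius_pow (n := n) hd hp hc hn hL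
  set w := adaptiveRadius c n p₀ L
  have hcw : c * w ≤ 1 / 2 := by
    have := mul_le_mul_of_nonneg_left hw.le hc.le
    have e : c * (1 / (2 * c)) = 1 / 2 := by field_simp
    linarith
  have h3 := lowerConst_le hd hp (mul_pos hc h1) hcw
  have h4 : w ^ ((4 + d : ℝ) / 2) < (1 / (2 * c)) ^ ((4 + d : ℝ) / 2) :=
    Real.rpow_lt_rpow h1.le hw (by positivity)
  have h5 : A ^ ((d : ℝ) / 2) * n * L₀ ^ ((d : ℝ) / 2) ≤ L ^ ((d : ℝ) / 2) := by
    have e : (n : ℝ) = ((n : ℝ) ^ ((2 : ℝ) / d)) ^ ((d : ℝ) / 2) := by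
      rw [← Real.rpow_mul hn0.le]
      have : (2 : ℝ) / d * (d / 2) = 1 := by field_simp
      rw [this, Real.rpow_one]
    conv_lhs => rw [e]
    rw [← Real.mul_rpow hA0.le (by positivity), ← Real.mul_rpow (by positivity) hL₀.le]
    exact Real.rpow_le_rpow (by positivity) hlt.le (by positivity)
  have h6 : 2 / lowerConst d * (1 / (2 * c)) ^ ((4 + d : ℝ) / 2) ≤ A ^ ((d : ℝ) / 2) := by
    refine (Real.le_sqrt (by positivity) hA0.le).2 hA |>.trans ?_
    rw [Real.sqrt_eq_rpow]
    refine Real.rpow_le_rpow_of_exponent_le hA1 ?_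
    have : (1 : ℝ) ≤ d := by exact_mod_cast hd
    linarith
  have hT := realT_nonneg p₀ (c * w)
  have h7 : A ^ ((d : ℝ) / 2) * (1 / 2) * lowerConst d ≤ w ^ ((4 + d : ℝ) / 2) := by
    rw [h2]
    calc A ^ ((d : ℝ) / 2) * (1 / 2) * lowerConst d
        ≤ A ^ ((d : ℝ) / 2) * Real.log n * (L₀ ^ ((d : ℝ) / 2) * realT p₀ (c * w)) := by gcongr
      _ = A ^ ((d : ℝ) / 2) * n * L₀ ^ ((d : ℝ) / 2) * Real.log n / n * realT p₀ (c * w) := by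
          field_simp
      _ ≤ _ := by gcongr
  have h8 := mul_le_mul_of_nonneg_right h6 (a := lowerConst d / 2) (by positivity)
  have e8 : 2 / lowerConst d * (1 / (2 * c)) ^ ((4 + d : ℝ) / 2) * (lowerConst d / 2) =
      (1 / (2 * c)) ^ ((4 + d : ℝ) / 2) := by field_simp
  rw [e8] at h8
  linarith

end Grid

/-! ### The adaptive test -/

section Adaptive

variable {d : ℕ} {L : ℝ} {p p₀ : Pt d → ℝ} {c : ℝ} {n : ℕ}

lemma measurableSet_binningTest (hd : 1 ≤ d) (hp : IsLipDensity L p₀) {ε : ℝ} (hε : 0 < ε)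
    (hε2 : ε ≤ 2) (α : ℝ) (m : ℕ) : MeasurableSet (binningTest n p₀ L ε α m) := by
  obtain ⟨i₀, h⟩ := goodBins_bins hd hp hε hε2
  exact measurable_counts h.meas (MeasurableSet.of_discrete (s := {x | CompositeRejects n
    (fun i => mass p₀ ((bins p₀ L ε).get i)) (ε / 8 / 8) α x}))

lemma poissonProb_le_one (hp : IsLipDensity L p) (n : ℕ) (R : Test d) : poissonProb n p R ≤ 1 := by
  have := hp.isProbabilityMeasure
  have h := poissonProb_eq_pi n (p := p) (k := 1) (A := fun _ => Set.univ)
    (fun _ => MeasurableSet.univ) (fun i j hij => absurd (Subsingleton.elim i j) hij)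
    (Set.iUnion_const _) Set.univ
  exact (poissonProb_mono fun m => Set.subset_univ _).trans (h.trans_le prob_le_one)

lemma poissonProb_biUnion_le (s : Finset ℕ) (R : ℕ → Test d) :
    poissonProb n p (fun m => ⋃ j ∈ s, R j m) ≤ ∑ j ∈ s, poissonProb n p (R j) := by
  unfold poissonProb
  rw [← Summable.tsum_finsetSum fun _ _ => ENNReal.summable]
  refine ENNReal.tsum_le_tsum fun m => ?_
  rw [← Finset.mul_sum]
  exact mul_le_mul_right (measure_biUnion_finset_le s _) _

lemma tunedSeparation_pos (hd : 1 ≤ d) (hp : IsLipDensity L p₀) (hc : 0 < c) (hn : 2 ≤ n)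
    {C α ζ : ℝ} (hC : 0 < C) (hα : 0 < α) : 0 < tunedSeparation c C α ζ n p₀ L := by
  have h1 := (adaptiveRadius_spec (n := n) hd hp hc hn (hp.lip_pos hd)).1
  have h2 : 0 < max (1 / α) (1 / ζ) := lt_of_lt_of_le (by positivity) (le_max_left _ _)
  refine lt_min (by norm_num) ?_
  unfold separation
  positivity

lemma le_two_pow_mul {L₀ : ℝ} (hL₀ : 0 ≤ L₀) (j : ℕ) : L₀ ≤ 2 ^ j * L₀ :=
  le_mul_of_one_le_left hL₀ (one_le_pow₀ one_le_two)

lemma measurableSet_adaptiveTest (hd : 1 ≤ d) {L₀ : ℝ} (hp : IsLipDensity L₀ p₀) (hc : 0 < c)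
    (hn : 2 ≤ n) (A : ℝ) {C α ζ : ℝ} (hC : 0 < C) (hα : 0 < α) (m : ℕ) :
    MeasurableSet (adaptiveTest c A C α ζ n L₀ p₀ m) :=
  Finset.measurableSet_biUnion _ fun j _ => by
    have hj := hp.mono (le_two_pow_mul (hp.lip_pos hd).le j)
    exact measurableSet_binningTest hd hj (tunedSeparation_pos hd hj hc hn hC hα)
      (min_le_left _ _) _ m

/-- The level of the adaptive test, by the union bound over the grid. -/
theorem rejectProb_adaptiveTest_le (hd : 1 ≤ d) {L₀ : ℝ} (hp : IsLipDensity L₀ p₀) (hc : 0 < c)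
    (hn : 2 ≤ n) {A C α ζ : ℝ} (hA : 1 ≤ A) (hC : 0 < C) (hα : 0 < α) :
    rejectProb n p₀ (adaptiveTest c A C α ζ n L₀ p₀) ≤ ENNReal.ofReal α := by
  have hK : (0 : ℝ) < gridSize d A n := by exact_mod_cast gridSize_pos hA d hn
  calc rejectProb n p₀ (adaptiveTest c A C α ζ n L₀ p₀)
      ≤ ∑ j ∈ Finset.range (gridSize d A n), rejectProb n p₀ (binningTest n p₀ (2 ^ j * L₀)
          (tunedSeparation c C α ζ n p₀ (2 ^ j * L₀)) (α / gridSize d A n)) :=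
        poissonProb_biUnion_le _ _
    _ ≤ ∑ j ∈ Finset.range (gridSize d A n), ENNReal.ofReal (α / gridSize d A n) := by
        refine Finset.sum_le_sum fun j _ => ?_
        have hj := hp.mono (le_two_pow_mul (hp.lip_pos hd).le j)
        exact rejectProb_binningTest_le hd hj (tunedSeparation_pos hd hj hc hn hC hα)
          (min_le_left _ _) (by positivity) n
    _ = ENNReal.ofReal α := by
        rw [Finset.sum_const, Finset.card_range, nsmul_eq_mul, ← ENNReal.ofReal_natCast,
          ← ENNReal.ofReal_mul hK.le, mul_div_cancel₀ _ hK.ne']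

/-- The threshold for the constant `C`. For `ζ < 1` it makes `C max(1/α, 1/ζ) ≥ 2` and `c w` at most
`1 / 512` of the tuned separation, and it ensures the two sample size conditions of the binning test. -/
def sepConst (d : ℕ) (c A : ℝ) : ℝ :=
  2 + 1024 * c + 2 ^ 18 * gridConst A / min (lowerConst d) 1 + 2 ^ 22 * powerConst d * gridConst A

/-- Power of the adaptive test: the alternative is detected by the binning test at a grid
point above its Lipschitz constant. -/
theorem acceptProb_adaptiveTest_le (hd : 1 ≤ d) {L₀ : ℝ} (hp₀ : IsLipDensity L₀ p₀)
    (hp : IsLipDensity L p) (hL : L₀ ≤ L) (hc : 0 < c) (hn : 2 ≤ n) {A C α ζ : ℝ} (hA1 : 1 ≤ A)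
    (hA : (2 / lowerConst d * (1 / (2 * c)) ^ ((4 + d : ℝ) / 2)) ^ 2 ≤ A)
    (hC : sepConst d c A ≤ C) (hα : 0 < α) (hζ : 0 < ζ)
    (hsep : separation c C α ζ n p₀ L ≤ l1Dist p p₀) :
    acceptProb n p (adaptiveTest c A C α ζ n L₀ p₀) ≤ ENNReal.ofReal ζ := by
  rcases le_or_gt 1 ζ with hζ1 | hζ1
  · refine (poissonProb_le_one hp n _).trans ?_
    rw [← ENNReal.ofReal_one]
    exact ENNReal.ofReal_le_ofReal hζ1
  have hL₀ := hp₀.lip_pos hd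
  have hL0 : 0 < L := hL₀.trans_le hL
  have hl := half_lt_log hn
  have hl0 : 0 < Real.log n := by linarith
  have hn0 : (0 : ℝ) < n := by exact_mod_cast (by omega : 0 < n)
  have hG := gridConst_pos hA1
  have hP := powerConst_pos hd
  have hκ : 0 < min (lowerConst d) 1 := lt_min (lowerConst_pos hd) one_pos
  have hGκ : 0 < 2 ^ 18 * gridConst A / min (lowerConst d) 1 := by positivity
  have hPG : 0 < 2 ^ 22 * powerConst d * gridConst A := by positivity
  unfold sepConst at hC
  have hC0 : 0 < C := by linarith
  set M := max (1 / α) (1 / ζ) with hMdef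
  have hMα : 1 ≤ M * α := (div_le_iff₀ hα).1 (le_max_left _ _)
  have hMζ : 1 ≤ M * ζ := (div_le_iff₀ hζ).1 (le_max_right _ _)
  have hM : 1 ≤ M := le_trans ((one_le_div hζ).2 hζ1.le) (le_max_right _ _)
  have hM0 : 0 < M := by linarith
  have hw0 := (adaptiveRadius_spec (n := n) hd hp₀ hc hn hL0).1
  have hCM : C ≤ C * M := le_mul_of_one_le_right hC0.le hM
  have hsep' : C * M * adaptiveRadius c n p₀ L ≤ l1Dist p p₀ := hsep
  have hcap := hsep'.trans (l1Dist_le_two hp hp₀)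
  -- beyond the grid the separation exceeds the largest possible distance `2`
  have hgrid : L ≤ A * (n : ℝ) ^ ((2 : ℝ) / d) * L₀ := by
    by_contra! hlt
    have h1 := one_div_le_adaptiveRadius hd hp₀ hc hn hA1 hA hlt
    have h2 : 5 * c ≤ C * M := by linarith
    have h3 := mul_le_mul h2 h1 (by positivity) (by positivity)
    have e : 5 * c * (1 / (2 * c)) = 5 / 2 := by field_simp
    linarith
  -- the binning test at `L' = 2 ^ j * L₀` detects the alternative
  obtain ⟨j, hj, hjL, hj2⟩ := exists_lt_gridSize hA1 hn hL₀ hL hgrid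
  set L' := 2 ^ j * L₀ with hL'
  have hp₀' : IsLipDensity L' p₀ := hp₀.mono (hL.trans hjL)
  have hL'0 : 0 < L' := hL0.trans_le hjL
  have hww := adaptiveRadius_le_two_mul (n := n) hd hp₀ hc hn hL0 hL'0 hj2
  have hw'0 := (adaptiveRadius_spec (n := n) hd hp₀ hc hn hL'0).1
  have hpow := adaptiveRadius_pow (n := n) hd hp₀ hc hn hL'0
  have hlow := mul_log_le_mul_adaptiveRadius hd hp₀' hc hn
  set w := adaptiveRadius c n p₀ L
  -- the cap in the tuned separation is not active, since `‖p - p₀‖₁ ≤ 2`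
  have hεle : C / 2 * M * adaptiveRadius c n p₀ L' ≤ C * M * w := by
    have := mul_le_mul_of_nonneg_left hww (a := C / 2 * M) (by positivity)
    linarith
  have hεeq : tunedSeparation c C α ζ n p₀ L' = C / 2 * M * adaptiveRadius c n p₀ L' :=
    min_eq_right (hεle.trans hcap)
  set w' := adaptiveRadius c n p₀ L'
  set ε := C / 2 * M * w' with hε
  have hε0 : 0 < ε := by positivity
  have hε2 : ε ≤ 2 := hεle.trans hcap
  have hcw : c * w' ≤ ε / 512 := by
    have h1 : 1024 * c ≤ C * M := by linarith
    have h2 := mul_le_mul_of_nonneg_right h1 hw'0.le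
    rw [hε]
    linarith
  have hlow' := hlow (hcw.trans (by linarith))
  have hK : (0 : ℝ) < gridSize d A n := by exact_mod_cast gridSize_pos hA1 d hn
  have hK1 : (1 : ℝ) ≤ gridSize d A n := by exact_mod_cast gridSize_pos hA1 d hn
  have hKle := gridSize_le (n := n) hd hA1 hn
  set K : ℝ := (gridSize d A n : ℝ)
  refine (poissonProb_mono (R' := fun m => (binningTest n p₀ L' ε (α / K) m)ᶜ) fun m => ?_).trans
    (acceptProb_binningTest_le (M := K * M) hd hp₀' (hp.mono hjL) hε0 hε2
      (hεle.trans hsep') (by positivity) hζ (by nlinarith) ?_ ?_ ?_ ?_)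
  · refine Set.compl_subset_compl.2 ?_
    rw [← hεeq]
    exact Set.subset_biUnion_of_mem (u := fun i => binningTest n p₀ (2 ^ i * L₀)
      (tunedSeparation c C α ζ n p₀ (2 ^ i * L₀)) (α / gridSize d A n) m)
      (Finset.mem_coe.2 (Finset.mem_range.2 hj))
  · have e : K * M * (α / K) = M * α := by field_simp
    rw [e]
    exact hMα
  · rw [mul_assoc]
    exact one_le_mul_of_one_le_of_one_le hK1 hMζ
  · have h1 : 2 ^ 18 * gridConst A ≤ C * min (lowerConst d) 1 :=
      (div_le_iff₀ hκ).1 (by linarith)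
    calc 2 ^ 17 * (K * M) ≤ 2 ^ 17 * (gridConst A * Real.log n * M) := by gcongr
      _ = 2 ^ 18 * gridConst A * (M / 2 * Real.log n) := by ring
      _ ≤ C * min (lowerConst d) 1 * (M / 2 * Real.log n) := by gcongr
      _ = C / 2 * M * (min (lowerConst d) 1 * Real.log n) := by ring
      _ ≤ C / 2 * M * (n * w') := by gcongr
      _ = n * ε := by rw [hε]; ring
  · have hT : realT p₀ (ε / 512) ≤ realT p₀ (c * w') := realT_anti hd hp₀ (by positivity) hcw
    have hT0 := realT_nonneg p₀ (ε / 512)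
    have hCM2 : 1 ≤ C / 2 * M := by linarith
    have h1 : C / 2 * M ≤ (C / 2 * M) ^ ((4 + d : ℝ) / 2) :=
      Real.self_le_rpow_of_one_le hCM2 (by
        have : (0 : ℝ) ≤ d := d.cast_nonneg
        linarith)
    have hpow0 : 0 ≤ w' ^ ((4 + d : ℝ) / 2) := by positivity
    have h2 : 2 ^ 21 * powerConst d * gridConst A ≤ C / 2 := by linarith
    calc 2 ^ 21 * powerConst d * (K * M) * (L' ^ ((d : ℝ) / 2) * realT p₀ (ε / 512))
        ≤ 2 ^ 21 * powerConst d * (gridConst A * Real.log n * M) *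
          (L' ^ ((d : ℝ) / 2) * realT p₀ (c * w')) := by gcongr
      _ = 2 ^ 21 * powerConst d * gridConst A *
          (M * Real.log n * (L' ^ ((d : ℝ) / 2) * realT p₀ (c * w'))) := by ring
      _ ≤ C / 2 * (M * Real.log n * (L' ^ ((d : ℝ) / 2) * realT p₀ (c * w'))) := by
          have := hT0.trans hT
          gcongr
      _ = n * (C / 2 * M * w' ^ ((4 + d : ℝ) / 2)) := by
          rw [hpow]
          field_simp
      _ ≤ n * ((C / 2 * M) ^ ((4 + d : ℝ) / 2) * w' ^ ((4 + d : ℝ) / 2)) := by gcongr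
      _ = n * ε ^ ((4 + d : ℝ) / 2) := by rw [hε, Real.mul_rpow (by positivity) hw'0.le]

end Adaptive

end LipTest

end

theorem mainTheorem7 (d : ℕ) (hd : 1 ≤ d) :
    ∃ c₀ : ℝ, 0 < c₀ ∧ ∀ c : ℝ, 0 < c → c ≤ c₀ →
    ∃ A₀ : ℝ, 1 ≤ A₀ ∧ ∀ A : ℝ, A₀ ≤ A →
    ∃ C₀ : ℝ, 0 < C₀ ∧ ∀ C : ℝ, C₀ ≤ C →
    ∀ (α ζ : ℝ), 0 < α → 0 < ζ →
    ∀ (n : ℕ), 2 ≤ n →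
    ∀ (L₀ : ℝ) (p₀ : LipTest.Pt d → ℝ), LipTest.IsLipDensity L₀ p₀ →
      -- the adaptive critical radii are well defined
      (∀ L : ℝ, L₀ ≤ L → ∃! w : ℝ, LipTest.SolvesAdaptiveEq c n p₀ L w) ∧
      -- the adaptive Lipschitz test is a Borel measurable test
      (∀ m : ℕ, MeasurableSet (LipTest.adaptiveTest c A C α ζ n L₀ p₀ m)) ∧
      -- Type I error
      LipTest.rejectProb n p₀ (LipTest.adaptiveTest c A C α ζ n L₀ p₀) ≤ ENNReal.ofReal α ∧
      -- Type II error, for all alternatives in the union over the unknown `L ≥ L₀`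
      (∀ L : ℝ, L₀ ≤ L → ∀ p : LipTest.Pt d → ℝ, LipTest.IsLipDensity L p →
        LipTest.separation c C α ζ n p₀ L ≤ LipTest.l1Dist p p₀ →
        LipTest.acceptProb n p (LipTest.adaptiveTest c A C α ζ n L₀ p₀) ≤ ENNReal.ofReal ζ) := by
  refine ⟨1, one_pos, fun c hc _ => ⟨max 1 ((2 / LipTest.lowerConst d *
    (1 / (2 * c)) ^ ((4 + d : ℝ) / 2)) ^ 2), le_max_left _ _, fun A hA => ?_⟩⟩
  have hA1 : 1 ≤ A := (le_max_left _ _).trans hA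
  have hG := LipTest.gridConst_pos hA1
  have hP := LipTest.powerConst_pos hd
  have hκ : 0 < min (LipTest.lowerConst d) 1 := lt_min (LipTest.lowerConst_pos hd) one_pos
  have hC₀ : 0 < LipTest.sepConst d c A := by
    unfold LipTest.sepConst
    positivity
  refine ⟨LipTest.sepConst d c A, hC₀, fun C hC α ζ hα hζ n hn L₀ p₀ hp₀ =>
    ⟨fun L hL => ?_, fun m => ?_, ?_, fun L hL p hp hsep => ?_⟩⟩
  · exact LipTest.existsUnique_solvesAdaptiveEq hd hp₀ hc hn ((hp₀.lip_pos hd).trans_le hL)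
  · exact LipTest.measurableSet_adaptiveTest hd hp₀ hc hn A (hC₀.trans_le hC) hα m
  · exact LipTest.rejectProb_adaptiveTest_le hd hp₀ hc hn hA1 (hC₀.trans_le hC) hα
  · exact LipTest.acceptProb_adaptiveTest_le hd hp₀ hp hL hc hn hA1 ((le_max_right _ _).trans hA)
      hC hα hζ hsep
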